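/- Let $\mathbb{F}$ be a field. A symmetric sequence $\mathcal{X}$ is a functor from the groupoid of finite sets and bijections to $\mathbb{F}$-vector spaces; equivalently, it is a sequence $(\mathcal{X}_k)_{k\ge 0}$ of representations $\mathcal{X}_k=\mathcal{X}(\{1,\dots,k\})$ of the symmetric groups $\Sigma_k$. The tensor product of symmetric sequences is $(\mathcal{X}\otimes\mathcal{Y})_k=\bigoplus_{i+j=k}\mathrm{Ind}_{\Sigma_i\times\Sigma_j}^{\Sigma_k}\mathcal{X}_i\boxtimes\mathcal{Y}_j$; it is symmetric monoidal, so $\Sigma_d$ acts on $\mathcal{X}^{\otimes d}$ by permuting the factors. For a vector space $V$, write $V(1)$ for the symmetric sequence equal to $V$ in weight $1$ and zero in all other weights. For integers $m,n\ge 0$, let $\mathcal{S}_m=\bigoplus_{d\ge 0}\left(\mathbb{F}^m(1)^{\otimes d}\right)_{\Sigma_d}$ be the free twisted commutative algebra on $m$ generators of weight $1$, let $\mathcal{T}_1=\bigoplus_{d\ge 0}\mathbb{F}(1)^{\otimes d}$ be the free twisted algebra on one generator of weight $1$, and let $\mathcal{A}_n=\mathcal{T}_1^{\otimes n}$. For a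 partition $\lambda=(\lambda_1\ge\dots\ge\lambda_r>0)$, let $|\lambda|=\sum_i\lambda_i$, let $V_\lambda$ be the Specht module over $\mathbb{F}$ indexed by $\lambda$ (the left ideal of $\mathbb{F}[\Sigma_{|\lambda|}]$ generated by the Young symmetrizer), and for $k\ge|\lambda|+\lambda_1$ (where $\lambda_1=0$ if $\lambda=\varnothing$) let $\lambda[k]=(k-|\lambda|,\lambda_1,\dots,\lambda_r)$. Let $\mathrm{mul}_\lambda\,\mathcal{X}(k)=\dim\mathrm{Hom}_{\Sigma_k}(V_{\lambda[k]},\mathcal{X}_k)$ for $k\ge|\lambda|+\lambda_1$, and $\mathrm{mul}_\lambda\,\mathcal{X}(k)=0$ otherwise. For functions $f,g$ of $k$, $f\in o(g)$ means $f(k)/g(k)\to 0$ as $k\to\infty$. **Theorem.** Let $m,n\ge 0$. Every $(\mathcal{S}_m\otimes\mathcal{A}_n)_k$ is finite-dimensional, $\dim(\mathcal{S}_m\otimes\mathcal{A}_n)_k\in o(k^n\,k!)$, and more precisely \[ \dim(\mathcal{S}_m\otimes\mathcal{A}_n)_k=\begin{cases}\dfrac{e^m}{(n-1)!}\,k^{n-1}k!+o(k^{n-1}k!)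 & n>0,\\[1ex] m^k\ \text{ for every } k\ge 0 & n=0\end{cases} \] (with $0^0=1$). Suppose moreover that $\mathbb{F}$ has characteristic zero. Then $\mathrm{mul}_\lambda(\mathcal{S}_m\otimes\mathcal{A}_n)\in o(k^{|\lambda|}\,k^{m+n})$ for every partition $\lambda$. If $n>0$, then for every partition $\lambda$ \[ \mathrm{mul}_\lambda(\mathcal{S}_m\otimes\mathcal{A}_n)(k)=\frac{\dim V_\lambda}{(|\lambda|+m+n-1)!}\binom{|\lambda|+n-1}{n-1}k^{|\lambda|+m+n-1}+o\left(k^{|\lambda|+m+n-1}\right). \] If $n=0$ and $m>0$, then there are non-negative real constants $c_\lambda$, one for each partition $\lambda$ (they may depend on $m$), with $c_\varnothing=1$, such that for every partition $\lambda$ \[ \mathrm{mul}_\lambda(\mathcal{S}_m\otimes\mathcal{A}_0)(k)=\frac{c_\lambda}{(m-1)!}\,k^{m-1}+o\left(k^{m-1}\right). \] -/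

import Mathlib

open Asymptotics Filter
open scoped Nat TensorProduct

universe u

/-- A symmetric sequence over `F` (concentrated in degree `0`), presented as a functor from the
groupoid of finite sets and bijections to `F`-vector spaces. Its weight `k` part is the value at
`Fin k`, with the action of `Equiv.Perm (Fin k)` given by functoriality. -/
structure SymSeq (F : Type u) [Field F] where
  obj : (S : Type) → [Finite S] → Type u
  [addCommGroup : ∀ (S : Type) [Finite S], AddCommGroup (obj S)]
  [module : ∀ (S : Type) [Finite S], Module F (obj S)]
  map : {S T : Type} → [Finite S] → [Finite T] → (S ≃ T) → (obj S →ₗ[F] obj T)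
  map_refl : ∀ (S : Type) [Finite S], map (Equiv.refl S) = LinearMap.id
  map_trans : ∀ {S T U : Type} [Finite S] [Finite T] [Finite U] (e : S ≃ T) (e' : T ≃ U),
    map (e.trans e') = map e' ∘ₗ map e

attribute [instance] SymSeq.addCommGroup SymSeq.module

namespace SymSeq

variable {F : Type u} [Field F]

/-- The action of the symmetric group of `S` on the value of a symmetric sequence at `S`. -/
def rep (X : SymSeq F) (S : Type) [Finite S] : Representation F (Equiv.Perm S) (X.obj S) where
  toFun g := X.map g
  map_one' := X.map_refl S
  map_mul' g h := X.map_trans h g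

/-- The symmetric sequence `V(1)` concentrated in weight `1`: its value at `S` is (functions from a
one-point set to) `V` if `S` has exactly one element, and zero otherwise. -/
def weightOne (V : Type u) [AddCommGroup V] [Module F V] : SymSeq F where
  obj S _ := PLift (Nat.card S = 1) → V
  map e := LinearMap.funLeft F V (fun h => ⟨(Nat.card_congr e).trans h.down⟩)
  map_refl _ _ := rfl
  map_trans _ _ := rfl

section Tensor

/-- The bijection from the preimage of `B` to `B` induced by a bijection. -/
def preimageEquiv {S T : Type} (e : S ≃ T) (B : Set T) : (e ⁻¹' B : Set S) ≃ B :=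
  e.subtypeEquiv fun _ => Iff.rfl

/-- The tensor product of two symmetric sequences. The value at `S` is the direct sum over all
decompositions `S = A ⊔ Aᶜ` of `X(A) ⊗ Y(Aᶜ)`; for `S = Fin k` this is
`⨁_{i+j=k} Ind_{Σ_i × Σ_j}^{Σ_k} X_i ⊠ Y_j`. (There are finitely many decompositions,
so the direct sum is written as a product.) -/
noncomputable def tensor (X Y : SymSeq F) : SymSeq F where
  obj S _ := (A : Set S) → X.obj A ⊗[F] Y.obj (Aᶜ : Set S)
  map {S T} _ _ e := LinearMap.pi fun B : Set T =>
    TensorProduct.map (X.map (preimageEquiv e B)) (Y.map (preimageEquiv e Bᶜ)) ∘ₗ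
      LinearMap.proj (e ⁻¹' B)
  map_refl S _ := by
    refine LinearMap.ext fun x => funext fun B => ?_
    change TensorProduct.map (X.map (Equiv.refl B)) (Y.map (Equiv.refl (Bᶜ : Set S))) (x B) = x B
    rw [X.map_refl, Y.map_refl, TensorProduct.map_id, LinearMap.id_apply]
  map_trans {S T U} _ _ _ e e' := by
    refine LinearMap.ext fun x => funext fun B => ?_
    change TensorProduct.map
        (X.map ((preimageEquiv e (e' ⁻¹' B)).trans (preimageEquiv e' B)))
        (Y.map ((preimageEquiv e (e' ⁻¹' Bᶜ)).trans (preimageEquiv e' Bᶜ))) (x (e ⁻¹' (e' ⁻¹' B))) =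
      TensorProduct.map (X.map (preimageEquiv e' B)) (Y.map (preimageEquiv e' Bᶜ))
        (TensorProduct.map (X.map (preimageEquiv e (e' ⁻¹' B)))
          (Y.map (preimageEquiv e (e' ⁻¹' Bᶜ))) (x (e ⁻¹' (e' ⁻¹' B))))
    rw [X.map_trans, Y.map_trans, TensorProduct.map_comp, LinearMap.comp_apply]

/-- The fibre of `f` over `i`. -/
abbrev Fiber {S ι : Type} (f : S → ι) (i : ι) : Type := {s : S // f s = i}

/-- The bijection of fibres induced by a bijection of the source. -/
def fiberEquiv {S T ι : Type} (e : S ≃ T) (f : T → ι) (i : ι) : Fiber (f ∘ e) i ≃ Fiber f i :=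
  e.subtypeEquiv fun _ => Iff.rfl

/-- The tensor product of a finite family of symmetric sequences. The value at `S` is the direct
sum, over all ordered decompositions of `S` into blocks indexed by `ι` (that is, over all maps
`f : S → ι`, the blocks being the fibres), of the tensor products of the values at the blocks. -/
noncomputable def piTensor {ι : Type} [Finite ι] (X : ι → SymSeq F) : SymSeq F where
  obj S _ := (f : S → ι) → PiTensorProduct F fun i => (X i).obj (Fiber f i)
  map {S T} _ _ e := LinearMap.pi fun f : T → ι =>
    PiTensorProduct.map (fun i => (X i).map (fiberEquiv e f i)) ∘ₗ LinearMap.proj (f ∘ e)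
  map_refl S _ := by
    refine LinearMap.ext fun x => funext fun f => ?_
    change PiTensorProduct.map (fun i => (X i).map (Equiv.refl (Fiber f i))) (x f) = x f
    simp only [map_refl, PiTensorProduct.map_id, LinearMap.id_apply]
  map_trans {S T U} _ _ _ e e' := by
    refine LinearMap.ext fun x => funext fun f => ?_
    change PiTensorProduct.map
        (fun i => (X i).map ((fiberEquiv e (f ∘ e') i).trans (fiberEquiv e' f i)))
          (x ((f ∘ e') ∘ e)) =
      PiTensorProduct.map (fun i => (X i).map (fiberEquiv e' f i))
        (PiTensorProduct.map (fun i => (X i).map (fiberEquiv e (f ∘ e') i)) (x ((f ∘ e') ∘ e)))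
    simp only [map_trans, PiTensorProduct.map_comp, LinearMap.comp_apply]

end Tensor

/-- The direct sum of a sequence of symmetric sequences. -/
noncomputable def directSum (X : ℕ → SymSeq F) : SymSeq F where
  obj S _ := DirectSum ℕ fun d => (X d).obj S
  map e := DirectSum.lmap fun d => (X d).map e
  map_refl S _ := by simp only [map_refl, DirectSum.lmap_id]
  map_trans e e' := by simp only [map_trans, DirectSum.lmap_comp]

/-- The `d`th tensor power of a symmetric sequence. -/
noncomputable def tensorPower (X : SymSeq F) (d : ℕ) : SymSeq F :=
  piTensor fun _ : Fin d => X

/-- The bijection between the fibres of `τ⁻¹ ∘ f` over `τ⁻¹ i` and of `f` over `i`. -/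
def fiberPermEquiv {S : Type} {d : ℕ} (τ : Equiv.Perm (Fin d)) (f : S → Fin d) (i : Fin d) :
    Fiber (τ.symm ∘ f) (τ.symm i) ≃ Fiber f i :=
  (Equiv.refl S).subtypeEquiv fun _ => τ.symm.injective.eq_iff

/-- The action of `Σ_d` on the `d`th tensor power by permuting the tensor factors. -/
noncomputable def permRep (X : SymSeq F) (d : ℕ) (S : Type) [Finite S] :
    Representation F (Equiv.Perm (Fin d)) ((X.tensorPower d).obj S) where
  toFun τ := LinearMap.pi fun f : S → Fin d =>
    PiTensorProduct.map (fun i => X.map (fiberPermEquiv τ f i)) ∘ₗ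
      (PiTensorProduct.reindex F (fun i => X.obj (Fiber (τ.symm ∘ f) i)) τ).toLinearMap ∘ₗ
        LinearMap.proj (τ.symm ∘ f)
  map_one' := by
    refine LinearMap.ext fun x => funext fun f => ?_
    change PiTensorProduct.map (fun i => X.map (Equiv.refl (Fiber f i)))
      (PiTensorProduct.reindex F (fun i => X.obj (Fiber f i)) (Equiv.refl (Fin d)) (x f)) = x f
    simp only [map_refl, PiTensorProduct.map_id, PiTensorProduct.reindex_refl]
    rfl
  map_mul' τ ρ := by
    refine LinearMap.ext fun x => funext fun f => ?_
    change PiTensorProduct.map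
        (s := fun i => X.obj (Fiber (ρ.symm ∘ τ.symm ∘ f) ((τ * ρ).symm i)))
        (fun i => X.map ((fiberPermEquiv ρ (τ.symm ∘ f) (τ.symm i)).trans (fiberPermEquiv τ f i)))
        (PiTensorProduct.reindex F (fun i => X.obj (Fiber (ρ.symm ∘ τ.symm ∘ f) i)) (τ * ρ)
          (x (ρ.symm ∘ τ.symm ∘ f))) =
      PiTensorProduct.map (fun i => X.map (fiberPermEquiv τ f i))
        (PiTensorProduct.reindex F (fun i => X.obj (Fiber (τ.symm ∘ f) i)) τ
          (PiTensorProduct.map (fun i => X.map (fiberPermEquiv ρ (τ.symm ∘ f) i))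
            (PiTensorProduct.reindex F (fun i => X.obj (Fiber (ρ.symm ∘ τ.symm ∘ f) i)) ρ
              (x (ρ.symm ∘ τ.symm ∘ f)))))
    generalize x (ρ.symm ∘ τ.symm ∘ f) = y
    induction y using PiTensorProduct.induction_on with
    | smul_tprod r v =>
      simp only [map_smul, PiTensorProduct.reindex_tprod, PiTensorProduct.map_tprod]
      refine congrArg (fun w => r • PiTensorProduct.tprod F w) (funext fun i => ?_)
      exact LinearMap.congr_fun (X.map_trans (fiberPermEquiv ρ (τ.symm ∘ f) (τ.symm i))
        (fiberPermEquiv τ f i)) (v (ρ.symm (τ.symm i)))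
    | add a b ha hb => simp only [map_add, ha, hb]

/-- The actions of bijections on a tensor power commute with permuting the tensor factors. -/
theorem map_permRep (X : SymSeq F) (d : ℕ) {S T : Type} [Finite S] [Finite T] (e : S ≃ T)
    (τ : Equiv.Perm (Fin d)) :
    (X.tensorPower d).map e ∘ₗ X.permRep d S τ = X.permRep d T τ ∘ₗ (X.tensorPower d).map e := by
  refine LinearMap.ext fun x => funext fun f => ?_
  change PiTensorProduct.map (fun i => X.map (fiberEquiv e f i))
      (PiTensorProduct.map (fun i => X.map (fiberPermEquiv τ (f ∘ e) i))
        (PiTensorProduct.reindex F (fun i => X.obj (Fiber (τ.symm ∘ f ∘ e) i)) τ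
          (x (τ.symm ∘ f ∘ e)))) =
    PiTensorProduct.map (fun i => X.map (fiberPermEquiv τ f i))
      (PiTensorProduct.reindex F (fun i => X.obj (Fiber (τ.symm ∘ f) i)) τ
        (PiTensorProduct.map (fun i => X.map (fiberEquiv e (τ.symm ∘ f) i))
          (x (τ.symm ∘ f ∘ e))))
  generalize x (τ.symm ∘ f ∘ e) = y
  induction y using PiTensorProduct.induction_on with
  | smul_tprod r v =>
    simp only [map_smul, PiTensorProduct.reindex_tprod, PiTensorProduct.map_tprod]
    congr 2
    funext i
    exact (LinearMap.congr_fun (X.map_trans (fiberPermEquiv τ (f ∘ e) i) (fiberEquiv e f i))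
      (v (τ.symm i))).symm.trans (LinearMap.congr_fun (X.map_trans
        (fiberEquiv e (τ.symm ∘ f) (τ.symm i)) (fiberPermEquiv τ f i)) (v (τ.symm i)))
  | add a b ha hb => simp only [map_add, ha, hb]

/-- The `d`th symmetric power: the `Σ_d`-coinvariants of the `d`th tensor power. -/
noncomputable def symPower (X : SymSeq F) (d : ℕ) : SymSeq F where
  obj S _ := (X.permRep d S).Coinvariants
  map {S T} _ _ e := Representation.Coinvariants.map _ _
    ⟨(X.tensorPower d).map e, X.map_permRep d e⟩
  map_refl S _ := by
    refine Representation.Coinvariants.hom_ext (LinearMap.ext fun x => ?_)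
    exact congrArg (Representation.Coinvariants.mk (X.permRep d S))
      (LinearMap.congr_fun ((X.tensorPower d).map_refl S) x)
  map_trans {S T U} _ _ _ e e' := by
    refine Representation.Coinvariants.hom_ext (LinearMap.ext fun x => ?_)
    exact congrArg (Representation.Coinvariants.mk (X.permRep d U))
      (LinearMap.congr_fun ((X.tensorPower d).map_trans e e') x)

/-- The free twisted algebra `𝒯(X)` on `X` (its underlying symmetric sequence). -/
noncomputable def freeAlg (X : SymSeq F) : SymSeq F := directSum X.tensorPower

/-- The free twisted commutative algebra `𝒮(X)` on `X` (its underlying symmetric sequence). -/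
noncomputable def freeCommAlg (X : SymSeq F) : SymSeq F := directSum X.symPower

variable (F)

/-- `𝒮_m = 𝒮(F^m(1))`. -/
noncomputable def SS (m : ℕ) : SymSeq F := freeCommAlg (weightOne (Fin m → F))

/-- `𝒯_n = 𝒯(F^n(1))`. -/
noncomputable def TT (n : ℕ) : SymSeq F := freeAlg (weightOne (Fin n → F))

/-- `𝒜_n`, the `n`-fold tensor power of `𝒯_1`: the twisted algebra freely generated by `n`
intercommuting but not autocommuting generators of weight `1`. -/
noncomputable def AA (n : ℕ) : SymSeq F := tensorPower (TT F 1) n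

variable {F}

/-- The dimension of the weight `k` part. -/
noncomputable def dim (X : SymSeq F) (k : ℕ) : ℕ := Module.finrank F (X.obj (Fin k))

end SymSeq

/-! ### Specht modules and multiplicities. Partitions are represented by Young diagrams. -/

namespace YoungDiagram

/-- The Young symmetrizer `c_μ = a_μ b_μ` in the group algebra of the group of permutations of the
cells of `μ`; `a_μ` is the sum over the permutations preserving each row and `b_μ` the signed sum
over the permutations preserving each column. -/
noncomputable def youngSymmetrizer (F : Type u) [Field F] (μ : YoungDiagram) :
    MonoidAlgebra F (Equiv.Perm μ.cells) :=
  (∑ g : Equiv.Perm μ.cells with ∀ c, (g c).1.1 = c.1.1, MonoidAlgebra.single g 1) *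
    ∑ g : Equiv.Perm μ.cells with ∀ c, (g c).1.2 = c.1.2,
      MonoidAlgebra.single g ((Equiv.Perm.sign g : ℤ) : F)

/-- The Specht module `V_μ`: the left ideal of the group algebra generated by the Young
symmetrizer, as a representation of the group of permutations of the cells of `μ`. -/
noncomputable def specht (F : Type u) [Field F] (μ : YoungDiagram) :
    Subrepresentation (Representation.leftRegular F (Equiv.Perm μ.cells)) where
  toSubmodule := (Ideal.span {μ.youngSymmetrizer F}).restrictScalars F
  apply_mem_toSubmodule g v hv := by
    have h : Representation.leftRegular F (Equiv.Perm μ.cells) g v =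
        MonoidAlgebra.single g 1 * v := by
      clear hv
      induction v using MonoidAlgebra.induction_linear with
      | zero => simp
      | add a b ha hb => simp only [map_add, mul_add, ha, hb]
      | single a r => simp
    rw [h]
    exact Ideal.mul_mem_left _ _ hv

/-- The dimension of the Specht module `V_μ`. -/
noncomputable def dimSpecht (F : Type u) [Field F] (μ : YoungDiagram) : ℕ :=
  Module.finrank F (μ.specht F).toSubmodule

/-- The padded partition `λ[k] = (k - |λ|, λ_1, …, λ_m)`, defined for `k ≥ |λ| + λ_1`. -/
def padded (μ : YoungDiagram) (k : ℕ) (h : μ.card + μ.rowLen 0 ≤ k) : YoungDiagram :=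
  ofRowLens ((k - μ.card) :: μ.rowLens) (by
    have h0 : ∀ b ∈ μ.rowLens, b ≤ k - μ.card := by
      intro b hb
      simp only [rowLens, List.mem_map, List.mem_range] at hb
      obtain ⟨i, -, rfl⟩ := hb
      have := μ.rowLen_anti 0 i (Nat.zero_le i)
      omega
    exact (List.pairwise_cons.2 ⟨h0, μ.rowLens_sorted.pairwise⟩).sortedGE)

end YoungDiagram

namespace SymSeq

variable {F : Type u} [Field F]

/-- `mul X (μ) = dim Hom_{Σ_{|μ|}}(V_μ, X_{|μ|})`, where `Σ_{|μ|}` is realized as the group of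
permutations of the cells of `μ` and `X_{|μ|}` as the value of `X` at the set of cells. -/
noncomputable def mul (X : SymSeq F) (μ : YoungDiagram) : ℕ :=
  Module.finrank F
    (Representation.IntertwiningMap (μ.specht F).toRepresentation (X.rep μ.cells))

/-- The function `k ↦ mul X (λ[k])`, extended by zero to `k < |λ| + λ_1`. -/
noncomputable def mulPadded (X : SymSeq F) (μ : YoungDiagram) (k : ℕ) : ℕ :=
  if h : μ.card + μ.rowLen 0 ≤ k then X.mul (μ.padded k h) else 0

end SymSeq

/-! The sequence `𝒮_m ⊗ 𝒜_n` is a permutation representation in every weight. A basis of `𝒮_m(S)` is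
the set of colourings of `S` by `m` colours. A basis of `𝒜_n(S)` is the set of `n`-tuples of linear
orders on the blocks of a decomposition; concatenation turns such a tuple into one linear order on
`S` together with a weak composition of `|S|` into `n` parts. Gluing the two, the tensor product has
as basis the decorated placements: maps `h : S → Fin m ⊕ Fin b` hitting each label of `Fin b`
exactly once, with a decoration, on which permutations act trivially, from a set of size
`n.multichoose b`. Counting gives `dim / k! = ∑ m^j / j! · n.multichoose (k - j)`, and dominated
convergence gives the asymptotics of the dimension, over any field.

In characteristic zero the multiplicity of `V_μ` is the rank of the Young symmetrizer. For `λ[k]`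
the cells are `P ⊔ R`, with `P` the cells of `λ` and `R` the first row. Fix `b` and the type of a
placement, that is, the number of times each colour is used. The placements of this type agreeing on
`P` form one orbit of `Perm R`, so summing over `Perm R` amounts to restricting placements to words
on `P`. What remains is the row sum of `λ` after this restriction after the full column sum.

Two bounds follow. From above, the full column sum absorbs the column sum of `λ`, so the rank is at
most that of the symmetrizer of `λ` on all words. On injective words the action is free and a trace
computes the rank as the number of words times `dim V_λ / |λ|!`; the other words are of lower order
in `b`. From below, only injective words using the labels `≥ λ₁` are kept, with the labels `< λ₁`
placed at the top of the columns of `λ`: a column permutation moving a cell out of `P` brings a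
small label in, so its contribution disappears. Both bounds have leading term `b^|λ| dim V_λ /
|λ|!`. Summing against `n.multichoose b · m.multichoose (k - b)` gives the claim for `n > 0`.

For `n = 0` only `b = 0` survives. The rank for a given type is at most that of an operator on words
not involving `k`, with equality once every colour is used often enough. That rank is `c_λ`, and
almost all of the roughly `k^(m-1)/(m-1)!` types attain it. -/

/-- A contravariant assignment of a set of structures to each finite set. -/
structure StructureSpecies where
  obj : (S : Type) → [Finite S] → Type
  pull : {S T : Type} → [Finite S] → [Finite T] → (S ≃ T) → obj T → obj S

/-! ### Bases of products and direct sums -/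

/-- The basis of a finite product of modules given by bases of the factors. -/
noncomputable def Module.Basis.piFinite {F : Type*} [Field F] {η : Type*} [Finite η]
    {κ M : η → Type*} [∀ i, AddCommGroup (M i)] [∀ i, Module F (M i)]
    (b : ∀ i, Module.Basis (κ i) F (M i)) : Module.Basis (Σ i, κ i) F (∀ i, M i) :=
  letI := Fintype.ofFinite η
  Pi.basis b

theorem Module.Basis.piFinite_apply {F : Type*} [Field F] {η : Type*} [Finite η] [DecidableEq η]
    {κ M : η → Type*} [∀ i, AddCommGroup (M i)] [∀ i, Module F (M i)]
    (b : ∀ i, Module.Basis (κ i) F (M i)) (i : η) (j : κ i) :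
    Module.Basis.piFinite b ⟨i, j⟩ = Pi.single i (b i j) :=
  letI := Fintype.ofFinite η
  Pi.basis_apply b ⟨i, j⟩

/-- Bijections act on tensor products by reindexing the summands along an injection `w` and applying
a linear map to each. A basis vector supported at the summand `w j` therefore lands in the summand
`j` alone. -/
theorem Module.Basis.piFinite_map {F : Type*} [Field F] {η η' : Type*} [Finite η] [Finite η']
    {κ M : η → Type*} [∀ i, AddCommGroup (M i)] [∀ i, Module F (M i)]
    {κ' M' : η' → Type*} [∀ i, AddCommGroup (M' i)] [∀ i, Module F (M' i)]
    (b : ∀ i, Module.Basis (κ i) F (M i)) (c : ∀ i, Module.Basis (κ' i) F (M' i))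
    {w : η' → η} (hw : Function.Injective w) (g : ∀ j, M (w j) →ₗ[F] M' j)
    {j : η'} {k : κ (w j)} {l : κ' j} (h : g j (b (w j) k) = c j l) (j' : η') :
    g j' (Module.Basis.piFinite b ⟨w j, k⟩ (w j')) = Module.Basis.piFinite c ⟨j, l⟩ j' := by
  classical
  rw [Module.Basis.piFinite_apply, Module.Basis.piFinite_apply]
  by_cases hj : j' = j
  · subst hj
    rw [Pi.single_eq_same, Pi.single_eq_same, h]
  · rw [Pi.single_eq_of_ne (fun h' => hj (hw h')), Pi.single_eq_of_ne hj, map_zero]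

theorem DFinsupp.basis_mk {F : Type*} [Field F] {η : Type*} [DecidableEq η]
    {κ M : η → Type*} [∀ i, AddCommGroup (M i)] [∀ i, Module F (M i)]
    (b : ∀ i, Module.Basis (κ i) F (M i)) (i : η) (j : κ i) :
    DFinsupp.basis b ⟨i, j⟩ = DFinsupp.single i (b i j) := by
  classical
  rw [Module.Basis.apply_eq_iff]
  have : (DFinsupp.basis b).repr (DFinsupp.single i (b i j)) =
      (sigmaFinsuppLequivDFinsupp F).symm
        (DFinsupp.mapRange (fun i x => (b i).repr x) (fun i => map_zero _)
          (DFinsupp.single i (b i j))) := rfl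
  rw [this, DFinsupp.mapRange_single, LinearEquiv.symm_apply_eq]
  simp

theorem DFinsupp.basis_map {F : Type*} [Field F] {η : Type*} {κ M κ' M' : η → Type*}
    [∀ i, AddCommGroup (M i)] [∀ i, Module F (M i)] [∀ i, AddCommGroup (M' i)]
    [∀ i, Module F (M' i)] (b : ∀ i, Module.Basis (κ i) F (M i))
    (c : ∀ i, Module.Basis (κ' i) F (M' i)) (g : ∀ i, M i →ₗ[F] M' i) {i : η} {k : κ i} {l : κ' i}
    (h : g i (b i k) = c i l) :
    DFinsupp.mapRange.linearMap g (DFinsupp.basis b ⟨i, k⟩) = DFinsupp.basis c ⟨i, l⟩ := by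
  classical
  rw [DFinsupp.basis_mk, DFinsupp.basis_mk, DFinsupp.mapRange.linearMap_apply,
    DFinsupp.mapRange_single, h]

/-! ### Operations on species -/

namespace StructureSpecies

/-- The species of pairs of structures on a decomposition into two blocks. -/
def tensor (A B : StructureSpecies) : StructureSpecies where
  obj S _ := Σ U : Set S, A.obj U × B.obj (Uᶜ : Set S)
  pull e ω := ⟨e ⁻¹' ω.1, A.pull (SymSeq.preimageEquiv e ω.1) ω.2.1,
    B.pull (SymSeq.preimageEquiv e ω.1ᶜ) ω.2.2⟩

/-- The species of families of structures on the blocks of a decomposition. -/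
def piTensor {ι : Type} (A : ι → StructureSpecies) : StructureSpecies where
  obj S _ := Σ f : S → ι, ∀ i, (A i).obj (SymSeq.Fiber f i)
  pull e ω := ⟨ω.1 ∘ e, fun i => (A i).pull (SymSeq.fiberEquiv e ω.1 i) (ω.2 i)⟩

/-- The disjoint union of a sequence of species. -/
def sigma (A : ℕ → StructureSpecies) : StructureSpecies where
  obj S _ := Σ d, (A d).obj S
  pull e ω := ⟨ω.1, (A ω.1).pull e ω.2⟩

/-- The species of `m`-coloured points. -/
def point (m : ℕ) : StructureSpecies where
  obj S _ := Σ _ : PLift (Nat.card S = 1), Fin m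
  pull e ω := ⟨⟨(Nat.card_congr e).trans ω.1.down⟩, ω.2⟩

end StructureSpecies

/-! ### Bases permuted by bijections -/

namespace SymSeq

variable {F : Type u} [Field F]

/-- Bases of the values of a symmetric sequence that are permuted by bijections. -/
structure PermBasis (X : SymSeq F) (Ω : StructureSpecies) where
  basis : (S : Type) → [Finite S] → Module.Basis (Ω.obj S) F (X.obj S)
  map_basis : ∀ {S T : Type} [Finite S] [Finite T] (e : S ≃ T) (ω : Ω.obj T),
    X.map e (basis S (Ω.pull e ω)) = basis T ω

namespace PermBasis

/-- Transport of a permutation basis along an isomorphism of species. -/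
noncomputable def reindex {X : SymSeq F} {Ω Ω' : StructureSpecies} (b : PermBasis X Ω)
    (e : (S : Type) → [Finite S] → (Ω.obj S ≃ Ω'.obj S))
    (he : ∀ {S T : Type} [Finite S] [Finite T] (g : S ≃ T) (ω : Ω.obj T),
      e S (Ω.pull g ω) = Ω'.pull g (e T ω)) : PermBasis X Ω' where
  basis S _ := (b.basis S).reindex (e S)
  map_basis {S T} _ _ g ω := by
    obtain ⟨ω, rfl⟩ := (e T).surjective ω
    rw [← he, Module.Basis.reindex_apply, Module.Basis.reindex_apply, Equiv.symm_apply_apply,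
      Equiv.symm_apply_apply, b.map_basis]

noncomputable def tensor {X Y : SymSeq F} {A B : StructureSpecies} (a : PermBasis X A)
    (b : PermBasis Y B) : PermBasis (X.tensor Y) (A.tensor B) where
  basis S _ := Module.Basis.piFinite fun U : Set S =>
    (a.basis U).tensorProduct (b.basis (Uᶜ : Set S))
  map_basis {S T} _ _ e ω := by
    have h := a.map_basis (preimageEquiv e ω.1) ω.2.1
    have h' := b.map_basis (preimageEquiv e ω.1ᶜ) ω.2.2
    have key : TensorProduct.map (X.map (preimageEquiv e ω.1)) (Y.map (preimageEquiv e ω.1ᶜ))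
        (((a.basis _).tensorProduct (b.basis _))
          (A.pull (preimageEquiv e ω.1) ω.2.1, B.pull (preimageEquiv e ω.1ᶜ) ω.2.2)) =
        ((a.basis _).tensorProduct (b.basis _)) ω.2 := by
      rw [Module.Basis.tensorProduct_apply, TensorProduct.map_tmul, h, h',
        Module.Basis.tensorProduct_apply']
    exact funext <| Module.Basis.piFinite_map
      (fun U : Set S => (a.basis U).tensorProduct (b.basis (Uᶜ : Set S)))
      (fun U : Set T => (a.basis U).tensorProduct (b.basis (Uᶜ : Set T)))
      e.surjective.preimage_injective
      (fun U => TensorProduct.map (X.map (preimageEquiv e U)) (Y.map (preimageEquiv e Uᶜ))) key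

noncomputable def piTensor {ι : Type} [Finite ι] {X : ι → SymSeq F} {A : ι → StructureSpecies}
    (a : ∀ i, PermBasis (X i) (A i)) :
    PermBasis (SymSeq.piTensor X) (StructureSpecies.piTensor A) where
  basis S _ := Module.Basis.piFinite fun f : S → ι =>
    Basis.piTensorProduct fun i => (a i).basis (Fiber f i)
  map_basis {S T} _ _ e ω := by
    have h := fun i => (a i).map_basis (fiberEquiv e ω.1 i) (ω.2 i)
    have key : PiTensorProduct.map (fun i => (X i).map (fiberEquiv e ω.1 i))
        (Basis.piTensorProduct (fun i => (a i).basis (Fiber (ω.1 ∘ e) i))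
          fun i => (A i).pull (fiberEquiv e ω.1 i) (ω.2 i)) =
        Basis.piTensorProduct (fun i => (a i).basis (Fiber ω.1 i)) ω.2 := by
      rw [Basis.piTensorProduct_apply, PiTensorProduct.map_tprod, Basis.piTensorProduct_apply]
      simp only [h]
    exact funext <| Module.Basis.piFinite_map
      (fun f : S → ι => Basis.piTensorProduct fun i => (a i).basis (Fiber f i))
      (fun f : T → ι => Basis.piTensorProduct fun i => (a i).basis (Fiber f i))
      e.surjective.injective_comp_right
      (fun f => PiTensorProduct.map fun i => (X i).map (fiberEquiv e f i)) key

noncomputable def directSum {X : ℕ → SymSeq F} {A : ℕ → StructureSpecies}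
    (a : ∀ i, PermBasis (X i) (A i)) :
    PermBasis (SymSeq.directSum X) (StructureSpecies.sigma A) where
  basis S _ := DFinsupp.basis fun d => (a d).basis S
  map_basis e _ := DFinsupp.basis_map _ _ (fun d => (X d).map e) ((a _).map_basis _ _)

noncomputable def weightOne (m : ℕ) :
    PermBasis (SymSeq.weightOne (F := F) (Fin m → F)) (StructureSpecies.point m) where
  basis S _ := Module.Basis.piFinite fun _ : PLift (Nat.card S = 1) => Pi.basisFun F (Fin m)
  map_basis {S T} _ _ e _ := funext <| Module.Basis.piFinite_map
    (fun _ : PLift (Nat.card S = 1) => Pi.basisFun F (Fin m))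
    (fun _ : PLift (Nat.card T = 1) => Pi.basisFun F (Fin m))
    (w := fun h => ⟨(Nat.card_congr e).trans h.down⟩) (Function.injective_of_subsingleton _)
    (fun _ => LinearMap.id) rfl

end PermBasis
end SymSeq

/-- Coinvariants of a permutation module have the orbits as basis. The orbit set is given by a
labelling `q`: `h₁` says that it is invariant, `h₂` that it separates orbits. The two inverse maps
send a class to its label and a label to the class of any representative. -/
theorem Representation.exists_basis_coinvariants {F : Type*} [Field F] {G V : Type*} [Group G]
    [AddCommGroup V] [Module F V] (ρ : Representation F G V) {Ω Q : Type*}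
    (b : Module.Basis Ω F V) {q : Ω → Q} (hq : Function.Surjective q)
    (h₁ : ∀ g ω, ∃ ω', ρ g (b ω) = b ω' ∧ q ω' = q ω)
    (h₂ : ∀ ω ω', q ω = q ω' → ∃ g, ρ g (b ω) = b ω') :
    ∃ c : Module.Basis Q F ρ.Coinvariants, ∀ ω,
      c (q ω) = Representation.Coinvariants.mk ρ (b ω) := by
  have h₃ : ∀ ω ω', q ω = q ω' →
      Representation.Coinvariants.mk ρ (b ω) = Representation.Coinvariants.mk ρ (b ω') := by
    intro ω ω' h
    obtain ⟨g, hg⟩ := h₂ ω ω' h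
    rw [← hg]
    exact ((Representation.Coinvariants.mk_eq_iff ρ).2
      (Representation.Coinvariants.sub_mem_ker g (b ω))).symm
  let L : ρ.Coinvariants →ₗ[F] (Q →₀ F) := Representation.Coinvariants.lift ρ
    (b.constr F fun ω => Finsupp.single (q ω) 1) fun g => by
      refine b.ext fun ω => ?_
      obtain ⟨ω', h, h'⟩ := h₁ g ω
      rw [LinearMap.comp_apply, h, Module.Basis.constr_basis, Module.Basis.constr_basis, h']
  have hL : ∀ ω, L (Representation.Coinvariants.mk ρ (b ω)) = Finsupp.single (q ω) 1 :=
    fun ω => b.constr_basis F _ ω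
  let M : (Q →₀ F) →ₗ[F] ρ.Coinvariants :=
    Finsupp.linearCombination F fun t =>
      Representation.Coinvariants.mk ρ (b (Function.surjInv hq t))
  have hM : ∀ ω, M (Finsupp.single (q ω) 1) = Representation.Coinvariants.mk ρ (b ω) := by
    intro ω
    simp only [M, Finsupp.linearCombination_single, one_smul]
    exact h₃ _ _ (Function.surjInv_eq hq _)
  refine ⟨.ofRepr (LinearEquiv.ofLinearMap L M ?_ ?_), fun ω => ?_⟩
  · refine Finsupp.lhom_ext' fun t => LinearMap.ext_ring ?_
    obtain ⟨ω, rfl⟩ := hq t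
    simp only [LinearMap.comp_apply, Finsupp.lsingle_apply, LinearMap.id_apply, hM, hL]
  · refine Representation.Coinvariants.hom_ext (b.ext fun ω => ?_)
    simp only [LinearMap.comp_apply, hL, hM, LinearMap.id_apply]
  · rw [Module.Basis.apply_eq_iff]
    exact hL ω

/-! ### Colourings and linear orders as bases of the free algebras -/

namespace StructureSpecies

/-- The species of maps to `Fin m`. -/
def coloring (m : ℕ) : StructureSpecies where
  obj S _ := S → Fin m
  pull e c := c ∘ e

/-- The species of maps to `Fin m`, restricted to sets with `d` elements. -/
def coloringCard (m d : ℕ) : StructureSpecies where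
  obj S _ := Σ _ : PLift (Nat.card S = d), (S → Fin m)
  pull e ω := ⟨⟨(Nat.card_congr e).trans ω.1.down⟩, ω.2 ∘ e⟩

/-- The species of linear orders, given by the rank function. -/
noncomputable def linearOrder : StructureSpecies where
  obj S _ := {g : S → ℕ // Function.Injective g ∧ ∀ s, g s < Nat.card S}
  pull e g := ⟨g.1 ∘ e, g.2.1.comp e.injective,
    fun s => (g.2.2 (e s)).trans_eq (Nat.card_congr e).symm⟩

/-- The species of linear orders decorated by an element of a finite set whose size depends on the
number of points. -/
noncomputable def decoratedOrder (a : ℕ → ℕ) : StructureSpecies where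
  obj S _ := Fin (a (Nat.card S)) × linearOrder.obj S
  pull e ω := ⟨Fin.cast (by rw [Nat.card_congr e]) ω.1, linearOrder.pull e ω.2⟩

end StructureSpecies

namespace SymSeq

variable {F : Type u} [Field F]

theorem bijective_of_card_fiber {S ι : Type} [Finite S] (f : S → ι)
    (h : ∀ i, Nat.card (Fiber f i) = 1) : Function.Bijective f := by
  refine ⟨fun s t hst => ?_, fun i => ?_⟩
  · have := (Nat.card_eq_one_iff_unique.1 (h (f t))).1
    exact congrArg Subtype.val (Subsingleton.elim (⟨s, hst⟩ : Fiber f (f t)) ⟨t, rfl⟩)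
  · obtain ⟨s⟩ := (Nat.card_eq_one_iff_unique.1 (h i)).2
    exact ⟨s.1, s.2⟩

theorem card_fiber_equiv {S ι : Type} (f : S ≃ ι) (i : ι) : Nat.card (Fiber f i) = 1 := by
  refine Nat.card_eq_one_iff_unique.2 ⟨⟨fun s t => Subtype.ext (f.injective (s.2.trans t.2.symm))⟩,
    ⟨⟨f.symm i, f.apply_symm_apply i⟩⟩⟩

namespace PermBasis

/-- The fibres are singletons, and a structure on a singleton is just a colour. Hence permuting
tensor factors renames the blocks and carries each colour along with its block. -/
theorem permRep_weightOne (m d : ℕ) (S : Type) [Finite S] (τ : Equiv.Perm (Fin d))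
    (f : S → Fin d) (ω : ∀ i, (StructureSpecies.point m).obj (Fiber f i))
    (ω' : ∀ i, (StructureSpecies.point m).obj (Fiber (τ.symm ∘ f) i))
    (h : ∀ i, (ω' (τ.symm i)).2 = (ω i).2) :
    (SymSeq.weightOne (F := F) (Fin m → F)).permRep d S τ
      ((piTensor fun _ : Fin d => weightOne (F := F) m).basis S ⟨τ.symm ∘ f, ω'⟩) =
    (piTensor fun _ : Fin d => weightOne (F := F) m).basis S ⟨f, ω⟩ := by
  have h' : ∀ i, (SymSeq.weightOne (F := F) (Fin m → F)).map (fiberPermEquiv τ f i)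
      ((weightOne m).basis _ (ω' (τ.symm i))) = (weightOne m).basis _ (ω i) := by
    intro i
    rw [← (weightOne (F := F) m).map_basis (fiberPermEquiv τ f i) (ω i)]
    congr 2
    exact Sigma.ext (Subsingleton.elim _ _) (heq_of_eq (h i))
  have key : (PiTensorProduct.map (fun i => (SymSeq.weightOne (Fin m → F)).map
        (fiberPermEquiv τ f i)) ∘ₗ
      (PiTensorProduct.reindex F (fun i => (SymSeq.weightOne (Fin m → F)).obj
        (Fiber (τ.symm ∘ f) i)) τ).toLinearMap)
        (Basis.piTensorProduct (fun i => (weightOne m).basis (Fiber (τ.symm ∘ f) i)) ω') =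
      Basis.piTensorProduct (fun i => (weightOne m).basis (Fiber f i)) ω := by
    rw [Basis.piTensorProduct_apply, LinearMap.comp_apply, LinearEquiv.coe_coe,
      PiTensorProduct.reindex_tprod, PiTensorProduct.map_tprod, Basis.piTensorProduct_apply]
    simp only [h']
  exact funext <| Module.Basis.piFinite_map
    (fun f : S → Fin d => Basis.piTensorProduct fun i => (weightOne m).basis (Fiber f i))
    (fun f : S → Fin d => Basis.piTensorProduct fun i => (weightOne m).basis (Fiber f i))
    (w := fun f => τ.symm ∘ f) τ.symm.injective.comp_left
    (fun f => PiTensorProduct.map (fun i => (SymSeq.weightOne (Fin m → F)).map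
        (fiberPermEquiv τ f i)) ∘ₗ
      (PiTensorProduct.reindex F (fun i => (SymSeq.weightOne (Fin m → F)).obj
        (Fiber (τ.symm ∘ f) i)) τ).toLinearMap) key

/-- The colouring underlying a structure of type `point m` on each singleton block. -/
def coloringOfBlocks (m d : ℕ) (S : Type) [Finite S]
    (ω : (StructureSpecies.piTensor fun _ : Fin d => StructureSpecies.point m).obj S) :
    (StructureSpecies.coloringCard m d).obj S :=
  ⟨⟨(Nat.card_congr (Equiv.ofBijective ω.1
    (bijective_of_card_fiber ω.1 fun i => (ω.2 i).1.down))).trans (Nat.card_fin d)⟩,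
    fun s => (ω.2 (ω.1 s)).2⟩

theorem coloringOfBlocks_surjective (m d : ℕ) (S : Type) [Finite S] :
    Function.Surjective (coloringOfBlocks m d S) := by
  rintro ⟨⟨h⟩, c⟩
  let f : S ≃ Fin d := (Finite.equivFin S).trans (finCongr h)
  refine ⟨⟨f, fun i => ⟨⟨card_fiber_equiv f i⟩, c (f.symm i)⟩⟩, ?_⟩
  refine Sigma.ext (Subsingleton.elim _ _) (heq_of_eq (funext fun s => ?_))
  exact congrArg c (f.symm_apply_apply s)

/-- A basis vector of the tensor power is a bijection `S → Fin d` with a colour on each block. `Σ_d`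
acts transitively on such bijections, so an orbit remembers only the induced colouring of `S`. -/
theorem exists_basis_symPower (m d : ℕ) (S : Type) [Finite S] :
    ∃ c : Module.Basis ((StructureSpecies.coloringCard m d).obj S) F
      (((SymSeq.weightOne (F := F) (Fin m → F)).symPower d).obj S),
      ∀ ω, c (coloringOfBlocks m d S ω) = Representation.Coinvariants.mk _
        ((piTensor fun _ : Fin d => weightOne (F := F) m).basis S ω) := by
  refine Representation.exists_basis_coinvariants _ _ (coloringOfBlocks_surjective m d S) ?_ ?_
  · rintro τ ⟨f', ω'⟩
    obtain ⟨f, rfl⟩ : ∃ f, τ.symm ∘ f = f' := ⟨τ ∘ f', funext fun s => τ.symm_apply_apply _⟩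
    have hb : Function.Bijective f := by
      have := bijective_of_card_fiber _ fun i => (ω' i).1.down
      simpa using this
    refine ⟨⟨f, fun i => ⟨⟨card_fiber_equiv (Equiv.ofBijective f hb) i⟩, (ω' (τ.symm i)).2⟩⟩,
      permRep_weightOne m d S τ f _ _ fun i => rfl,
      Sigma.ext (Subsingleton.elim _ _) (heq_of_eq rfl)⟩
  · rintro ⟨f', ω'⟩ ⟨f, ω⟩ h
    have h : ∀ s, (ω' (f' s)).2 = (ω (f s)).2 := by
      intro s
      have := congrArg (fun x => x.2 s) h
      exact this
    have hf := bijective_of_card_fiber _ fun i => (ω i).1.down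
    obtain ⟨τ, rfl⟩ : ∃ τ : Equiv.Perm (Fin d), τ.symm ∘ f = f' := by
      -- The permutation taking one bijection to the other is forced; equality of the colourings of
      -- `S` then makes it match the block colours.
      let e' := Equiv.ofBijective f' (bijective_of_card_fiber _ fun i => (ω' i).1.down)
      let e := Equiv.ofBijective f hf
      refine ⟨e'.symm.trans e, funext fun s => ?_⟩
      change e' (e.symm (e s)) = e' s
      rw [e.symm_apply_apply]
    refine ⟨τ, permRep_weightOne m d S τ f _ _ fun i => ?_⟩
    obtain ⟨s, rfl⟩ := hf.surjective i
    exact h s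

noncomputable def symPower (m d : ℕ) : PermBasis
    ((SymSeq.weightOne (F := F) (Fin m → F)).symPower d) (StructureSpecies.coloringCard m d) where
  basis S _ := (exists_basis_symPower m d S).choose
  map_basis {S T} _ _ e ω := by
    obtain ⟨ω, rfl⟩ := coloringOfBlocks_surjective m d T ω
    have h := (exists_basis_symPower (F := F) m d T).choose_spec ω
    have h' := (exists_basis_symPower (F := F) m d S).choose_spec
      ((StructureSpecies.piTensor fun _ : Fin d => StructureSpecies.point m).pull e ω)
    refine Eq.trans ?_ h.symm
    rw [← (piTensor fun _ : Fin d => weightOne (F := F) m).map_basis e ω]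
    exact congrArg _ h'

/-- The degree `d` carries no information: it must equal `|S|`. -/
noncomputable def SS (m : ℕ) : PermBasis (SymSeq.SS F m) (StructureSpecies.coloring m) :=
  (directSum fun d => symPower (F := F) m d).reindex
    (fun S _ => ⟨fun ω => ω.2.2, fun c => ⟨Nat.card S, ⟨rfl⟩, c⟩, fun ω => by
      obtain ⟨d, ⟨h⟩, c⟩ := ω
      subst h
      rfl, fun _ => rfl⟩) fun _ _ => rfl

end PermBasis
end SymSeq

/-! ### Concatenation of linear orders -/

/-- The maps `Fin n → ℕ` of given sum. -/
abbrev WeakComposition (n k : ℕ) : Type := {l : Fin n → ℕ // ∑ i, l i = k}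

theorem WeakComposition.nonempty_equiv (n k : ℕ) :
    Nonempty (WeakComposition n k ≃ Fin (n.multichoose k)) := by
  have := (Sym.equivNatSumOfFintype (Fin n) k).symm.trans (Fintype.equivFin _)
  rw [Sym.card_sym_eq_multichoose, Fintype.card_fin] at this
  exact ⟨this⟩

/-- An enumeration of the weak compositions. -/
noncomputable def WeakComposition.equivFin (n k : ℕ) :
    WeakComposition n k ≃ Fin (n.multichoose k) := (WeakComposition.nonempty_equiv n k).some

theorem WeakComposition.equivFin_cast {n k k' : ℕ} (h : k = k') {l l' : Fin n → ℕ} (hl : l = l')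
    (hk : ∑ i, l i = k) (hk' : ∑ i, l' i = k') (h' : n.multichoose k = n.multichoose k') :
    WeakComposition.equivFin n k' ⟨l', hk'⟩ =
      Fin.cast h' (WeakComposition.equivFin n k ⟨l, hk⟩) := by
  subst h hl
  rfl

/-- The position of the `j`th element of the `i`th block in the concatenation of blocks of
sizes `l`. -/
def blockRank {n : ℕ} (l : Fin n → ℕ) (i : Fin n) (j : ℕ) : ℕ :=
  if h : j < l i then finSigmaFinEquiv ⟨i, ⟨j, h⟩⟩ else 0

theorem blockRank_lt {n : ℕ} {l : Fin n → ℕ} {i : Fin n} {j : ℕ} (h : j < l i) :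
    blockRank l i j < ∑ i, l i := by
  rw [blockRank, dif_pos h]
  exact Fin.is_lt _

theorem blockRank_inj {n : ℕ} {l : Fin n → ℕ} {i i' : Fin n} {j j' : ℕ} (h : j < l i)
    (h' : j' < l i') (heq : blockRank l i j = blockRank l i' j') : i = i' ∧ j = j' := by
  rw [blockRank, dif_pos h, blockRank, dif_pos h'] at heq
  have := finSigmaFinEquiv.injective (Fin.ext heq)
  simp only [Sigma.mk.injEq] at this
  obtain ⟨rfl, this⟩ := this
  exact ⟨rfl, by simpa using this⟩

theorem exists_blockRank_eq {n : ℕ} {l : Fin n → ℕ} {x : ℕ} (h : x < ∑ i, l i) :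
    ∃ i j, j < l i ∧ blockRank l i j = x := by
  obtain ⟨⟨i, j⟩, hij⟩ := finSigmaFinEquiv.surjective (⟨x, h⟩ : Fin (∑ i, l i))
  refine ⟨i, j, j.2, ?_⟩
  rw [blockRank, dif_pos j.2]
  exact congrArg Fin.val hij

namespace SymSeq

variable {F : Type u} [Field F]

theorem sum_card_fiber {S : Type} [Finite S] {n : ℕ} (f : S → Fin n) :
    ∑ i, Nat.card (Fiber f i) = Nat.card S := by
  rw [← Nat.card_sigma, Nat.card_congr (Equiv.sigmaFiberEquiv f)]

namespace PermBasis

/-- The linear order underlying a bijection to `Fin d`. -/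
noncomputable def orderOfBlocks (S : Type) [Finite S]
    (ω : (StructureSpecies.sigma fun d =>
      StructureSpecies.piTensor fun _ : Fin d => StructureSpecies.point 1).obj S) :
    StructureSpecies.linearOrder.obj S :=
  have h := bijective_of_card_fiber ω.2.1 fun i => (ω.2.2 i).1.down
  ⟨fun s => ω.2.1 s, Fin.val_injective.comp h.injective, fun s =>
    ((ω.2.1 s).2.trans_eq (Nat.card_fin _).symm).trans_eq
      (Nat.card_congr (Equiv.ofBijective _ h)).symm⟩

/-- All blocks are singletons, so the block map is a bijection and `d = |S|`; with a single colour
nothing else remains. -/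
theorem orderOfBlocks_bijective (S : Type) [Finite S] :
    Function.Bijective (orderOfBlocks S) := by
  constructor
  · rintro ⟨d, f, ω⟩ ⟨d', f', ω'⟩ h
    have h₁ := Nat.card_congr (Equiv.ofBijective f
      (bijective_of_card_fiber f fun i => (ω i).1.down))
    have h₂ := Nat.card_congr (Equiv.ofBijective f'
      (bijective_of_card_fiber f' fun i => (ω' i).1.down))
    obtain rfl : d = d' := by
      rw [h₁, Nat.card_fin, Nat.card_fin] at h₂
      exact h₂
    obtain rfl : f = f' := funext fun s => Fin.ext (congrFun (congrArg Subtype.val h) s)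
    obtain rfl : ω = ω' := funext fun i => Sigma.ext (Subsingleton.elim _ _)
      (heq_of_eq (Subsingleton.elim (α := Fin 1) _ _))
    rfl
  · rintro ⟨g, hg, hg'⟩
    let f : S → Fin (Nat.card S) := fun s => ⟨g s, hg' s⟩
    have hf : Function.Bijective f := by
      rw [Nat.bijective_iff_injective_and_card]
      exact ⟨fun s t h => hg (congrArg Fin.val h), (Nat.card_fin _).symm⟩
    exact ⟨⟨Nat.card S, f, fun i => ⟨⟨card_fiber_equiv (Equiv.ofBijective f hf) i⟩, 0⟩⟩, rfl⟩

noncomputable def TT_one : PermBasis (SymSeq.TT F 1) StructureSpecies.linearOrder :=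
  (directSum fun d => piTensor fun _ : Fin d => weightOne (F := F) 1).reindex
    (fun S _ => Equiv.ofBijective _ (orderOfBlocks_bijective S)) fun _ _ => rfl

/-- The concatenation of a family of linear orders on blocks, with the sizes of the blocks. -/
noncomputable def concatOrder (n : ℕ) (S : Type) [Finite S]
    (ω : (StructureSpecies.piTensor fun _ : Fin n => StructureSpecies.linearOrder).obj S) :
    (StructureSpecies.decoratedOrder n.multichoose).obj S :=
  ⟨WeakComposition.equivFin n (Nat.card S) ⟨fun i => Nat.card (Fiber ω.1 i), sum_card_fiber ω.1⟩,
    fun s => blockRank (fun i => Nat.card (Fiber ω.1 i)) (ω.1 s) ((ω.2 (ω.1 s)).1 ⟨s, rfl⟩), by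
      intro s t h
      obtain ⟨h, h'⟩ := blockRank_inj ((ω.2 (ω.1 s)).2.2 ⟨s, rfl⟩) ((ω.2 (ω.1 t)).2.2 ⟨t, rfl⟩) h
      have key : ∀ i (hs : ω.1 s = i), (ω.2 (ω.1 s)).1 ⟨s, rfl⟩ = (ω.2 i).1 ⟨s, hs⟩ := by
        rintro _ rfl
        rfl
      exact congrArg Subtype.val ((ω.2 _).2.1 ((key _ h).symm.trans h')), fun s =>
    (blockRank_lt ((ω.2 (ω.1 s)).2.2 ⟨s, rfl⟩)).trans_eq (sum_card_fiber ω.1)⟩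

/-- Once the block sizes are known, a position in the concatenation determines the block and the
rank within it. -/
theorem concatOrder_bijective (n : ℕ) (S : Type) [Finite S] :
    Function.Bijective (concatOrder n S) := by
  constructor
  · rintro ⟨f, ω⟩ ⟨f', ω'⟩ h
    have h₁ := congrArg Subtype.val ((WeakComposition.equivFin n _).injective (congrArg Prod.fst h))
    have h₂ := congrFun (congrArg Subtype.val (congrArg Prod.snd h))
    simp only [concatOrder] at h₁ h₂
    rw [← h₁] at h₂
    have h₃ := fun s => blockRank_inj ((ω (f s)).2.2 ⟨s, rfl⟩)
      (((ω' (f' s)).2.2 ⟨s, rfl⟩).trans_eq (congrFun h₁ _).symm) (h₂ s)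
    obtain rfl : f = f' := funext fun s => (h₃ s).1
    obtain rfl : ω = ω' := by
      refine funext fun i => Subtype.ext (funext fun s => ?_)
      obtain ⟨s, rfl⟩ := s
      exact (h₃ s).2
    rfl
  · rintro ⟨a, r, hr, hr'⟩
    obtain ⟨⟨l, hl⟩, rfl⟩ := (WeakComposition.equivFin n _).surjective a
    choose f j hj hfj using fun s => exists_blockRank_eq ((hr' s).trans_eq hl.symm)
    have hinj : ∀ i, Function.Injective fun s : Fiber f i => j s.1 := by
      intro i s t hst
      refine Subtype.ext (hr ?_)
      rw [← hfj, ← hfj, s.2, t.2]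
      exact congrArg _ hst
    have hcard : ∀ i, Nat.card (Fiber f i) ≤ l i := by
      intro i
      have := Nat.card_le_card_of_injective
        (fun s : Fiber f i => (⟨j s.1, (hj s.1).trans_eq (congrArg l s.2)⟩ : Fin (l i)))
        fun s t hst => hinj i (congrArg Fin.val hst)
      rwa [Nat.card_fin] at this
    have hfl : (fun i => Nat.card (Fiber f i)) = l := by
      -- The ranks embed each fibre into `Fin (l i)`, and the sizes have the same total as `l`, so
      -- all these inequalities are equalities.
      refine funext fun i => ?_
      refine (Finset.sum_eq_sum_iff_of_le fun i _ => hcard i).1 ?_ i (Finset.mem_univ i)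
      rw [sum_card_fiber, hl]
    refine ⟨⟨f, fun i => ⟨fun s => j s.1, hinj i, fun s => ?_⟩⟩, ?_⟩
    · exact (hj s.1).trans_eq ((congrArg l s.2).trans (congrFun hfl i).symm)
    · refine Prod.ext ?_ (Subtype.ext (funext fun s => ?_))
      · exact congrArg (WeakComposition.equivFin n (Nat.card S)) (Subtype.ext hfl)
      · change blockRank (fun i => Nat.card (Fiber f i)) (f s) (j s) = r s
        rw [hfl, hfj]

noncomputable def AA (n : ℕ) :
    PermBasis (SymSeq.AA F n) (StructureSpecies.decoratedOrder n.multichoose) :=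
  (piTensor fun _ : Fin n => TT_one (F := F)).reindex
    (fun S _ => Equiv.ofBijective _ (concatOrder_bijective n S)) fun {S T} _ _ e ω => by
      have h : (fun i => Nat.card (Fiber ω.1 i)) = fun i => Nat.card (Fiber (ω.1 ∘ e) i) :=
        funext fun i => (Nat.card_congr (fiberEquiv e ω.1 i)).symm
      refine Prod.ext (WeakComposition.equivFin_cast (Nat.card_congr e).symm h _ _
        (by rw [Nat.card_congr e]))
        (Subtype.ext (funext fun s => ?_))
      change blockRank (fun i => Nat.card (Fiber (ω.1 ∘ e) i)) _ _ =
        blockRank (fun i => Nat.card (Fiber ω.1 i)) _ _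
      rw [h]
      rfl

end PermBasis
end SymSeq

/-! ### Placements: a basis of the tensor product -/

/-- The maps `S → Fin m ⊕ Fin b` taking each value in `Fin b` exactly once. -/
abbrev Placement (m b : ℕ) (S : Type) : Type :=
  {h : S → Fin m ⊕ Fin b // ∀ j, ∃! s, h s = Sum.inr j}

namespace StructureSpecies

/-- The species of decorated placements. -/
def placement (m : ℕ) (a : ℕ → ℕ) : StructureSpecies where
  obj S _ := Σ b : ℕ, Fin (a b) × Placement m b S
  pull e ω := ⟨ω.1, ω.2.1, ω.2.2.1 ∘ e, fun j => by
    obtain ⟨s, hs, hs'⟩ := ω.2.2.2 j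
    exact ⟨e.symm s, by simpa using hs, fun t ht => (e.eq_symm_apply).2 (hs' _ ht)⟩⟩

theorem placement_ext {m : ℕ} {a : ℕ → ℕ} {S : Type} [Finite S] {b b' : ℕ} (hb : b = b')
    {i : Fin (a b)} {i' : Fin (a b')} (hi : (i : ℕ) = i') {h : Placement m b S}
    {h' : Placement m b' S} (hh : ∀ s, (h.1 s).map id Fin.val = (h'.1 s).map id Fin.val) :
    (⟨b, i, h⟩ : (placement m a).obj S) = ⟨b', i', h'⟩ := by
  subst hb
  obtain rfl := Fin.ext hi
  obtain rfl : h = h' := Subtype.ext (funext fun s =>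
    (Function.injective_id.sumMap Fin.val_injective) (hh s))
  rfl

end StructureSpecies

namespace SymSeq

variable {F : Type u} [Field F]

theorem existsUnique_rank_eq {S : Type} [Finite S] (g : StructureSpecies.linearOrder.obj S)
    (j : Fin (Nat.card S)) : ∃! s, g.1 s = j := by
  have h : Function.Bijective fun s => (⟨g.1 s, g.2.2 s⟩ : Fin (Nat.card S)) := by
    rw [Nat.bijective_iff_injective_and_card]
    exact ⟨fun s t h => g.2.1 (congrArg Fin.val h), (Nat.card_fin _).symm⟩
  simpa [Fin.ext_iff] using h.existsUnique j

namespace PermBasis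

open Classical in
/-- The map to `Fin m ⊕ ℕ` obtained by gluing a colouring and an order on complementary subsets. -/
noncomputable def glue {m : ℕ} {S : Type} [Finite S] (U : Set S) (c : U → Fin m)
    (g : StructureSpecies.linearOrder.obj (Uᶜ : Set S)) (s : S) :
    Fin m ⊕ Fin (Nat.card (Uᶜ : Set S)) :=
  if h : s ∈ U then Sum.inl (c ⟨s, h⟩) else Sum.inr ⟨g.1 ⟨s, h⟩, g.2.2 _⟩

theorem glue_mem {m : ℕ} {S : Type} [Finite S] (U : Set S) (c : U → Fin m)
    (g : StructureSpecies.linearOrder.obj (Uᶜ : Set S)) {s : S} (h : s ∈ U) :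
    glue U c g s = Sum.inl (c ⟨s, h⟩) := dif_pos h

theorem glue_notMem {m : ℕ} {S : Type} [Finite S] (U : Set S) (c : U → Fin m)
    (g : StructureSpecies.linearOrder.obj (Uᶜ : Set S)) {s : S} (h : s ∉ U) :
    glue U c g s = Sum.inr ⟨g.1 ⟨s, h⟩, g.2.2 _⟩ := dif_neg h

theorem isLeft_glue {m : ℕ} {S : Type} [Finite S] (U : Set S) (c : U → Fin m)
    (g : StructureSpecies.linearOrder.obj (Uᶜ : Set S)) (s : S) :
    (glue U c g s).isLeft = true ↔ s ∈ U := by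
  by_cases h : s ∈ U
  · simp [glue_mem U c g h, h]
  · simp [glue_notMem U c g h, h]

theorem existsUnique_glue {m : ℕ} {S : Type} [Finite S] (U : Set S) (c : U → Fin m)
    (g : StructureSpecies.linearOrder.obj (Uᶜ : Set S)) (j : Fin (Nat.card (Uᶜ : Set S))) :
    ∃! s, glue U c g s = Sum.inr j := by
  obtain ⟨s, hs, hs'⟩ := existsUnique_rank_eq g j
  refine ⟨s.1, ?_, fun t ht => ?_⟩
  · change glue U c g s = _
    rw [glue_notMem _ _ _ s.2]
    exact congrArg _ (Fin.ext hs)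
  · have ht' : t ∉ U := fun h => by
      exact Sum.inl_ne_inr ((glue_mem U c g h).symm.trans ht)
    replace ht := (glue_notMem U c g ht').symm.trans ht
    exact congrArg Subtype.val (hs' ⟨t, ht'⟩ (congrArg Fin.val (Sum.inr_injective ht)))

/-- The placement obtained from a colouring and an order on complementary subsets. -/
noncomputable def toPlacement (m : ℕ) (a : ℕ → ℕ) (S : Type) [Finite S]
    (ω : ((StructureSpecies.coloring m).tensor (StructureSpecies.decoratedOrder a)).obj S) :
    (StructureSpecies.placement m a).obj S :=
  ⟨Nat.card (ω.1ᶜ : Set S), ω.2.2.1, glue ω.1 ω.2.1 ω.2.2.2,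
    existsUnique_glue ω.1 ω.2.1 ω.2.2.2⟩

/-- The coloured part `U` is recovered as the set where the glued map takes values in `Fin m`; the
labels then give the order on the complement. -/
theorem toPlacement_bijective (m : ℕ) (a : ℕ → ℕ) (S : Type) [Finite S] :
    Function.Bijective (toPlacement m a S) := by
  constructor
  · rintro ⟨U, c, i, g⟩ ⟨U', c', i', g'⟩ h
    obtain rfl : U = U' := by
      ext s
      rw [← isLeft_glue U c g s, ← isLeft_glue U' c' g' s]
      exact (congrArg (fun x : (StructureSpecies.placement m a).obj S =>
        ((x.2.2.1 s).isLeft = true)) h).to_iff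
    have h := eq_of_heq (Sigma.mk.inj h).2
    obtain rfl : i = i' := congrArg Prod.fst h
    have h := congrFun (congrArg Subtype.val (congrArg Prod.snd h))
    obtain rfl : c = c' := funext fun s => Sum.inl_injective
      (((glue_mem U c g s.2).symm.trans (h s.1)).trans (glue_mem U c' g' s.2))
    obtain rfl : g = g' := Subtype.ext (funext fun s => congrArg Fin.val (Sum.inr_injective
      (((glue_notMem U c g s.2).symm.trans (h s.1)).trans (glue_notMem U c g' s.2))))
    rfl
  · rintro ⟨b, i, h, hh⟩
    obtain ⟨U, hU⟩ : ∃ U : Set S, ∀ s, s ∈ U ↔ (h s).isLeft = true := ⟨{s | _}, fun s => Iff.rfl⟩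
    have hU' : ∀ s : (Uᶜ : Set S), (h s.1).isRight = true := fun s => by
      have := (hU s.1).not.1 s.2
      simpa using this
    have hbij : Function.Bijective fun s : (Uᶜ : Set S) => (h s.1).getRight (hU' s) := by
      constructor
      · intro s t hst
        refine Subtype.ext ((hh _).unique (Sum.inr_getRight _ (hU' s)).symm ?_)
        exact (Sum.inr_getRight _ (hU' t)).symm.trans (congrArg Sum.inr hst.symm)
      · intro j
        obtain ⟨s, hs, -⟩ := hh j
        refine ⟨⟨s, fun h' => ?_⟩, ?_⟩
        · rw [hU, hs] at h'
          cases h'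
        · simp [hs]
    obtain rfl : b = Nat.card (Uᶜ : Set S) := by
      rw [Nat.card_congr (Equiv.ofBijective _ hbij), Nat.card_fin]
    refine ⟨⟨U, fun s => (h s.1).getLeft ((hU _).1 s.2), i, fun s => (h s.1).getRight (hU' s),
      Fin.val_injective.comp hbij.injective, fun s => Fin.is_lt _⟩, ?_⟩
    refine StructureSpecies.placement_ext rfl rfl fun s => congrArg _ ?_
    change glue _ _ _ _ = _
    by_cases hs : s ∈ U
    · rw [glue_mem _ _ _ hs, Sum.inl_getLeft]
    · rw [glue_notMem _ _ _ hs]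
      exact Sum.inr_getRight _ (hU' ⟨s, hs⟩)

noncomputable def decomposition (m n : ℕ) : PermBasis ((SymSeq.SS F m).tensor (SymSeq.AA F n))
    ((StructureSpecies.coloring m).tensor (StructureSpecies.decoratedOrder n.multichoose)) :=
  (SS m).tensor (AA n)

noncomputable def placement (m n : ℕ) : PermBasis ((SymSeq.SS F m).tensor (SymSeq.AA F n))
    (StructureSpecies.placement m n.multichoose) :=
  (decomposition m n).reindex (fun S _ => Equiv.ofBijective _ (toPlacement_bijective m _ S))
    fun {S T} _ _ e ω => by
      refine StructureSpecies.placement_ext (Nat.card_congr (preimageEquiv e ω.1ᶜ)) rfl fun s => ?_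
      by_cases hs : e s ∈ ω.1
      · exact (congrArg (Sum.map id Fin.val) (glue_mem (S := S) (e ⁻¹' ω.1) _ _ hs)).trans
          (congrArg (Sum.map id Fin.val) (glue_mem (S := T) ω.1 ω.2.1 ω.2.2.2 hs)).symm
      · exact (congrArg (Sum.map id Fin.val) (glue_notMem (S := S) (e ⁻¹' ω.1) _ _ hs)).trans
          (congrArg (Sum.map id Fin.val) (glue_notMem (S := T) ω.1 ω.2.1 ω.2.2.2 hs)).symm

end PermBasis

/-! ### The dimension formula -/

open Classical in
theorem card_linearOrder (S : Type) [Finite S] :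
    Nat.card (StructureSpecies.linearOrder.obj S) = (Nat.card S)! := by
  have := Fintype.ofFinite S
  let e : StructureSpecies.linearOrder.obj S ≃ (S ↪ Fin (Nat.card S)) :=
    { toFun g := ⟨fun s => ⟨g.1 s, g.2.2 s⟩, fun s t h => g.2.1 (congrArg Fin.val h)⟩
      invFun g := ⟨fun s => g s, Fin.val_injective.comp g.injective, fun s => (g s).2⟩
      left_inv _ := rfl
      right_inv _ := rfl }
  rw [Nat.card_congr e, Nat.card_eq_fintype_card, Fintype.card_embedding_eq, Fintype.card_fin,
    Nat.card_eq_fintype_card, Nat.descFactorial_self]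

instance (S : Type) [Finite S] : Finite (StructureSpecies.linearOrder.obj S) :=
  Nat.finite_of_card_ne_zero (card_linearOrder S ▸ Nat.factorial_ne_zero _)

instance (m : ℕ) (a : ℕ → ℕ) (S : Type) [Finite S] : Finite
    (((StructureSpecies.coloring m).tensor (StructureSpecies.decoratedOrder a)).obj S) :=
  inferInstanceAs (Finite (Σ U : Set S, (U → Fin m) ×
    (Fin (a (Nat.card (Uᶜ : Set S))) × StructureSpecies.linearOrder.obj (Uᶜ : Set S))))

instance (m : ℕ) (a : ℕ → ℕ) (S : Type) [Finite S] :
    Finite ((StructureSpecies.placement m a).obj S) :=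
  Finite.of_surjective _ (PermBasis.toPlacement_bijective m a S).surjective

theorem finite_obj (m n : ℕ) (S : Type) [Finite S] :
    Module.Finite F (((SS F m).tensor (AA F n)).obj S) :=
  .of_basis ((PermBasis.decomposition m n).basis S)

/-- The summand `j` counts the basis elements whose coloured part has `j` elements. Using
decompositions instead of placements makes this a sum over subsets depending only on their
cardinality. -/
theorem dim_eq (m n k : ℕ) : ((SS F m).tensor (AA F n)).dim k =
    ∑ j ∈ Finset.range (k + 1), k.choose j * (m ^ j * (n.multichoose (k - j) * (k - j)!)) := by
  classical
  rw [dim, Module.finrank_eq_nat_card_basis ((PermBasis.decomposition m n).basis (Fin k))]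
  change Nat.card (Σ U : Set (Fin k), (U → Fin m) ×
    (Fin (n.multichoose (Nat.card (Uᶜ : Set (Fin k))))
    × StructureSpecies.linearOrder.obj (Uᶜ : Set (Fin k)))) = _
  rw [Nat.card_sigma, ← Fintype.finsetEquivSet.sum_comp]
  have h : ∀ U : Finset (Fin k),
      Nat.card ((Fintype.finsetEquivSet U)ᶜ : Set (Fin k)) = k - U.card := by
    intro U
    rw [Fintype.coe_finsetEquivSet, ← Finset.coe_compl, Nat.card_eq_card_toFinset,
      Finset.toFinset_coe, Finset.card_compl, Fintype.card_fin]
  have h' : ∀ U : Finset (Fin k), Nat.card (Fintype.finsetEquivSet U) = U.card := by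
    intro U
    rw [Fintype.coe_finsetEquivSet]
    simp
  simp only [Nat.card_prod, Nat.card_fun, Nat.card_fin, card_linearOrder, h, h']
  have := Finset.sum_powerset_apply_card (fun j => m ^ j * (n.multichoose (k - j) * (k - j)!))
    (x := (Finset.univ : Finset (Fin k)))
  simpa using this

end SymSeq

/-! ### Ranks, traces and idempotents -/

section LinearAlgebra

variable {F : Type*} [Field F]

theorem LinearMap.finrank_range_comp_le_left {V W U : Type*} [AddCommGroup V] [Module F V]
    [AddCommGroup W] [Module F W] [AddCommGroup U] [Module F U] [Module.Finite F W]
    (f : W →ₗ[F] U) (g : V →ₗ[F] W) :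
    Module.finrank F (LinearMap.range (f ∘ₗ g)) ≤ Module.finrank F (LinearMap.range f) :=
  Submodule.finrank_mono (LinearMap.range_comp_le_range g f)

theorem LinearMap.finrank_range_comp_le_right {V W U : Type*} [AddCommGroup V] [Module F V]
    [AddCommGroup W] [Module F W] [AddCommGroup U] [Module F U] [Module.Finite F W]
    (f : W →ₗ[F] U) (g : V →ₗ[F] W) :
    Module.finrank F (LinearMap.range (f ∘ₗ g)) ≤ Module.finrank F (LinearMap.range g) := by
  rw [LinearMap.range_comp]
  exact Submodule.finrank_map_le f _

theorem LinearMap.trace_eq_sum_repr {V ι : Type*} [AddCommGroup V] [Module F V] [Fintype ι]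
    (b : Module.Basis ι F V) (f : V →ₗ[F] V) :
    LinearMap.trace F V f = ∑ i, b.repr (f (b i)) i := by
  classical
  rw [LinearMap.trace_eq_matrix_trace F b, Matrix.trace]
  simp [LinearMap.toMatrix_apply]

theorem LinearMap.trace_eq_finrank_range {V : Type*} [AddCommGroup V] [Module F V]
    [Module.Finite F V] {f : V →ₗ[F] V} (hf : IsIdempotentElem f) :
    LinearMap.trace F V f = Module.finrank F (LinearMap.range f) :=
  (LinearMap.IsIdempotentElem.isProj_range f hf).trace

end LinearAlgebra

namespace Representation

section Ideal

variable {F G : Type*} [Field F] [Group G]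

theorem leftRegular_apply_eq_single_mul (g : G) (x : MonoidAlgebra F G) :
    leftRegular F G g x = MonoidAlgebra.single g 1 * x := by
  induction x using MonoidAlgebra.induction_linear with
  | zero => simp
  | add a b ha hb => simp only [map_add, mul_add, ha, hb]
  | single a r => simp

/-- By Maschke's theorem the group algebra is semisimple, so every left ideal has an idempotent
generator. Using this generator avoids computing the scalar by which a Young symmetrizer is
quasi-idempotent. -/
theorem exists_idempotent [Finite G] [CharZero F] (c : MonoidAlgebra F G) :
    ∃ e x : MonoidAlgebra F G, e * e = e ∧ e = x * c ∧ c * e = c ∧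
      Ideal.span {c} = Ideal.span {e} := by
  obtain ⟨e, he, h⟩ := IsSemisimpleRing.ideal_eq_span_idempotent (Ideal.span {c})
  obtain ⟨x, hx⟩ := Ideal.mem_span_singleton'.1
    (h ▸ Ideal.mem_span_singleton_self e : e ∈ Ideal.span {c})
  obtain ⟨y, hy⟩ := Ideal.mem_span_singleton'.1
    (h ▸ Ideal.mem_span_singleton_self c : c ∈ Ideal.span {e})
  refine ⟨e, x, he, hx.symm, ?_, h⟩
  rw [← hy, mul_assoc, he.eq]

variable {V : Type*} [AddCommGroup V] [Module F V] (ρ : Representation F G V)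

/-- Each of `c` and `e` factors through the other on the right, so each rank bounds the other. -/
theorem finrank_range_eq_of_idempotent [Module.Finite F V] {c e x : MonoidAlgebra F G}
    (h : e = x * c) (h' : c * e = c) :
    Module.finrank F (LinearMap.range (ρ.asAlgebraHom c)) =
      Module.finrank F (LinearMap.range (ρ.asAlgebraHom e)) := by
  apply le_antisymm
  · rw [← h', map_mul]
    exact LinearMap.finrank_range_comp_le_right _ _
  · rw [h, map_mul]
    exact LinearMap.finrank_range_comp_le_right _ _

theorem IntertwiningMap.map_mul_of_leftRegular {W : Subrepresentation (leftRegular F G)}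
    (f : IntertwiningMap W.toRepresentation ρ) (y w : MonoidAlgebra F G) (hw : w ∈ W.toSubmodule)
    (hyw : y * w ∈ W.toSubmodule) : f ⟨y * w, hyw⟩ = ρ.asAlgebraHom y (f ⟨w, hw⟩) := by
  have key : ∀ y : MonoidAlgebra F G, ∃ h : y * w ∈ W.toSubmodule,
      f ⟨y * w, h⟩ = ρ.asAlgebraHom y (f ⟨w, hw⟩) := by
    intro y
    induction y using MonoidAlgebra.induction_linear with
    | zero =>
      refine ⟨by simp, ?_⟩
      simp only [zero_mul, map_zero, LinearMap.zero_apply]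
      exact map_zero f
    | add a b ha hb =>
      obtain ⟨ha, ha'⟩ := ha
      obtain ⟨hb, hb'⟩ := hb
      refine ⟨by rw [add_mul]; exact add_mem ha hb, ?_⟩
      rw [map_add, LinearMap.add_apply, ← ha', ← hb', ← map_add]
      congr 1
      exact Subtype.ext (add_mul a b w)
    | single g r =>
      have hg : MonoidAlgebra.single g r * w = r • leftRegular F G g w := by
        rw [leftRegular_apply_eq_single_mul, ← smul_mul_assoc, MonoidAlgebra.smul_single,
          smul_eq_mul, mul_one]
      have hm := W.apply_mem_toSubmodule g hw
      refine ⟨hg ▸ W.toSubmodule.smul_mem r hm, ?_⟩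
      rw [asAlgebraHom_single, LinearMap.smul_apply, ← f.isIntertwining]
      exact (congrArg f (Subtype.ext hg : (⟨_, _⟩ : W.toSubmodule) =
        r • W.toRepresentation g ⟨w, hw⟩)).trans (map_smul f r _)
  exact (key y).2

/-- Homomorphisms from a left ideal generated by an idempotent `e` are classified by the image
of `e`. -/
noncomputable def homIdealEquiv (W : Subrepresentation (leftRegular F G)) {e : MonoidAlgebra F G}
    (he : e * e = e) (hW : W.toSubmodule = (Ideal.span {e}).restrictScalars F) :
    IntertwiningMap W.toRepresentation ρ ≃ₗ[F] LinearMap.range (ρ.asAlgebraHom e) :=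
  have hmem : ∀ y, y * e ∈ W.toSubmodule := fun y => by
    rw [hW]
    exact Ideal.mul_mem_left _ y (Ideal.mem_span_singleton_self e)
  have hmem' : e ∈ W.toSubmodule := by simpa [he] using hmem e
  have hright : ∀ w ∈ W.toSubmodule, w * e = w := fun w hw => by
    rw [hW] at hw
    obtain ⟨y, rfl⟩ := Ideal.mem_span_singleton'.1 hw
    rw [mul_assoc, he]
  -- Evaluation at the generator: `f e = f (e * e) = e • f e` lies in the image of `e`, and `w ↦ w •
  -- v` is the homomorphism with value `v` at `e` when `v` is in that image.
  let ev : IntertwiningMap W.toRepresentation ρ →ₗ[F] LinearMap.range (ρ.asAlgebraHom e) :=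
    { toFun f := ⟨f ⟨e, hmem'⟩, f ⟨e, hmem'⟩, by
        rw [← f.map_mul_of_leftRegular ρ e e hmem' (hmem e)]
        congr 1
        exact Subtype.ext he⟩
      map_add' _ _ := rfl
      map_smul' _ _ := rfl }
  LinearEquiv.ofBijective ev
    (by
      constructor
      · intro f f' h
        have h : f ⟨e, hmem'⟩ = f' ⟨e, hmem'⟩ := congrArg Subtype.val h
        refine IntertwiningMap.ext (LinearMap.ext fun w => ?_)
        have hw : w = ⟨w.1 * e, hmem _⟩ := Subtype.ext (hright _ w.2).symm
        change f w = f' w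
        rw [hw, f.map_mul_of_leftRegular ρ _ e hmem', f'.map_mul_of_leftRegular ρ _ e hmem', h]
      · rintro ⟨_, v, rfl⟩
        refine ⟨⟨{ toFun w := ρ.asAlgebraHom w.1 (ρ.asAlgebraHom e v)
                   map_add' _ _ := by simp
                   map_smul' _ _ := by simp }, fun g => LinearMap.ext fun w => ?_⟩, ?_⟩
        · change ρ.asAlgebraHom (leftRegular F G g w.1) _ = ρ g (ρ.asAlgebraHom w.1 _)
          rw [leftRegular_apply_eq_single_mul, map_mul, asAlgebraHom_single_one]
          rfl
        · refine Subtype.ext ?_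
          change ρ.asAlgebraHom e (ρ.asAlgebraHom e v) = ρ.asAlgebraHom e v
          rw [← Module.End.mul_apply, ← map_mul, he])

theorem finrank_intertwiningMap_ideal [Finite G] [CharZero F] [Module.Finite F V]
    (W : Subrepresentation (leftRegular F G)) (c : MonoidAlgebra F G)
    (hW : W.toSubmodule = (Ideal.span {c}).restrictScalars F) :
    Module.finrank F (IntertwiningMap W.toRepresentation ρ) =
      Module.finrank F (LinearMap.range (ρ.asAlgebraHom c)) := by
  obtain ⟨e, x, he, hx, hc, hs⟩ := exists_idempotent c
  rw [finrank_range_eq_of_idempotent ρ hx hc]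
  exact (homIdealEquiv ρ W he (hW.trans (by rw [hs]))).finrank_eq

end Ideal

/-! ### Permutation modules and free actions -/

section Permutation

variable (F : Type*) [Field F] (G : Type*) [Group G] (α : Type*) [MulAction G α]

/-- The permutation representation on finitely supported functions. -/
noncomputable def perm : Representation F G (α →₀ F) where
  toFun g := Finsupp.lmapDomain F F (g • ·)
  map_one' := by
    refine Finsupp.lhom_ext fun a r => ?_
    simp
  map_mul' g h := by
    refine Finsupp.lhom_ext fun a r => ?_
    simp [mul_smul]

variable {F G α}

theorem perm_single (g : G) (a : α) (r : F) :
    perm F G α g (Finsupp.single a r) = Finsupp.single (g • a) r :=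
  Finsupp.mapDomain_single

/-- Only the identity has fixed points, so no other group element contributes to the diagonal. -/
theorem trace_perm_of_free [Finite G] [Fintype α] (hα : ∀ (g : G) (a : α), g • a = a → g = 1)
    (x : MonoidAlgebra F G) :
    LinearMap.trace F (α →₀ F) ((perm F G α).asAlgebraHom x) = Fintype.card α * x.coeff 1 := by
  classical
  induction x using MonoidAlgebra.induction_linear with
  | zero => simp
  | add a b ha hb => simp [map_add, ha, hb, mul_add]
  | single g r =>
    rw [asAlgebraHom_single, map_smul, LinearMap.trace_eq_sum_repr Finsupp.basisSingleOne]
    simp only [Finsupp.coe_basisSingleOne, perm_single, Finsupp.basisSingleOne_repr,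
      LinearEquiv.refl_apply, Finsupp.single_apply]
    by_cases hg : g = 1
    · subst hg
      simp [mul_comm]
    · have : ∀ a : α, g • a ≠ a := fun a ha => hg (hα g a ha)
      simp [this, hg]

theorem trace_mulRight [Fintype G] (x : MonoidAlgebra F G) :
    LinearMap.trace F (MonoidAlgebra F G) (LinearMap.mulRight F x) =
      Fintype.card G * x.coeff 1 := by
  classical
  rw [LinearMap.trace_eq_sum_repr (Module.Basis.ofRepr (MonoidAlgebra.coeffLinearEquiv F))]
  have : ∀ g : G, (MonoidAlgebra.coeffLinearEquiv F) ((LinearMap.mulRight F x)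
      ((MonoidAlgebra.coeffLinearEquiv F).symm (Finsupp.single g 1))) g = x.coeff 1 := by
    intro g
    simp
  exact (Finset.sum_congr rfl fun g _ => this g).trans (by simp)

/-- Replace `c` by an idempotent generator `e` of its left ideal, which is the image of right
multiplication by `e`. The rank of an idempotent is its trace, and both traces are multiples of the
coefficient of `e` at `1`, by `|α|` and `|G|` respectively. -/
theorem card_mul_finrank_range_perm [Fintype G] [CharZero F] [Fintype α]
    (hα : ∀ (g : G) (a : α), g • a = a → g = 1) (c : MonoidAlgebra F G) :
    Fintype.card G * Module.finrank F (LinearMap.range ((perm F G α).asAlgebraHom c)) =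
      Fintype.card α * Module.finrank F ((Ideal.span {c}).restrictScalars F) := by
  obtain ⟨e, x, he, hx, hc, hs⟩ := exists_idempotent c
  have h₁ : (Ideal.span {c}).restrictScalars F = LinearMap.range (LinearMap.mulRight F e) := by
    ext y
    rw [hs, Submodule.restrictScalars_mem, Ideal.mem_span_singleton']
    rfl
  have h₂ := LinearMap.trace_eq_finrank_range (f := LinearMap.mulRight F e)
    (LinearMap.ext fun y => by simp [mul_assoc, he])
  have h₃ := LinearMap.trace_eq_finrank_range (f := (perm F G α).asAlgebraHom e)
    (by rw [IsIdempotentElem, ← map_mul, he])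
  rw [trace_mulRight] at h₂
  rw [trace_perm_of_free hα] at h₃
  rw [finrank_range_eq_of_idempotent _ hx hc, h₁, ← Nat.cast_inj (R := F), Nat.cast_mul,
    Nat.cast_mul, ← h₂, ← h₃]
  ring

end Permutation

end Representation

/-! ### Ranks under isomorphisms, direct sums and orbit sums -/

section LinearAlgebra

variable {F : Type*} [Field F]

theorem LinearMap.finrank_range_of_comm {V W : Type*} [AddCommGroup V] [Module F V]
    [AddCommGroup W] [Module F W] (L : V ≃ₗ[F] W) {f : V →ₗ[F] V} {g : W →ₗ[F] W}
    (h : ∀ v, L (f v) = g (L v)) :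
    Module.finrank F (LinearMap.range f) = Module.finrank F (LinearMap.range g) := by
  have : LinearMap.range g = (LinearMap.range f).map (L : V →ₗ[F] W) := by
    ext w
    constructor
    · rintro ⟨w, rfl⟩
      exact ⟨f (L.symm w), ⟨_, rfl⟩, by simp [h]⟩
    · rintro ⟨_, ⟨v, rfl⟩, rfl⟩
      exact ⟨L v, (h v).symm⟩
  rw [this]
  exact (LinearEquiv.finrank_map_eq L _).symm

theorem LinearMap.finrank_range_pi {ι : Type*} [Fintype ι] {V : ι → Type*}
    [∀ i, AddCommGroup (V i)] [∀ i, Module F (V i)] [∀ i, Module.Finite F (V i)]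
    (f : ∀ i, V i →ₗ[F] V i) :
    Module.finrank F (LinearMap.range (LinearMap.pi fun i => f i ∘ₗ LinearMap.proj i)) =
      ∑ i, Module.finrank F (LinearMap.range (f i)) := by
  rw [← Module.finrank_pi_fintype]
  let g : (∀ i, LinearMap.range (f i)) →ₗ[F] ∀ i, V i :=
    LinearMap.pi fun i => (LinearMap.range (f i)).subtype ∘ₗ LinearMap.proj i
  have hg : Function.Injective g := fun a b h => funext fun i => Subtype.ext (congrFun h i)
  rw [← LinearMap.finrank_range_of_inj hg]
  suffices h : LinearMap.range (LinearMap.pi fun i => f i ∘ₗ LinearMap.proj i) =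
      LinearMap.range g by rw [h]
  ext w
  constructor
  · rintro ⟨v, rfl⟩
    exact ⟨fun i => ⟨f i (v i), v i, rfl⟩, rfl⟩
  · rintro ⟨v, rfl⟩
    choose u hu using fun i => (v i).2
    exact ⟨u, funext hu⟩

end LinearAlgebra

namespace Representation

variable {F G : Type*} [Field F] [Group G] {α β Y : Type*} [MulAction G α] [MulAction G β]

theorem lmapDomain_perm {H : Type*} [Group H] {Y : Type*} [MulAction H Y] {θ : α → Y} {g : G}
    {h : H} (hθ : ∀ a, θ (g • a) = h • θ a) (v : α →₀ F) :
    Finsupp.lmapDomain F F θ (perm F G α g v) = perm F H Y h (Finsupp.lmapDomain F F θ v) := by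
  induction v using Finsupp.induction_linear with
  | zero => simp
  | add a b ha hb => simp only [map_add, ha, hb]
  | single a r =>
    rw [perm_single, Finsupp.lmapDomain_apply, Finsupp.lmapDomain_apply, Finsupp.mapDomain_single,
      Finsupp.mapDomain_single, perm_single, hθ]

/-- A linear map commuting with group elements commutes with the group algebra. -/
theorem asAlgebraHom_comm {V W : Type*} [AddCommGroup V] [Module F V] [AddCommGroup W] [Module F W]
    {ρ : Representation F G V} {σ : Representation F G W} (L : V →ₗ[F] W)
    (h : ∀ g v, L (ρ g v) = σ g (L v)) (x : MonoidAlgebra F G) (v : V) :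
    L (ρ.asAlgebraHom x v) = σ.asAlgebraHom x (L v) := by
  induction x using MonoidAlgebra.induction_linear with
  | zero => simp
  | add a b ha hb => simp only [map_add, LinearMap.add_apply, ha, hb]
  | single g r => simp [h]

theorem finrank_range_perm_congr (e : α ≃ β) (he : ∀ (g : G) (a : α), e (g • a) = g • e a)
    (x : MonoidAlgebra F G) :
    Module.finrank F (LinearMap.range ((perm F G α).asAlgebraHom x)) =
      Module.finrank F (LinearMap.range ((perm F G β).asAlgebraHom x)) :=
  LinearMap.finrank_range_of_comm (Finsupp.domLCongr e) fun v =>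
    asAlgebraHom_comm (Finsupp.domLCongr e : (α →₀ F) ≃ₗ[F] (β →₀ F)).toLinearMap (fun g v => by
      have := lmapDomain_perm (F := F) (he g) v
      simpa [Finsupp.domLCongr, Finsupp.equivMapDomain_eq_mapDomain] using this) x v

theorem finrank_range_perm_sigma {ι : Type*} [Fintype ι] {γ : ι → Type*} [∀ i, MulAction G (γ i)]
    [∀ i, Finite (γ i)] (e : (Σ i, γ i) ≃ α) (he : ∀ (g : G) i a, e ⟨i, g • a⟩ = g • e ⟨i, a⟩)
    (x : MonoidAlgebra F G) :
    Module.finrank F (LinearMap.range ((perm F G α).asAlgebraHom x)) =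
      ∑ i, Module.finrank F (LinearMap.range ((perm F G (γ i)).asAlgebraHom x)) := by
  classical
  rw [← LinearMap.finrank_range_pi]
  let L : (α →₀ F) ≃ₗ[F] ∀ i, γ i →₀ F :=
    (Finsupp.domLCongr e.symm).trans (Finsupp.sigmaFinsuppLEquivPiFinsupp F)
  have hL : ∀ i a r, L (Finsupp.single (e ⟨i, a⟩) r) = Pi.single i (Finsupp.single a r) := by
    intro i a r
    refine funext fun j => Finsupp.ext fun b => ?_
    simp only [L, LinearEquiv.trans_apply, Finsupp.domLCongr_single,
      Finsupp.sigmaFinsuppLEquivPiFinsupp_apply]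
    rw [show e.symm (e ⟨i, a⟩) = ⟨i, a⟩ from e.symm_apply_apply _]
    by_cases h : j = i
    · subst h
      simp [Finsupp.single_apply]
    · rw [Pi.single_eq_of_ne h, Finsupp.single_eq_of_ne]
      · rfl
      · rintro ⟨⟩
        exact h rfl
  refine LinearMap.finrank_range_of_comm L fun v => funext fun i => ?_
  refine asAlgebraHom_comm ((LinearMap.proj i).comp L.toLinearMap) (fun g v => ?_) x v
  induction v using Finsupp.induction_linear with
  | zero => simp
  | add a b ha hb => simp only [map_add, ha, hb]
  | single a r =>
    obtain ⟨⟨j, a⟩, rfl⟩ := e.surjective a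
    rw [perm_single, ← he]
    simp only [LinearMap.comp_apply, LinearEquiv.coe_coe, hL, LinearMap.proj_apply]
    by_cases h : i = j
    · subst h
      rw [Pi.single_eq_same, Pi.single_eq_same, perm_single]
    · rw [Pi.single_eq_of_ne h, Pi.single_eq_of_ne h, map_zero]

/-- The sum over a group of its translates on a permutation module has the same rank, after any
operator, as the map induced by a map whose fibres are the orbits. -/
theorem finrank_range_orbitSum_comp [CharZero F] {H : Type*} [Group H] [Fintype H] (s : H →* G)
    [Finite α] [Finite Y] {θ : α → Y} (hθ : ∀ h a, θ (s h • a) = θ a)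
    (hθ' : ∀ a a', θ a = θ a' → ∃ h, s h • a = a') (Z : (α →₀ F) →ₗ[F] (α →₀ F)) :
    Module.finrank F (LinearMap.range ((∑ h, perm F G α (s h)) ∘ₗ Z)) =
      Module.finrank F (LinearMap.range (Finsupp.lmapDomain F F θ ∘ₗ Z)) := by
  classical
  -- Projecting the orbit sum only multiplies the projection by `|H|`, which is invertible in
  -- characteristic zero.
  have h₁ : Finsupp.lmapDomain F F θ ∘ₗ (∑ h, perm F G α (s h)) =
      (Fintype.card H : F) • Finsupp.lmapDomain F F θ := by
    refine Finsupp.lhom_ext fun a r => ?_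
    simp only [LinearMap.comp_apply, LinearMap.sum_apply, map_sum, perm_single,
      Finsupp.lmapDomain_apply, Finsupp.mapDomain_single, hθ, LinearMap.smul_apply]
    simp
  -- Conversely the orbit sum depends only on the orbit, so it factors through the projection; `Θ`
  -- sends a point to the sum of the translates of any preimage, and to zero off the image of `θ`.
  obtain ⟨Θ, h₂⟩ : ∃ Θ : (Y →₀ F) →ₗ[F] (α →₀ F),
      (∑ h, perm F G α (s h)) = Θ ∘ₗ Finsupp.lmapDomain F F θ := by
    refine ⟨Finsupp.linearCombination F fun y => if h : ∃ a, θ a = y then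
      (∑ i, perm F G α (s i)) (Finsupp.single h.choose 1) else 0, ?_⟩
    refine Finsupp.lhom_ext' fun a => LinearMap.ext_ring ?_
    simp only [LinearMap.comp_apply, Finsupp.lsingle_apply, Finsupp.lmapDomain_apply,
      Finsupp.mapDomain_single, Finsupp.linearCombination_single, one_smul]
    have hex : ∃ a', θ a' = θ a := ⟨a, rfl⟩
    rw [dif_pos hex]
    obtain ⟨h, hh⟩ := hθ' _ _ hex.choose_spec.symm
    simp only [LinearMap.sum_apply, perm_single, ← hh, smul_smul, ← map_mul]
    exact (Equiv.sum_comp (Equiv.mulRight h) fun i => Finsupp.single (s i • a) (1 : F)).symm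
  have hc : (Fintype.card H : F) ≠ 0 := Nat.cast_ne_zero.2 Fintype.card_ne_zero
  apply le_antisymm
  · rw [h₂, LinearMap.comp_assoc]
    exact LinearMap.finrank_range_comp_le_right _ _
  · rw [← LinearMap.range_smul (Finsupp.lmapDomain F F θ ∘ₗ Z) _ hc, ← LinearMap.smul_comp, ← h₁,
      LinearMap.comp_assoc]
    exact LinearMap.finrank_range_comp_le_right _ _

end Representation

/-! ### Row sums, column sums and Young symmetrizers -/

namespace Representation

variable {F V W : Type*} [Field F] [AddCommGroup V] [Module F V] [AddCommGroup W] [Module F W]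
  {S T : Type*} [Fintype S] [DecidableEq S] [Fintype T] [DecidableEq T]

/-- The sum of the operators of the permutations preserving a function. -/
noncomputable def rowSum (ρ : Representation F (Equiv.Perm S) V) (row : S → ℕ) : V →ₗ[F] V :=
  ∑ g : Equiv.Perm S with ∀ s, row (g s) = row s, ρ g

/-- The signed sum of the operators of the permutations preserving a function. -/
noncomputable def colSum (ρ : Representation F (Equiv.Perm S) V) (col : S → ℕ) : V →ₗ[F] V :=
  ∑ g : Equiv.Perm S with ∀ s, col (g s) = col s, ((Equiv.Perm.sign g : ℤ) : F) • ρ g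

theorem sum_permCongr {M : Type*} [AddCommMonoid M] (e : S ≃ T) (p : T → ℕ)
    (f : Equiv.Perm T → M) :
    ∑ g : Equiv.Perm S with ∀ s, p (e (g s)) = p (e s), f (e.permCongr g) =
      ∑ g : Equiv.Perm T with ∀ s, p (g s) = p s, f g := by
  refine Finset.sum_equiv e.permCongr (fun g => ?_) fun _ _ => rfl
  simp [← e.forall_congr_right, Equiv.permCongr_apply]

theorem rowSum_congr {ρ : Representation F (Equiv.Perm S) V} {σ : Representation F (Equiv.Perm T) W}
    (e : S ≃ T) (L : V →ₗ[F] W) (h : ∀ g v, L (ρ g v) = σ (e.permCongr g) (L v)) (row : T → ℕ)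
    (v : V) : L (ρ.rowSum (fun s => row (e s)) v) = σ.rowSum row (L v) := by
  simp only [rowSum, LinearMap.sum_apply, map_sum, h]
  exact sum_permCongr e row fun g => σ g (L v)

theorem colSum_congr {ρ : Representation F (Equiv.Perm S) V} {σ : Representation F (Equiv.Perm T) W}
    (e : S ≃ T) (L : V →ₗ[F] W) (h : ∀ g v, L (ρ g v) = σ (e.permCongr g) (L v)) (col : T → ℕ)
    (v : V) : L (ρ.colSum (fun s => col (e s)) v) = σ.colSum col (L v) := by
  simp only [colSum, LinearMap.sum_apply, map_sum, LinearMap.smul_apply, map_smul, h]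
  rw [← sum_permCongr e]
  simp [Equiv.Perm.sign_permCongr]

theorem asAlgebraHom_youngSymmetrizer (μ : YoungDiagram)
    (ρ : Representation F (Equiv.Perm μ.cells) V) :
    ρ.asAlgebraHom (μ.youngSymmetrizer F) =
      ρ.rowSum (fun c => c.1.1) * ρ.colSum (fun c => c.1.2) := by
  simp only [YoungDiagram.youngSymmetrizer, rowSum, colSum, map_mul, map_sum,
    asAlgebraHom_single, one_smul]

/-- The Young symmetrizer attached to a row and a column function. -/
noncomputable def youngElement (F : Type*) [Field F] (row col : S → ℕ) :
    MonoidAlgebra F (Equiv.Perm S) :=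
  (∑ g : Equiv.Perm S with ∀ s, row (g s) = row s, MonoidAlgebra.single g 1) *
    ∑ g : Equiv.Perm S with ∀ s, col (g s) = col s,
      MonoidAlgebra.single g ((Equiv.Perm.sign g : ℤ) : F)

theorem asAlgebraHom_youngElement (ρ : Representation F (Equiv.Perm S) V) (row col : S → ℕ) :
    ρ.asAlgebraHom (youngElement F row col) = ρ.rowSum row * ρ.colSum col := by
  simp only [youngElement, rowSum, colSum, map_mul, map_sum, asAlgebraHom_single, one_smul]

theorem finrank_range_young_congr {ρ : Representation F (Equiv.Perm S) V}
    {σ : Representation F (Equiv.Perm T) W} (e : S ≃ T) (L : V ≃ₗ[F] W)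
    (h : ∀ g v, L (ρ g v) = σ (e.permCongr g) (L v)) (row col : T → ℕ) :
    Module.finrank F (LinearMap.range
      (ρ.asAlgebraHom (youngElement F (fun s => row (e s)) fun s => col (e s)))) =
    Module.finrank F (LinearMap.range (σ.asAlgebraHom (youngElement F row col))) := by
  refine LinearMap.finrank_range_of_comm L fun v => ?_
  rw [asAlgebraHom_youngElement, asAlgebraHom_youngElement, Module.End.mul_apply,
    Module.End.mul_apply]
  exact (rowSum_congr e L.toLinearMap h row _).trans
    (congrArg _ (colSum_congr e L.toLinearMap h col v))

end Representation

instance (m b : ℕ) (S : Type) : MulAction (Equiv.Perm S) (Placement m b S) where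
  smul g h := ⟨h.1 ∘ g.symm, fun j => by
    obtain ⟨s, hs, hs'⟩ := h.2 j
    exact ⟨g s, by simpa using hs, fun t ht => (g.symm_apply_eq).1 (hs' _ ht)⟩⟩
  one_smul _ := rfl
  mul_smul _ _ _ := rfl

instance (m : ℕ) (a : ℕ → ℕ) (S : Type) [Finite S] :
    MulAction (Equiv.Perm S) ((StructureSpecies.placement m a).obj S) where
  smul g ω := ⟨ω.1, ω.2.1, g • ω.2.2⟩
  one_smul _ := rfl
  mul_smul _ _ _ := rfl

namespace SymSeq

variable {F : Type u} [Field F]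

/-- The linear equivalence induced by a bijection. -/
noncomputable def mapEquiv (X : SymSeq F) {S T : Type} [Finite S] [Finite T] (e : S ≃ T) :
    X.obj S ≃ₗ[F] X.obj T :=
  LinearEquiv.ofLinearMap (X.map e) (X.map e.symm)
    (by rw [← X.map_trans, e.symm_trans_self, X.map_refl])
    (by rw [← X.map_trans, e.self_trans_symm, X.map_refl])

theorem mapEquiv_rep (X : SymSeq F) {S T : Type} [Finite S] [Finite T] (e : S ≃ T)
    (g : Equiv.Perm S) (v : X.obj S) :
    X.mapEquiv e (X.rep S g v) = X.rep T (e.permCongr g) (X.mapEquiv e v) := by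
  change (X.map e ∘ₗ X.map g) v = (X.map (e.permCongr g) ∘ₗ X.map e) v
  rw [← X.map_trans, ← X.map_trans]
  congr 2
  ext s
  simp

theorem PermBasis.repr_rep {X : SymSeq F} {Ω : StructureSpecies} (b : PermBasis X Ω) (S : Type)
    [Finite S] [MulAction (Equiv.Perm S) (Ω.obj S)]
    (h : ∀ (g : Equiv.Perm S) (ω : Ω.obj S), Ω.pull g (g • ω) = ω) (g : Equiv.Perm S)
    (v : X.obj S) :
    (b.basis S).repr (X.rep S g v) = Representation.perm F _ _ g ((b.basis S).repr v) := by
  have : (b.basis S).repr.toLinearMap ∘ₗ X.rep S g =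
      Representation.perm F _ _ g ∘ₗ (b.basis S).repr.toLinearMap := by
    refine (b.basis S).ext fun ω => ?_
    have h' : X.rep S g (b.basis S ω) = b.basis S (g • ω) := by
      rw [← b.map_basis g (g • ω), h]
      rfl
    simp [h', Representation.perm_single]
  exact LinearMap.congr_fun this v

theorem finite_of_permBasis {X : SymSeq F} {Ω : StructureSpecies} (b : PermBasis X Ω) (S : Type)
    [Finite S] [Finite (Ω.obj S)] : Module.Finite F (X.obj S) := .of_basis (b.basis S)

theorem mul_eq_finrank_range_perm [CharZero F] {X : SymSeq F} {Ω : StructureSpecies}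
    (b : PermBasis X Ω) (μ : YoungDiagram) (S : Type) [Fintype S] [DecidableEq S]
    [MulAction (Equiv.Perm S) (Ω.obj S)] [Finite (Ω.obj S)]
    (h : ∀ (g : Equiv.Perm S) (ω : Ω.obj S), Ω.pull g (g • ω) = ω)
    (e : μ.cells ≃ S) (row col : S → ℕ) (hrow : ∀ c, row (e c) = c.1.1)
    (hcol : ∀ c, col (e c) = c.1.2) :
    X.mul μ = Module.finrank F (LinearMap.range ((Representation.perm F (Equiv.Perm S)
      (Ω.obj S)).asAlgebraHom (Representation.youngElement F row col))) := by
  have hfin := finite_of_permBasis b S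
  have hfin : Module.Finite F (X.obj μ.cells) := Module.Finite.equiv (X.mapEquiv e).symm
  rw [mul, Representation.finrank_intertwiningMap_ideal _ _ (μ.youngSymmetrizer F) rfl,
    ← Representation.finrank_range_young_congr (ρ := X.rep μ.cells) e
      ((X.mapEquiv e).trans (b.basis S).repr) (fun g v => by
        rw [LinearEquiv.trans_apply, LinearEquiv.trans_apply, mapEquiv_rep,
          b.repr_rep S h]) row col]
  rw [show (fun s => row (e s)) = _ from funext hrow,
    show (fun s => col (e s)) = _ from funext hcol]
  rfl

end SymSeq

/-! ### The cells of a padded diagram -/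

namespace YoungDiagram

theorem mem_padded {μ : YoungDiagram} {k : ℕ} (h : μ.card + μ.rowLen 0 ≤ k) {c : ℕ × ℕ} :
    c ∈ μ.padded k h ↔ (c.1 = 0 ∧ c.2 < k - μ.card) ∨ ∃ i, c.1 = i + 1 ∧ (i, c.2) ∈ μ := by
  obtain ⟨i, j⟩ := c
  rw [padded, mem_ofRowLens]
  cases i with
  | zero => simp
  | succ i =>
    simp only [List.length_cons, List.getElem_cons_succ, add_lt_add_iff_right]
    constructor
    · rintro ⟨h₁, h₂⟩
      rw [get_rowLens] at h₂
      exact Or.inr ⟨i, rfl, mem_iff_lt_rowLen.2 h₂⟩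
    · rintro (⟨h₁, -⟩ | ⟨i', h₁, h₂⟩)
      · cases h₁
      · obtain rfl : i = i' := by simpa using h₁
        have h₃ : i < μ.rowLens.length := by
          rw [length_rowLens]
          exact mem_iff_lt_colLen.1 (μ.up_left_mem le_rfl (Nat.zero_le j) h₂)
        exact ⟨h₃, by rw [get_rowLens]; exact mem_iff_lt_rowLen.1 h₂⟩

/-- The row of a cell of a padded diagram. -/
def paddedRow (μ : YoungDiagram) (d : ℕ) : μ.cells ⊕ (Fin (μ.rowLen 0) ⊕ Fin d) → ℕ :=
  Sum.elim (fun c => c.1.1 + 1) fun _ => 0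

/-- The column of a cell of a padded diagram. -/
def paddedCol (μ : YoungDiagram) (d : ℕ) : μ.cells ⊕ (Fin (μ.rowLen 0) ⊕ Fin d) → ℕ :=
  Sum.elim (fun c => c.1.2) (Sum.elim (fun j => j) fun i => μ.rowLen 0 + i)

/-- The first row has `rowLen 0 + d` cells. The first `rowLen 0` of them lie above the columns of
`μ`, while each of the last `d` is alone in its column. -/
theorem exists_padded_equiv (μ : YoungDiagram) (d : ℕ)
    (h : μ.card + μ.rowLen 0 ≤ μ.card + μ.rowLen 0 + d) :
    ∃ e : (μ.padded (μ.card + μ.rowLen 0 + d) h).cells ≃ μ.cells ⊕ (Fin (μ.rowLen 0) ⊕ Fin d),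
      (∀ c, μ.paddedRow d (e c) = c.1.1) ∧ ∀ c, μ.paddedCol d (e c) = c.1.2 := by
  have hmem : ∀ s, (μ.paddedRow d s, μ.paddedCol d s) ∈
      (μ.padded (μ.card + μ.rowLen 0 + d) h).cells := by
    intro s
    rw [mem_cells, mem_padded]
    obtain c | j | i := s
    · exact Or.inr ⟨c.1.1, rfl, c.2⟩
    · refine Or.inl ⟨rfl, ?_⟩
      simp only [paddedCol, Sum.elim_inr, Sum.elim_inl]
      have := j.2
      omega
    · refine Or.inl ⟨rfl, ?_⟩
      simp only [paddedCol, Sum.elim_inr]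
      have := i.2
      omega
  let f : μ.cells ⊕ (Fin (μ.rowLen 0) ⊕ Fin d) → (μ.padded (μ.card + μ.rowLen 0 + d) h).cells :=
    fun s => ⟨_, hmem s⟩
  have hf : Function.Bijective f := by
    constructor
    · intro s t hst
      have h₁ : μ.paddedRow d s = μ.paddedRow d t := congrArg (fun c => c.1.1) hst
      have h₂ : μ.paddedCol d s = μ.paddedCol d t := congrArg (fun c => c.1.2) hst
      obtain c | j | i := s <;> obtain c' | j' | i' := t <;>
        simp only [paddedRow, paddedCol, Sum.elim_inl, Sum.elim_inr] at h₁ h₂ <;>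
        first
        | omega
        | skip
      · exact congrArg _ (Subtype.ext (Prod.ext (by omega) h₂))
      · exact congrArg _ (congrArg _ (Fin.ext h₂))
      · exact congrArg _ (congrArg _ (Fin.ext (by omega)))
    · rintro ⟨⟨i, j⟩, hc⟩
      have hc' := hc
      rw [mem_cells, mem_padded] at hc'
      obtain ⟨hi, hj⟩ | ⟨i', hi, hj⟩ := hc'
      · simp only at hi hj
        subst hi
        by_cases hjl : j < μ.rowLen 0
        · exact ⟨Sum.inr (Sum.inl ⟨j, hjl⟩), rfl⟩
        · refine ⟨Sum.inr (Sum.inr ⟨j - μ.rowLen 0, by omega⟩), Subtype.ext (Prod.ext rfl ?_)⟩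
          change μ.rowLen 0 + (j - μ.rowLen 0) = j
          omega
      · simp only at hi hj
        subst hi
        exact ⟨Sum.inl ⟨(i', j), hj⟩, rfl⟩
  refine ⟨(Equiv.ofBijective f hf).symm, fun c => ?_, fun c => ?_⟩
  · exact congrArg (fun c => c.1.1) ((Equiv.ofBijective f hf).apply_symm_apply c)
  · exact congrArg (fun c => c.1.2) ((Equiv.ofBijective f hf).apply_symm_apply c)

end YoungDiagram

/-! ### Multiplicities as ranks on placements -/

namespace SymSeq

variable {F : Type u} [Field F]

/-- The rank of the padded Young symmetrizer on a permutation module. -/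
noncomputable def youngRank (F : Type u) [Field F] (μ : YoungDiagram) (d : ℕ) (α : Type)
    [MulAction (Equiv.Perm (μ.cells ⊕ (Fin (μ.rowLen 0) ⊕ Fin d))) α] : ℕ :=
  Module.finrank F (LinearMap.range ((Representation.perm F
    (Equiv.Perm (μ.cells ⊕ (Fin (μ.rowLen 0) ⊕ Fin d))) α).asAlgebraHom
      (Representation.youngElement F (μ.paddedRow d) (μ.paddedCol d))))

/-- Permutations change neither the number `b` of labels nor the decoration, so the permutation
module splits accordingly, with `n.multichoose b` copies for each `b`. -/
theorem mulPadded_eq [CharZero F] (m n : ℕ) (μ : YoungDiagram) (d : ℕ) :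
    ((SS F m).tensor (AA F n)).mulPadded μ (μ.card + μ.rowLen 0 + d) =
      ∑ b ∈ Finset.range (μ.card + μ.rowLen 0 + d + 1), n.multichoose b *
        youngRank F μ d (Placement m b (μ.cells ⊕ (Fin (μ.rowLen 0) ⊕ Fin d))) := by
  obtain ⟨e, hrow, hcol⟩ := μ.exists_padded_equiv d (Nat.le_add_right _ _)
  rw [mulPadded, dif_pos (Nat.le_add_right _ _),
    mul_eq_finrank_range_perm (PermBasis.placement m n) _ _ (fun g ω => ?_) e _ _ hrow hcol]
  · have hb : ∀ b, Placement m b (μ.cells ⊕ (Fin (μ.rowLen 0) ⊕ Fin d)) →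
        b < μ.card + μ.rowLen 0 + d + 1 := by
      intro b h
      choose f hf _ using h.2
      have := Fintype.card_le_of_injective f fun j j' hj => Sum.inr_injective
        ((hf j).symm.trans ((congrArg _ hj).trans (hf j')))
      simp only [Fintype.card_fin, Fintype.card_sum, Fintype.card_coe] at this
      change b ≤ μ.card + _ at this
      omega
    rw [Representation.finrank_range_perm_sigma
      (ι := Σ b : Fin (μ.card + μ.rowLen 0 + d + 1), Fin (n.multichoose b))
      (γ := fun i => Placement m i.1 (μ.cells ⊕ (Fin (μ.rowLen 0) ⊕ Fin d)))
      { toFun := fun x => ⟨x.1.1, x.1.2, x.2⟩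
        invFun := fun x => ⟨⟨⟨x.1, hb _ x.2.2⟩, x.2.1⟩, x.2.2⟩
        left_inv := fun _ => rfl
        right_inv := fun _ => rfl } (fun _ _ _ => rfl)]
    rw [Fintype.sum_sigma, Finset.sum_range]
    refine Finset.sum_congr rfl fun b _ => ?_
    change ∑ _ : Fin (n.multichoose b), youngRank F μ d (Placement m b _) = _
    rw [Finset.sum_const, Finset.card_univ, Fintype.card_fin, smul_eq_mul]
  · refine StructureSpecies.placement_ext rfl rfl fun s => ?_
    change (ω.2.2.1 (g.symm (g s))).map _ _ = _
    rw [g.symm_apply_apply]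

end SymSeq

/-! ### Row and column sums over a disjoint union -/

/-- Extension of a permutation by the identity. -/
def permInl (P R : Type*) : Equiv.Perm P →* Equiv.Perm (P ⊕ R) :=
  (Equiv.Perm.sumCongrHom P R).comp (MonoidHom.inl _ _)

/-- Extension of a permutation by the identity. -/
def permInr (P R : Type*) : Equiv.Perm R →* Equiv.Perm (P ⊕ R) :=
  (Equiv.Perm.sumCongrHom P R).comp (MonoidHom.inr _ _)

theorem permInl_mul_permInr {P R : Type*} (σ : Equiv.Perm P) (τ : Equiv.Perm R) :
    permInr P R τ * permInl P R σ = Equiv.sumCongr σ τ := by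
  ext (p | r) <;> rfl

theorem exists_eq_sumCongr {P R : Type*} [Finite P] [Finite R] {g : Equiv.Perm (P ⊕ R)}
    (h : ∀ p, ∃ p', g (Sum.inl p) = Sum.inl p') :
    ∃ (σ : Equiv.Perm P) (τ : Equiv.Perm R), g = Equiv.sumCongr σ τ := by
  obtain ⟨⟨σ, τ⟩, rfl⟩ := Equiv.Perm.mem_sumCongrHom_range_of_perm_mapsTo_inl (σ := g) (by
    rintro _ ⟨p, rfl⟩
    obtain ⟨p', hp'⟩ := h p
    exact ⟨p', hp'.symm⟩)
  exact ⟨σ, τ, rfl⟩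

namespace Representation

variable {F V : Type*} [Field F] [AddCommGroup V] [Module F V]
  {P R : Type*} [Fintype P] [DecidableEq P] [Fintype R] [DecidableEq R]

/-- The shift by one keeps the rows of `P` apart from the single row `R`, so the row group is the
product of that of `P` with the whole of `Perm R`. -/
theorem rowSum_sumElim (ρ : Representation F (Equiv.Perm (P ⊕ R)) V) (row : P → ℕ) :
    ρ.rowSum (Sum.elim (fun p => row p + 1) fun _ => 0) =
      (∑ τ, ρ (permInr P R τ)) ∘ₗ (rowSum (ρ.comp (permInl P R)) row) := by
  have h : (∑ τ, ρ (permInr P R τ)) ∘ₗ (rowSum (ρ.comp (permInl P R)) row) =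
      ∑ x : Equiv.Perm R × Equiv.Perm P with ∀ p, row (x.2 p) = row p,
        ρ (Equiv.sumCongr x.2 x.1) := by
    change (∑ τ, ρ (permInr P R τ)) * (rowSum (ρ.comp (permInl P R)) row) = _
    rw [rowSum, Finset.sum_mul_sum, ← Finset.univ_product_univ, ← Finset.sum_product']
    refine Finset.sum_congr (by ext; simp) fun x _ => ?_
    rw [← permInl_mul_permInr, map_mul]
    rfl
  rw [h, rowSum]
  symm
  refine Finset.sum_nbij (fun x => Equiv.sumCongr x.2 x.1) ?_ ?_ ?_ fun _ _ => rfl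
  · intro x hx
    simp only [Finset.mem_filter, Finset.mem_univ, true_and] at hx ⊢
    rintro (p | r)
    · simp [hx]
    · simp
  · rintro ⟨τ, σ⟩ - ⟨τ', σ'⟩ - h
    have := Equiv.Perm.sumCongrHom_injective (a₁ := (σ, τ)) (a₂ := (σ', τ')) h
    simp only [Prod.mk.injEq] at this ⊢
    exact this.symm
  · intro g hg
    simp only [Finset.coe_filter, Finset.mem_univ, true_and, Set.mem_ofPred_eq] at hg
    obtain ⟨σ, τ, rfl⟩ := exists_eq_sumCongr (g := g) fun p => by
      have := hg (Sum.inl p)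
      generalize g (Sum.inl p) = s at this
      rcases s with p' | r
      · exact ⟨p', rfl⟩
      · exact absurd this (Nat.succ_ne_zero _).symm
    refine ⟨(τ, σ), ?_, rfl⟩
    simp only [Finset.coe_filter, Finset.mem_univ, true_and, Set.mem_ofPred_eq]
    intro p
    simpa using hg (Sum.inl p)

theorem sign_permInl (σ : Equiv.Perm P) :
    Equiv.Perm.sign (permInl P R σ) = Equiv.Perm.sign σ := by
  change Equiv.Perm.sign (Equiv.sumCongr σ 1) = _
  rw [Equiv.Perm.sign_sumCongr, map_one, mul_one]

/-- The column group of `P` sits inside the full column group, and the signed sum absorbs each of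
its elements with its sign. -/
theorem colSum_comp_colSum (ρ : Representation F (Equiv.Perm (P ⊕ R)) V) (col : P ⊕ R → ℕ) :
    colSum (ρ.comp (permInl P R)) (fun p => col (Sum.inl p)) ∘ₗ ρ.colSum col =
      (Finset.card {σ : Equiv.Perm P | ∀ p, col (Sum.inl (σ p)) = col (Sum.inl p)} : F) •
        ρ.colSum col := by
  have h : ∀ σ : Equiv.Perm P, (∀ p, col (Sum.inl (σ p)) = col (Sum.inl p)) →
      (((Equiv.Perm.sign σ : ℤ) : F) • ρ (permInl P R σ)) * ρ.colSum col = ρ.colSum col := by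
    intro σ hσ
    have hσ' : ∀ s, col (permInl P R σ s) = col s := by
      rintro (p | r)
      · exact hσ p
      · rfl
    rw [colSum, Finset.mul_sum]
    refine Finset.sum_equiv (Equiv.mulLeft (permInl P R σ)) (fun g => ?_) fun g _ => ?_
    · simp [hσ']
    · rw [Equiv.coe_mulLeft, Equiv.Perm.sign_mul, sign_permInl, map_mul, smul_mul_smul_comm]
      push_cast
      rfl
  change colSum (ρ.comp (permInl P R)) (fun p => col (Sum.inl p)) * ρ.colSum col = _
  rw [colSum, Finset.sum_mul, Nat.cast_smul_eq_nsmul, ← Finset.sum_const]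
  exact Finset.sum_congr rfl fun σ hσ => h σ (Finset.mem_filter.1 hσ).2

/-- Split the column group by whether `P` is preserved. An element preserving `P` also preserves
`R`, where the columns are distinct, so it is the identity there. -/
theorem colSum_eq_add (ρ : Representation F (Equiv.Perm (P ⊕ R)) V) (col : P ⊕ R → ℕ)
    (hcol : Function.Injective fun r => col (Sum.inr r)) :
    ρ.colSum col = colSum (ρ.comp (permInl P R)) (fun p => col (Sum.inl p)) +
      ∑ g : Equiv.Perm (P ⊕ R) with (∀ s, col (g s) = col s) ∧ ∃ p r, g (Sum.inl p) = Sum.inr r,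
        ((Equiv.Perm.sign g : ℤ) : F) • ρ g := by
  classical
  rw [colSum, ← Finset.sum_filter_add_sum_filter_not _
    (fun g : Equiv.Perm (P ⊕ R) => ∀ p, ∃ p', g (Sum.inl p) = Sum.inl p')]
  congr 1
  · symm
    refine Finset.sum_nbij (fun σ => permInl P R σ) ?_ ?_ ?_ ?_
    · intro σ hσ
      simp only [Finset.mem_filter, Finset.mem_univ, true_and] at hσ ⊢
      refine ⟨?_, fun p => ⟨σ p, rfl⟩⟩
      rintro (p | r)
      · exact hσ p
      · rfl
    · intro σ _ σ' _ h
      exact congrArg Prod.fst (Equiv.Perm.sumCongrHom_injective (a₁ := (σ, 1)) (a₂ := (σ', 1)) h)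
    · intro g hg
      simp only [Finset.coe_filter, Finset.mem_univ, true_and, Set.mem_ofPred_eq,
        Finset.mem_filter] at hg
      obtain ⟨hg, hg'⟩ := hg
      obtain ⟨σ, τ, rfl⟩ := exists_eq_sumCongr hg'
      obtain rfl : τ = 1 := DFunLike.ext _ _ fun r => hcol (hg (Sum.inr r))
      refine ⟨σ, ?_, rfl⟩
      simp only [Finset.coe_filter, Finset.mem_univ, true_and, Set.mem_ofPred_eq]
      exact fun p => hg (Sum.inl p)
    · intro σ _
      rw [sign_permInl]
      rfl
  · refine Finset.sum_congr ?_ fun _ _ => rfl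
    ext g
    simp only [Finset.mem_filter, Finset.mem_univ, true_and, not_forall, not_exists]
    refine and_congr_right fun _ => exists_congr fun p => ?_
    rcases g (Sum.inl p) with p' | r <;> simp

end Representation

/-! ### Invariant subsets of permutation modules -/

namespace SubMulAction

variable {F G : Type*} [Field F] [Group G] {Y Q : Type*} [MulAction G Y]

/-- The fibre of an invariant map. -/
def fiber (q : Y → Q) (hq : ∀ (g : G) y, q (g • y) = q y) (i : Q) : SubMulAction G Y where
  carrier := {y | q y = i}
  smul_mem' g y hy := (hq g y).trans hy

theorem finrank_range_perm_eq_sum_fiber [Finite Y] [Fintype Q] (q : Y → Q)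
    (hq : ∀ (g : G) y, q (g • y) = q y) (x : MonoidAlgebra F G) :
    Module.finrank F (LinearMap.range ((Representation.perm F G Y).asAlgebraHom x)) =
      ∑ i, Module.finrank F (LinearMap.range
        ((Representation.perm F G (fiber q hq i)).asAlgebraHom x)) :=
  Representation.finrank_range_perm_sigma (γ := fun i => fiber q hq i) (Equiv.sigmaFiberEquiv q)
    (fun _ _ _ => rfl) x

open Classical in
-- The module splits into the parts on `p` and on its complement; on the latter the rank is bounded
-- by the dimension.
theorem finrank_range_perm_le [Finite Y] (p : SubMulAction G Y) (x : MonoidAlgebra F G) :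
    Module.finrank F (LinearMap.range ((Representation.perm F G Y).asAlgebraHom x)) ≤
      Module.finrank F (LinearMap.range ((Representation.perm F G p).asAlgebraHom x)) +
        (Nat.card Y - Nat.card p) := by
  have := Fintype.ofFinite Y
  have hq : ∀ (g : G) y, decide (g • y ∈ p) = decide (y ∈ p) := fun g y => by
    simp
  rw [finrank_range_perm_eq_sum_fiber (fun y => decide (y ∈ p)) hq, Fintype.sum_bool]
  refine add_le_add (le_of_eq ?_) ((LinearMap.finrank_range_le _).trans ?_)
  · let e : fiber (fun y => decide (y ∈ p)) hq true ≃ p := Equiv.subtypeEquivRight fun y => by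
      change decide (y ∈ p) = true ↔ y ∈ p
      simp
    exact Representation.finrank_range_perm_congr e (fun _ _ => rfl) x
  · rw [Module.finrank_finsupp_self, Nat.card_eq_fintype_card, Nat.card_eq_fintype_card]
    refine le_of_eq ?_
    have h : Fintype.card (fiber (fun y => decide (y ∈ p)) hq false) =
        Fintype.card {y // ¬ y ∈ p} :=
      Fintype.card_congr (Equiv.subtypeEquivRight fun y => by
        change decide (y ∈ p) = false ↔ y ∉ p
        simp)
    rw [h, Fintype.card_subtype_compl]

end SubMulAction

namespace Representation

variable {F : Type*} [Field F] {P R : Type*} [Fintype P] [DecidableEq P] {α Y : Type*}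
  [MulAction (Equiv.Perm (P ⊕ R)) α] [MulAction (Equiv.Perm P) Y] {θ : α → Y}

theorem lmapDomain_comp_rowSum (hP : ∀ σ a, θ (permInl P R σ • a) = σ • θ a) (row : P → ℕ) :
    Finsupp.lmapDomain F F θ ∘ₗ rowSum ((perm F (Equiv.Perm (P ⊕ R)) α).comp (permInl P R)) row =
      rowSum (perm F (Equiv.Perm P) Y) row ∘ₗ Finsupp.lmapDomain F F θ := by
  refine LinearMap.ext fun v => ?_
  simp only [rowSum, LinearMap.comp_apply, LinearMap.sum_apply, map_sum]
  exact Finset.sum_congr rfl fun σ _ => lmapDomain_perm (hP σ) v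

theorem lmapDomain_comp_colSum (hP : ∀ σ a, θ (permInl P R σ • a) = σ • θ a) (col : P → ℕ) :
    Finsupp.lmapDomain F F θ ∘ₗ colSum ((perm F (Equiv.Perm (P ⊕ R)) α).comp (permInl P R)) col =
      colSum (perm F (Equiv.Perm P) Y) col ∘ₗ Finsupp.lmapDomain F F θ := by
  refine LinearMap.ext fun v => ?_
  simp only [colSum, LinearMap.comp_apply, LinearMap.sum_apply, map_sum, LinearMap.smul_apply,
    map_smul]
  exact Finset.sum_congr rfl fun σ _ => congrArg _ (lmapDomain_perm (hP σ) v)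

end Representation

namespace SubMulAction

variable {F G Y : Type*} [Field F] [Group G] [MulAction G Y]

/-- Restriction of functions to an invariant subset. -/
noncomputable def restrict (F : Type*) [Field F] (p : SubMulAction G Y) :
    (Y →₀ F) →ₗ[F] (p →₀ F) :=
  Finsupp.lcomapDomain Subtype.val Subtype.val_injective

theorem restrict_single (p : SubMulAction G Y) (y : p) (r : F) :
    restrict F p (Finsupp.single y.1 r) = Finsupp.single y r := by
  classical
  refine Finsupp.ext fun z => ?_
  change (Finsupp.single y.1 r) z.1 = Finsupp.single y r z
  rw [Finsupp.single_apply, Finsupp.single_apply]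
  exact if_congr Subtype.ext_iff.symm rfl rfl

theorem restrict_single_of_notMem (p : SubMulAction G Y) {y : Y} (hy : y ∉ p) (r : F) :
    restrict F p (Finsupp.single y r) = 0 := by
  refine Finsupp.ext fun z => ?_
  have : y ≠ z.1 := fun h => hy (h ▸ z.2)
  simp [restrict, Finsupp.lcomapDomain, Finsupp.comapDomain_apply, this]

/-- The complement of `p` is invariant too, so restriction is equivariant. -/
theorem restrict_perm (p : SubMulAction G Y) (g : G) (v : Y →₀ F) :
    restrict F p (Representation.perm F G Y g v) =
      Representation.perm F G p g (restrict F p v) := by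
  induction v using Finsupp.induction_linear with
  | zero => simp
  | add a b ha hb => simp only [map_add, ha, hb]
  | single y r =>
    rw [Representation.perm_single]
    by_cases hy : y ∈ p
    · rw [restrict_single p ⟨y, hy⟩, Representation.perm_single]
      exact restrict_single p (g • (⟨y, hy⟩ : p)) r
    · rw [restrict_single_of_notMem p hy, restrict_single_of_notMem p, map_zero]
      exact fun h => hy (by simpa using p.smul_mem g⁻¹ h)

end SubMulAction

/-! ### Bounds for the rank of the padded symmetrizer -/

namespace SymSeq

variable {F : Type u} [Field F] [CharZero F] {μ : YoungDiagram} {d : ℕ} {α Y : Type}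
  [Finite α] [Finite Y] [MulAction (Equiv.Perm (μ.cells ⊕ (Fin (μ.rowLen 0) ⊕ Fin d))) α]
  [MulAction (Equiv.Perm μ.cells) Y] {θ : α → Y}

open Representation

/-- The hypotheses say that the fibres of `θ` are the orbits of the first row group. The sum over
this group can then be traded for `θ`, and the row sum of `μ` passes through `θ` by equivariance. -/
theorem youngRank_eq (hP : ∀ (σ : Equiv.Perm μ.cells) a,
      θ (permInl μ.cells (Fin (μ.rowLen 0) ⊕ Fin d) σ • a) = σ • θ a)
    (hR : ∀ τ a, θ (permInr μ.cells (Fin (μ.rowLen 0) ⊕ Fin d) τ • a) = θ a)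
    (hR' : ∀ a a', θ a = θ a' → ∃ τ, permInr μ.cells (Fin (μ.rowLen 0) ⊕ Fin d) τ • a = a') :
    youngRank F μ d α = Module.finrank F (LinearMap.range
      (rowSum (perm F (Equiv.Perm μ.cells) Y) (fun c => c.1.1) ∘ₗ Finsupp.lmapDomain F F θ ∘ₗ
        colSum (perm F (Equiv.Perm (μ.cells ⊕ (Fin (μ.rowLen 0) ⊕ Fin d))) α)
          (μ.paddedCol d))) := by
  rw [youngRank, asAlgebraHom_youngElement, YoungDiagram.paddedRow, rowSum_sumElim]
  change Module.finrank F (LinearMap.range (_ ∘ₗ (_ ∘ₗ _))) = _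
  rw [finrank_range_orbitSum_comp _ hR hR', ← LinearMap.comp_assoc, lmapDomain_comp_rowSum hP,
    LinearMap.comp_assoc]

/-- Up to the nonzero scalar `N`, the padded column sum begins with the column sum of `μ`, which
moves past `θ`. The operator therefore factors on the left through the Young symmetrizer of `μ` on
`Y`. -/
theorem youngRank_le (hP : ∀ (σ : Equiv.Perm μ.cells) a,
      θ (permInl μ.cells (Fin (μ.rowLen 0) ⊕ Fin d) σ • a) = σ • θ a)
    (hR : ∀ τ a, θ (permInr μ.cells (Fin (μ.rowLen 0) ⊕ Fin d) τ • a) = θ a)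
    (hR' : ∀ a a', θ a = θ a' → ∃ τ, permInr μ.cells (Fin (μ.rowLen 0) ⊕ Fin d) τ • a = a') :
    youngRank F μ d α ≤ Module.finrank F (LinearMap.range
      ((perm F (Equiv.Perm μ.cells) Y).asAlgebraHom (μ.youngSymmetrizer F))) := by
  rw [youngRank_eq hP hR hR', asAlgebraHom_youngSymmetrizer]
  have hc := colSum_comp_colSum
    (perm F (Equiv.Perm (μ.cells ⊕ (Fin (μ.rowLen 0) ⊕ Fin d))) α) (μ.paddedCol d)
  set N := Finset.card {σ : Equiv.Perm μ.cells |
    ∀ p, μ.paddedCol d (Sum.inl (σ p)) = μ.paddedCol d (Sum.inl p)} with hN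
  have hN' : (N : F) ≠ 0 := by
    rw [Nat.cast_ne_zero, hN]
    exact Finset.card_ne_zero_of_mem (a := 1) (by simp)
  rw [← LinearMap.range_smul _ _ hN', ← LinearMap.comp_smul, ← LinearMap.comp_smul, ← hc,
    ← LinearMap.comp_assoc _ _ (Finsupp.lmapDomain F F θ), lmapDomain_comp_colSum hP,
    LinearMap.comp_assoc, ← LinearMap.comp_assoc]
  exact LinearMap.finrank_range_comp_le_left _ _

/-- After restriction to `p`, the column permutations that move a cell of `μ` into the first row
contribute nothing on the chosen lift of `y`. The others give the column sum of `μ` itself, so the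
symmetrizer of `μ` on `p` is reached. -/
theorem le_youngRank (hP : ∀ (σ : Equiv.Perm μ.cells) a,
      θ (permInl μ.cells (Fin (μ.rowLen 0) ⊕ Fin d) σ • a) = σ • θ a)
    (hR : ∀ τ a, θ (permInr μ.cells (Fin (μ.rowLen 0) ⊕ Fin d) τ • a) = θ a)
    (hR' : ∀ a a', θ a = θ a' → ∃ τ, permInr μ.cells (Fin (μ.rowLen 0) ⊕ Fin d) τ • a = a')
    (p : SubMulAction (Equiv.Perm μ.cells) Y)
    (hp : ∀ y ∈ p, ∃ a, θ a = y ∧ ∀ g : Equiv.Perm (μ.cells ⊕ (Fin (μ.rowLen 0) ⊕ Fin d)),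
      (∀ s, μ.paddedCol d (g s) = μ.paddedCol d s) →
        (∃ c r, g (Sum.inl c) = Sum.inr r) → θ (g • a) ∉ p) :
    Module.finrank F (LinearMap.range
      ((perm F (Equiv.Perm μ.cells) p).asAlgebraHom (μ.youngSymmetrizer F))) ≤
        youngRank F μ d α := by
  rw [youngRank_eq hP hR hR', asAlgebraHom_youngSymmetrizer]
  refine le_trans ?_ (Submodule.finrank_map_le (p.restrict F) _)
  refine Submodule.finrank_mono ?_
  have hres : ∀ v, p.restrict F (rowSum (perm F (Equiv.Perm μ.cells) Y) (fun c => c.1.1) v) =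
      rowSum (perm F (Equiv.Perm μ.cells) p) (fun c => c.1.1) (p.restrict F v) := fun v => by
    simp only [rowSum, LinearMap.sum_apply, map_sum, SubMulAction.restrict_perm]
  have hres' : ∀ v, p.restrict F (colSum (perm F (Equiv.Perm μ.cells) Y) (fun c => c.1.2) v) =
      colSum (perm F (Equiv.Perm μ.cells) p) (fun c => c.1.2) (p.restrict F v) := fun v => by
    simp only [colSum, LinearMap.sum_apply, map_sum, LinearMap.smul_apply, map_smul,
      SubMulAction.restrict_perm]
  have hinj : Function.Injective fun r => μ.paddedCol d (Sum.inr r) := by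
    rintro (j | i) (j' | i') h <;>
      simp only [YoungDiagram.paddedCol, Sum.elim_inl, Sum.elim_inr] at h
    · exact congrArg _ (Fin.ext h)
    · omega
    · omega
    · exact congrArg _ (Fin.ext (by omega))
  rintro _ ⟨v, rfl⟩
  induction v using Finsupp.induction_linear with
  | zero => simp
  | add v w hv hw =>
    rw [map_add]
    exact add_mem hv hw
  | single y r =>
    obtain ⟨a, hay, ha⟩ := hp y y.2
    refine ⟨_, ⟨Finsupp.single a r, rfl⟩, ?_⟩
    rw [LinearMap.comp_apply, LinearMap.comp_apply, hres, colSum_eq_add _ _ hinj,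
      LinearMap.add_apply, map_add, map_add, Module.End.mul_apply]
    have h₁ : p.restrict F (Finsupp.lmapDomain F F θ (colSum
        ((perm F (Equiv.Perm (μ.cells ⊕ (Fin (μ.rowLen 0) ⊕ Fin d))) α).comp (permInl _ _))
        (fun c => μ.paddedCol d (Sum.inl c)) (Finsupp.single a r))) =
        colSum (perm F (Equiv.Perm μ.cells) p) (fun c => c.1.2) (Finsupp.single y r) := by
      have h := LinearMap.congr_fun (lmapDomain_comp_colSum (F := F) hP fun c => c.1.2)
        (Finsupp.single a r)
      rw [LinearMap.comp_apply, LinearMap.comp_apply, Finsupp.lmapDomain_apply,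
        Finsupp.lmapDomain_apply, Finsupp.mapDomain_single, hay] at h
      rw [← p.restrict_single, ← hres']
      exact congrArg _ h
    have h₂ : p.restrict F (Finsupp.lmapDomain F F θ ((∑ g : Equiv.Perm
        (μ.cells ⊕ (Fin (μ.rowLen 0) ⊕ Fin d)) with (∀ s, μ.paddedCol d (g s) = μ.paddedCol d s) ∧
          ∃ c r, g (Sum.inl c) = Sum.inr r, ((Equiv.Perm.sign g : ℤ) : F) • perm F _ α g)
            (Finsupp.single a r))) = 0 := by
      simp only [LinearMap.sum_apply, map_sum, LinearMap.smul_apply, map_smul, perm_single,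
        Finsupp.lmapDomain_apply, Finsupp.mapDomain_single]
      refine Finset.sum_eq_zero fun g hg => ?_
      obtain ⟨hg, hg'⟩ := (Finset.mem_filter.1 hg).2
      rw [p.restrict_single_of_notMem (ha g hg hg'), smul_zero]
    rw [h₁, h₂, add_zero]

end SymSeq

/-! ### Value counts and words -/

/-- The number of times that a map takes each value. -/
noncomputable def valueCount {S C : Type*} [Fintype S] (h : S → C) : C →₀ ℕ :=
  ∑ s, Finsupp.single (h s) 1

section ValueCount

variable {S T C : Type*} [Fintype S] [Fintype T]

open Classical in
theorem valueCount_apply (h : S → C) (c : C) :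
    valueCount h c = Finset.card {s | h s = c} := by
  simp [valueCount, Finsupp.finsetSum_apply, Finsupp.single_apply]

theorem valueCount_comp_equiv (h : T → C) (e : S ≃ T) : valueCount (h ∘ e) = valueCount h :=
  e.sum_comp fun t => Finsupp.single (h t) 1

theorem valueCount_sum (h : S ⊕ T → C) :
    valueCount h = valueCount (h ∘ Sum.inl) + valueCount (h ∘ Sum.inr) :=
  Fintype.sum_sum_type _

theorem degree_valueCount (h : S → C) : (valueCount h).degree = Fintype.card S := by
  simp [valueCount]

theorem exists_perm_of_valueCount_eq {f f' : S → C} (h : valueCount f = valueCount f') :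
    ∃ τ : Equiv.Perm S, f ∘ τ = f' := by
  classical
  have h' : ∀ c, Nonempty ({s // f' s = c} ≃ {s // f s = c}) := fun c => by
    rw [← Fintype.card_eq, Fintype.card_subtype, Fintype.card_subtype, ← valueCount_apply,
      ← valueCount_apply, h]
  refine ⟨(Equiv.sigmaFiberEquiv f').symm.trans
    ((Equiv.sigmaCongrRight fun c => (h' c).some).trans (Equiv.sigmaFiberEquiv f)),
    funext fun s => ?_⟩
  exact ((h' (f' s)).some ⟨s, rfl⟩).2

theorem exists_valueCount_eq (n : ℕ) {D : C →₀ ℕ} (hD : D.degree = n) :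
    ∃ v : Fin n → C, valueCount v = D := by
  induction n generalizing D with
  | zero => exact ⟨Fin.elim0, (Finsupp.degree_eq_zero_iff D |>.1 hD).symm ▸ rfl⟩
  | succ n ih =>
    have h0 : D ≠ 0 := fun h => by simp [h] at hD
    obtain ⟨c, hc⟩ := Finsupp.ne_iff.1 h0
    have hle : Finsupp.single c 1 ≤ D := Finsupp.single_le_iff.2 (Nat.one_le_iff_ne_zero.2 hc)
    obtain ⟨v, hv⟩ := ih (D := D - Finsupp.single c 1) (by
      have := congrArg Finsupp.degree (tsub_add_cancel_of_le hle)
      rw [map_add, Finsupp.degree_single] at this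
      omega)
    refine ⟨Fin.cons c v, ?_⟩
    rw [valueCount, Fin.sum_univ_succ]
    simp only [Fin.cons_zero, Fin.cons_succ]
    rw [← valueCount, hv, add_tsub_cancel_of_le hle]

theorem exists_sumElim_valueCount_eq {w : T → C} {D : C →₀ ℕ} (hle : valueCount w ≤ D) {d : ℕ}
    (hD : D.degree = Fintype.card T + d) : ∃ v : Fin d → C, valueCount (Sum.elim w v) = D := by
  obtain ⟨v, hv⟩ := exists_valueCount_eq d (D := D - valueCount w) (by
    have := congrArg Finsupp.degree (tsub_add_cancel_of_le hle)
    rw [map_add, degree_valueCount, hD] at this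
    omega)
  refine ⟨v, ?_⟩
  rw [valueCount_sum, Sum.elim_comp_inl, Sum.elim_comp_inr, hv, add_tsub_cancel_of_le hle]

theorem valueCount_le_card (h : S → C) (c : C) : valueCount h c ≤ Fintype.card S := by
  classical
  rw [valueCount_apply]
  exact Finset.card_le_univ _

theorem valueCount_le_one {h : S → C} (hh : Function.Injective h) (c : C) :
    valueCount h c ≤ 1 := by
  classical
  rw [valueCount_apply, Finset.card_le_one]
  intro s hs t ht
  exact hh ((Finset.mem_filter.1 hs).2.trans (Finset.mem_filter.1 ht).2.symm)

end ValueCount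

/-- The maps from `S` to `C`, with the action of the permutations of `S`. -/
def Word (S C : Type) : Type := S → C

instance (S C : Type) : MulAction (Equiv.Perm S) (Word S C) where
  smul g u := u ∘ g.symm
  one_smul _ := rfl
  mul_smul _ _ _ := rfl

instance (S C : Type) [Finite S] [Finite C] : Finite (Word S C) := inferInstanceAs (Finite (S → C))

namespace Word

/-- The injective maps with values in a given set. -/
def injInto (S : Type) {C : Type} (A : Set C) : SubMulAction (Equiv.Perm S) (Word S C) where
  carrier := {u | Function.Injective u ∧ ∀ s, u s ∈ A}
  smul_mem' g _ hu := ⟨hu.1.comp g.symm.injective, fun s => hu.2 (g.symm s)⟩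

/-- The injective maps with values in a given set are the embeddings. -/
def injIntoEquiv (S : Type) {C : Type} (A : Set C) : injInto S A ≃ (S ↪ A) where
  toFun u := ⟨fun s => ⟨u.1 s, u.2.2 s⟩, fun _ _ h => u.2.1 (congrArg Subtype.val h)⟩
  invFun f := ⟨fun s => f s, fun _ _ h => f.injective (Subtype.ext h), fun s => (f s).2⟩
  left_inv _ := rfl
  right_inv _ := rfl

theorem card_injInto (S : Type) {C : Type} [Fintype S] (A : Set C) [Finite A] :
    Nat.card (injInto S A) = (Nat.card A).descFactorial (Fintype.card S) := by
  classical
  have := Fintype.ofFinite A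
  rw [Nat.card_congr (injIntoEquiv S A), Nat.card_eq_fintype_card, Fintype.card_embedding_eq,
    Nat.card_eq_fintype_card]

/-- Freeness on injective words is what lets the trace formula compute the rank below. -/
theorem smul_injInto_eq {S C : Type} {A : Set C} (g : Equiv.Perm S) (u : injInto S A)
    (h : g • u = u) : g = 1 := by
  refine Equiv.ext fun s => u.2.1 ?_
  have := congrFun (congrArg Subtype.val h) (g s)
  exact this.symm.trans (congrArg u.1 (g.symm_apply_apply s))

theorem factorial_mul_finrank_range_perm {F : Type u} [Field F] [CharZero F] (μ : YoungDiagram)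
    {C : Type} [Finite C] (A : Set C) :
    μ.card ! * Module.finrank F (LinearMap.range ((Representation.perm F (Equiv.Perm μ.cells)
      (injInto μ.cells A)).asAlgebraHom (μ.youngSymmetrizer F))) =
        (Nat.card A).descFactorial μ.card * μ.dimSpecht F := by
  have := Fintype.ofFinite (injInto μ.cells A)
  have h := Representation.card_mul_finrank_range_perm (F := F)
    (smul_injInto_eq (S := μ.cells) (A := A)) (μ.youngSymmetrizer F)
  rw [Fintype.card_perm, Fintype.card_coe, ← Nat.card_eq_fintype_card, card_injInto,
    Fintype.card_coe] at h
  exact h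

end Word

/-! ### Types of placements -/

theorem Placement.valueCount_inr {m b : ℕ} {S : Type} [Fintype S] (h : Placement m b S)
    (j : Fin b) : valueCount h.1 (Sum.inr j) = 1 := by
  classical
  obtain ⟨s, hs, hs'⟩ := h.2 j
  rw [valueCount_apply, Finset.card_eq_one]
  exact ⟨s, by ext t; simpa using ⟨fun h => hs' t h, fun h => h ▸ hs⟩⟩

/-- The type of a placement: the numbers of elements with the values of the first kind. -/
noncomputable def Placement.type {m b k : ℕ} {S : Type} [Fintype S] (hk : Fintype.card S = k)
    (h : Placement m b S) : WeakComposition m (k - b) :=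
  ⟨fun i => valueCount h.1 (Sum.inl i), by
    have h₁ := degree_valueCount h.1
    rw [hk, Finsupp.degree_eq_sum, Fintype.sum_sum_type,
      Finset.sum_congr rfl fun j _ => h.valueCount_inr j] at h₁
    simp only [Finset.sum_const, Finset.card_univ, Fintype.card_fin, smul_eq_mul, mul_one] at h₁
    exact Nat.eq_sub_of_add_eq h₁⟩

theorem Placement.type_smul {m b k : ℕ} {S : Type} [Fintype S] (hk : Fintype.card S = k)
    (g : Equiv.Perm S) (h : Placement m b S) : (g • h).type hk = h.type hk :=
  Subtype.ext (funext fun i => DFunLike.congr_fun (valueCount_comp_equiv h.1 g.symm) (Sum.inl i))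

/-- The placements of given type. -/
noncomputable abbrev PlacementOfType {m b k : ℕ} {S : Type} [Fintype S] (hk : Fintype.card S = k)
    (a : WeakComposition m (k - b)) : SubMulAction (Equiv.Perm S) (Placement m b S) :=
  SubMulAction.fiber (Placement.type hk) (Placement.type_smul hk) a

theorem PlacementOfType.valueCount_eq {m b k : ℕ} {S : Type} [Fintype S] {hk : Fintype.card S = k}
    {a : WeakComposition m (k - b)} (h h' : PlacementOfType hk a) :
    valueCount h.1.1 = valueCount h'.1.1 := by
  have hh : h.1.type hk = h'.1.type hk := h.2.trans h'.2.symm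
  ext (i | j)
  · exact congrFun (congrArg Subtype.val hh) i
  · rw [h.1.valueCount_inr, h'.1.valueCount_inr]

/-- The map with given numbers of preimages of the elements of the first kind and one preimage of
each element of the second kind. -/
theorem exists_placement {m b : ℕ} {T : Type} [Fintype T] {d : ℕ} (hb : b ≤ Fintype.card T + d)
    (a : WeakComposition m (Fintype.card T + d - b)) {w : T → Fin b} (hw : Function.Injective w) :
    ∃ v : Fin d → Fin m ⊕ Fin b, (∀ i, valueCount (Sum.elim (Sum.inr ∘ w) v) (Sum.inl i) = a.1 i) ∧
      ∀ j, valueCount (Sum.elim (Sum.inr ∘ w) v) (Sum.inr j) = 1 := by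
  let D : Fin m ⊕ Fin b →₀ ℕ := Finsupp.equivFunOnFinite.symm (Sum.elim a.1 1)
  have hle : valueCount (Sum.inr ∘ w : T → Fin m ⊕ Fin b) ≤ D := by
    classical
    rintro (i | j)
    · rw [valueCount_apply]
      simp
    · exact valueCount_le_one (Sum.inr_injective.comp hw) _
  have hD : D.degree = Fintype.card T + d := by
    rw [Finsupp.degree_eq_sum, Fintype.sum_sum_type]
    change ∑ i, a.1 i + ∑ _ : Fin b, 1 = _
    rw [a.2]
    simp [hb]
  obtain ⟨v, this⟩ := exists_sumElim_valueCount_eq hle hD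
  exact ⟨v, fun i => by rw [this]; rfl, fun j => by rw [this]; rfl⟩

theorem existsUnique_of_valueCount {S C : Type} [Fintype S] {h : S → C} {c : C}
    (hc : valueCount h c = 1) : ∃! s, h s = c := by
  classical
  rw [valueCount_apply, Finset.card_eq_one] at hc
  obtain ⟨s, hs⟩ := hc
  have hs' : ∀ t, h t = c ↔ t = s := fun t => by
    simpa using Finset.ext_iff.1 hs t
  exact ⟨s, (hs' s).2 rfl, fun t => (hs' t).1⟩

/-! ### Multiplicity bounds by counting words -/

namespace SymSeq

variable {F : Type u} [Field F] [CharZero F] {μ : YoungDiagram} {m b d : ℕ}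

open Representation

noncomputable instance (m k : ℕ) : Fintype (WeakComposition m k) :=
  Fintype.ofEquiv _ (WeakComposition.equivFin m k).symm

theorem card_weakComposition (m k : ℕ) : Fintype.card (WeakComposition m k) = m.multichoose k := by
  rw [Fintype.card_congr (WeakComposition.equivFin m k), Fintype.card_fin]

theorem card_paddedCells (μ : YoungDiagram) (d : ℕ) :
    Fintype.card (μ.cells ⊕ (Fin (μ.rowLen 0) ⊕ Fin d)) = μ.card + μ.rowLen 0 + d := by
  simp only [Fintype.card_fin, Fintype.card_sum, Fintype.card_coe, ← add_assoc]

theorem youngRank_placement (F : Type u) [Field F] (μ : YoungDiagram) (m b d : ℕ) :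
    youngRank F μ d (Placement m b (μ.cells ⊕ (Fin (μ.rowLen 0) ⊕ Fin d))) =
      ∑ a : WeakComposition m (μ.card + μ.rowLen 0 + d - b),
        youngRank F μ d (PlacementOfType (card_paddedCells μ d) a) :=
  SubMulAction.finrank_range_perm_eq_sum_fiber _ (Placement.type_smul (card_paddedCells μ d)) _

variable {a : WeakComposition m (μ.card + μ.rowLen 0 + d - b)}

/-- The restriction of a placement. -/
def restrictPlacement (h : PlacementOfType (card_paddedCells μ d) a) :
    Word μ.cells (Fin m ⊕ Fin b) := h.1.1 ∘ Sum.inl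

/-- Placements of the same type have equal value counts. If they agree on the cells of `μ`, their
counts on the first row agree as well, so a permutation of that row matches them. -/
theorem exists_smul_eq_of_restrict (h h' : PlacementOfType (card_paddedCells μ d) a)
    (hh : restrictPlacement h = restrictPlacement h') :
    ∃ τ, permInr μ.cells (Fin (μ.rowLen 0) ⊕ Fin d) τ • h = h' := by
  have h₁ := PlacementOfType.valueCount_eq h h'
  have h₂ : h.1.1 ∘ Sum.inl = h'.1.1 ∘ Sum.inl := hh
  rw [valueCount_sum, valueCount_sum h'.1.1, h₂, add_right_inj] at h₁
  obtain ⟨τ, hτ⟩ := exists_perm_of_valueCount_eq h₁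
  refine ⟨τ⁻¹, Subtype.ext (Subtype.ext (funext ?_))⟩
  rintro (p | r)
  · exact congrFun hh p
  · exact congrFun hτ r

/-- The injective words contribute exactly; each of the remaining words is charged a full dimension,
which is harmless since they are of lower order in `b`. -/
theorem factorial_mul_youngRank_le :
    μ.card ! * youngRank F μ d (PlacementOfType (card_paddedCells μ d) a) ≤
      (m + b).descFactorial μ.card * μ.dimSpecht F +
        μ.card ! * ((m + b) ^ μ.card - (m + b).descFactorial μ.card) := by
  have h := (youngRank_le (F := F) (θ := restrictPlacement (a := a)) (fun _ _ => rfl)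
    (fun _ _ => rfl) exists_smul_eq_of_restrict).trans
    (SubMulAction.finrank_range_perm_le (Word.injInto μ.cells Set.univ) _)
  refine (Nat.mul_le_mul_left _ h).trans (le_of_eq ?_)
  rw [mul_add, Word.factorial_mul_finrank_range_perm, Word.card_injInto]
  have h₁ : Nat.card (Set.univ : Set (Fin m ⊕ Fin b)) = m + b := by simp
  have h₂ : Nat.card (Word μ.cells (Fin m ⊕ Fin b)) = (m + b) ^ μ.card := by
    change Nat.card (μ.cells → Fin m ⊕ Fin b) = _
    rw [Nat.card_eq_fintype_card, Fintype.card_fun, Fintype.card_sum, Fintype.card_fin,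
      Fintype.card_fin, Fintype.card_coe]
  rw [h₁, h₂, Fintype.card_coe]

/-- Apply `le_youngRank` to the injective words whose values are labels `≥ μ.rowLen 0`. The smaller
labels are reserved for the tops of the columns of `μ`, where they detect any exchange with the
first row. -/
theorem le_factorial_mul_youngRank (hb : b ≤ μ.card + μ.rowLen 0 + d) :
    (b - μ.rowLen 0).descFactorial μ.card * μ.dimSpecht F ≤
      μ.card ! * youngRank F μ d (PlacementOfType (card_paddedCells μ d) a) := by
  have hcard : Nat.card (Sum.inr '' {j : Fin b | μ.rowLen 0 ≤ j} : Set (Fin m ⊕ Fin b)) =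
      b - μ.rowLen 0 := by
    rw [Nat.card_image_of_injective Sum.inr_injective, ← Nat.card_fin (b - μ.rowLen 0)]
    refine (Nat.card_eq_of_bijective (fun i => ⟨⟨μ.rowLen 0 + i, by omega⟩, Nat.le_add_right _ _⟩)
      ⟨fun i j h => ?_, fun ⟨j, hj⟩ => ?_⟩).symm
    · simpa [Fin.ext_iff] using h
    · simp only [Set.mem_ofPred_eq] at hj
      exact ⟨⟨j - μ.rowLen 0, by omega⟩, Subtype.ext (Fin.ext (by simp; omega))⟩
  rw [← hcard, ← Word.factorial_mul_finrank_range_perm]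
  refine Nat.mul_le_mul_left _ (le_youngRank (F := F) (θ := restrictPlacement (a := a))
    (fun _ _ => rfl) (fun _ _ => rfl) exists_smul_eq_of_restrict _ ?_)
  rintro u ⟨hu, hu'⟩
  choose u' hu₁ hu₂ using hu'
  have hJ : ∀ c : μ.cells, c.1.2 < μ.rowLen 0 := fun c =>
    (YoungDiagram.mem_iff_lt_rowLen.1 c.2).trans_le (μ.rowLen_anti 0 _ (Nat.zero_le _))
  -- Otherwise `μ` has a corner cell, whose label would be at least `μ.rowLen 0` and yet less than
  -- `b`.
  have hlb : μ.rowLen 0 ≤ b := by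
    by_contra! hlt
    have : (0, 0) ∈ μ := YoungDiagram.mem_iff_lt_rowLen.2 (by omega)
    have h := hu₁ ⟨(0, 0), this⟩
    have := (u' ⟨(0, 0), this⟩).2
    simp only [Set.mem_ofPred_eq] at h
    omega
  -- The lift carries the given word on `μ` and the label `j` at the `j`th cell of the first row;
  -- `v` then fills the rest of that row as the type prescribes.
  let w : μ.cells ⊕ Fin (μ.rowLen 0) → Fin b := Sum.elim u' (Fin.castLE hlb)
  have hw : Function.Injective w := by
    have hu₃ : Function.Injective u' := fun s t hst => hu (by rw [← hu₂, ← hu₂, hst])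
    refine hu₃.sumElim (Fin.castLE_injective hlb) fun c j h => ?_
    have := hu₁ c
    rw [h] at this
    exact absurd j.2 (not_lt.2 this)
  have hT : Fintype.card (μ.cells ⊕ Fin (μ.rowLen 0)) = μ.card + μ.rowLen 0 := by
    simp [YoungDiagram.card]
  obtain ⟨v, hv₁, hv₂⟩ := exists_placement (T := μ.cells ⊕ Fin (μ.rowLen 0)) (d := d)
    (by rwa [hT]) (⟨a.1, by rw [a.2, hT]⟩ : WeakComposition m _) hw
  let h : μ.cells ⊕ (Fin (μ.rowLen 0) ⊕ Fin d) → Fin m ⊕ Fin b :=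
    Sum.elim (Sum.inr ∘ w) v ∘ (Equiv.sumAssoc _ _ _).symm
  have hval : valueCount h = valueCount (Sum.elim (Sum.inr ∘ w) v) := valueCount_comp_equiv _ _
  let h' : PlacementOfType (card_paddedCells μ d) a :=
    ⟨⟨h, fun j => existsUnique_of_valueCount (by rw [hval, hv₂])⟩,
      Subtype.ext (funext fun i => by
        change valueCount h _ = _
        rw [hval, hv₁])⟩
  refine ⟨h', funext hu₂, fun g hg ⟨c, r, hcr⟩ hmem => ?_⟩
  -- The only first-row cell in the column of `c` is the one at its top.
  have hr : r = Sum.inl ⟨c.1.2, hJ c⟩ := by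
    have := hg (Sum.inl c)
    rw [hcr] at this
    have hc := hJ c
    rcases r with j | i <;> simp only [YoungDiagram.paddedCol, Sum.elim_inl, Sum.elim_inr] at this
    · exact congrArg _ (Fin.ext this)
    · omega
  subst hr
  -- That top cell is now occupied by the image of `c`, so it must itself move to a cell of `μ`,
  -- taking its reserved label along.
  obtain ⟨c', hc'⟩ : ∃ c', g (Sum.inr (Sum.inl ⟨c.1.2, hJ c⟩)) = Sum.inl c' := by
    have h₁ := hg (Sum.inr (Sum.inl ⟨c.1.2, hJ c⟩))
    have h₂ : g (Sum.inr (Sum.inl ⟨c.1.2, hJ c⟩)) ≠ Sum.inr (Sum.inl ⟨c.1.2, hJ c⟩) := fun h =>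
      Sum.inl_ne_inr (g.injective (hcr.trans h.symm))
    have hc := hJ c
    generalize g (Sum.inr (Sum.inl ⟨c.1.2, hJ c⟩)) = s at h₁ h₂
    rcases s with c' | j | i
    · exact ⟨c', rfl⟩
    · simp only [YoungDiagram.paddedCol, Sum.elim_inl, Sum.elim_inr] at h₁
      exact absurd (congrArg (fun x => Sum.inr (Sum.inl x)) (Fin.ext h₁)) h₂
    · simp only [YoungDiagram.paddedCol, Sum.elim_inl, Sum.elim_inr] at h₁
      omega
  obtain ⟨j, hj, hj'⟩ := hmem.2 c'
  have : restrictPlacement (g • h') c' = Sum.inr (Fin.castLE hlb ⟨c.1.2, hJ c⟩) := by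
    change h (g.symm (Sum.inl c')) = _
    rw [← hc', g.symm_apply_apply]
    rfl
  rw [← hj', Sum.inr.injEq] at this
  subst this
  exact absurd (hJ c) (not_lt.2 hj)

theorem factorial_mul_mulPadded_le (F : Type u) [Field F] [CharZero F] (m n : ℕ)
    (μ : YoungDiagram) (d : ℕ) :
    μ.card ! * ((SS F m).tensor (AA F n)).mulPadded μ (μ.card + μ.rowLen 0 + d) ≤
      ∑ b ∈ Finset.range (μ.card + μ.rowLen 0 + d + 1), n.multichoose b *
        ((m + b).descFactorial μ.card * μ.dimSpecht F +
          μ.card ! * ((m + b) ^ μ.card - (m + b).descFactorial μ.card)) *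
            m.multichoose (μ.card + μ.rowLen 0 + d - b) := by
  rw [mulPadded_eq, Finset.mul_sum]
  refine Finset.sum_le_sum fun b _ => ?_
  rw [youngRank_placement, mul_left_comm, Finset.mul_sum, mul_assoc]
  refine Nat.mul_le_mul_left _ ((Finset.sum_le_sum fun a _ =>
    factorial_mul_youngRank_le).trans_eq ?_)
  rw [Finset.sum_const, Finset.card_univ, card_weakComposition, smul_eq_mul, mul_comm]

theorem le_factorial_mul_mulPadded (F : Type u) [Field F] [CharZero F] (m n : ℕ)
    (μ : YoungDiagram) (d : ℕ) :
    ∑ b ∈ Finset.range (μ.card + μ.rowLen 0 + d + 1), n.multichoose b *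
        ((b - μ.rowLen 0).descFactorial μ.card * μ.dimSpecht F) *
          m.multichoose (μ.card + μ.rowLen 0 + d - b) ≤
      μ.card ! * ((SS F m).tensor (AA F n)).mulPadded μ (μ.card + μ.rowLen 0 + d) := by
  rw [mulPadded_eq, Finset.mul_sum]
  refine Finset.sum_le_sum fun b hb => ?_
  rw [youngRank_placement, mul_left_comm (μ.card !), Finset.mul_sum, mul_assoc]
  refine Nat.mul_le_mul_left _ (le_trans (le_of_eq ?_) (Finset.sum_le_sum fun a _ =>
    le_factorial_mul_youngRank (F := F) (Nat.lt_succ_iff.1 (Finset.mem_range.1 hb))))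
  rw [Finset.sum_const, Finset.card_univ, card_weakComposition, smul_eq_mul, mul_comm]

end SymSeq

/-! ### The case `n = 0`: an operator independent of `k` -/

/-- The restriction of a map to a summand. -/
def Word.restrict {S T C : Type} (u : Word (S ⊕ T) C) : Word S C := u ∘ Sum.inl

namespace Representation

variable {F V S : Type*} [Field F] [AddCommGroup V] [Module F V] [Fintype S] [DecidableEq S]
  [IsEmpty S]

theorem rowSum_of_isEmpty (ρ : Representation F (Equiv.Perm S) V) (row : S → ℕ) :
    ρ.rowSum row = LinearMap.id := by
  rw [rowSum, Finset.filter_true_of_mem fun _ _ s => isEmptyElim s, Fintype.sum_unique]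
  exact ρ.map_one

theorem colSum_of_isEmpty (ρ : Representation F (Equiv.Perm S) V) (col : S → ℕ) :
    ρ.colSum col = LinearMap.id := by
  rw [colSum, Finset.filter_true_of_mem fun _ _ s => isEmptyElim s, Fintype.sum_unique]
  simp only [Equiv.Perm.default_eq, Equiv.Perm.sign_one, Units.val_one, Int.cast_one, one_smul]
  exact ρ.map_one

theorem colSum_eq_of_forall {P R : Type*} [Fintype P] [DecidableEq P] [Fintype R] [DecidableEq R]
    (ρ : Representation F (Equiv.Perm (P ⊕ R)) V) (col : P ⊕ R → ℕ)
    (hcol : Function.Injective fun r => col (Sum.inr r))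
    (h : ∀ p r, col (Sum.inl p) ≠ col (Sum.inr r)) :
    ρ.colSum col = colSum (ρ.comp (permInl P R)) fun p => col (Sum.inl p) := by
  rw [colSum_eq_add ρ col hcol, Finset.sum_eq_zero, add_zero]
  intro g hg
  obtain ⟨hg, p, r, hr⟩ := (Finset.mem_filter.1 hg).2
  exact absurd ((hg (Sum.inl p)).symm.trans (congrArg col hr)) (h p r)

end Representation

namespace SymSeq

variable {F : Type u} [Field F] {μ : YoungDiagram} {m b d : ℕ}

open Representation

/-- The column of an element. -/
def innerCol (μ : YoungDiagram) : μ.cells ⊕ Fin (μ.rowLen 0) → ℕ :=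
  Sum.elim (fun c => c.1.2) fun j => j

/-- The operator whose rank is the leading multiplicity. -/
noncomputable def leadingOperator (F : Type u) [Field F] (μ : YoungDiagram) (C : Type) :
    (Word (μ.cells ⊕ Fin (μ.rowLen 0)) C →₀ F) →ₗ[F] (Word μ.cells C →₀ F) :=
  rowSum (perm F (Equiv.Perm μ.cells) (Word μ.cells C)) (fun c => c.1.1) ∘ₗ
    Finsupp.lmapDomain F F Word.restrict ∘ₗ
      colSum (perm F (Equiv.Perm (μ.cells ⊕ Fin (μ.rowLen 0)))
        (Word (μ.cells ⊕ Fin (μ.rowLen 0)) C)) (innerCol μ)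

variable {a : WeakComposition m (μ.card + μ.rowLen 0 + d - b)}

/-- The part of a placement on the cells and the first elements of the padding. -/
def innerPlacement (h : PlacementOfType (card_paddedCells μ d) a) :
    Word (μ.cells ⊕ Fin (μ.rowLen 0)) (Fin m ⊕ Fin b) := h.1.1 ∘ Sum.map id Sum.inl

/-- The last `d` cells are alone in their columns, so the column group fixes them and acts only on
the cells of `μ` and the first `μ.rowLen 0` cells of the padding. -/
theorem colSum_paddedCol {V : Type*} [AddCommGroup V] [Module F V]
    (ρ : Representation F (Equiv.Perm (μ.cells ⊕ (Fin (μ.rowLen 0) ⊕ Fin d))) V) :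
    ρ.colSum (μ.paddedCol d) = ∑ g : Equiv.Perm (μ.cells ⊕ Fin (μ.rowLen 0)) with
      ∀ s, innerCol μ (g s) = innerCol μ s, ((Equiv.Perm.sign g : ℤ) : F) •
        ρ ((Equiv.sumAssoc _ _ _).permCongr (permInl _ (Fin d) g)) := by
  let e := Equiv.sumAssoc μ.cells (Fin (μ.rowLen 0)) (Fin d)
  let σ : Representation F (Equiv.Perm ((μ.cells ⊕ Fin (μ.rowLen 0)) ⊕ Fin d)) V :=
    ρ.comp e.permCongrHom.toMonoidHom
  have h₁ : ρ.colSum (μ.paddedCol d) = σ.colSum (fun s => μ.paddedCol d (e s)) :=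
    LinearMap.ext fun v => (colSum_congr (σ := ρ) e LinearMap.id (fun _ _ => rfl) _ v).symm
  have hJ : ∀ s : μ.cells ⊕ Fin (μ.rowLen 0), innerCol μ s < μ.rowLen 0 := by
    rintro (c | j)
    · exact (YoungDiagram.mem_iff_lt_rowLen.1 c.2).trans_le (μ.rowLen_anti 0 _ (Nat.zero_le _))
    · exact j.2
  have h₂ : ∀ s, μ.paddedCol d (e (Sum.inl s)) = innerCol μ s := by
    rintro (c | j) <;> rfl
  rw [h₁, colSum_eq_of_forall σ _ fun i j h => Fin.ext (Nat.add_left_cancel h)]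
  · simp only [colSum, h₂]
    rfl
  · intro s i h
    have h₃ := hJ s
    rw [← h₂, h] at h₃
    exact absurd h₃ (not_lt.2 (Nat.le_add_right _ _))

theorem leadingOperator_single (h : PlacementOfType (card_paddedCells μ d) a) (r : F) :
    leadingOperator F μ _ (Finsupp.single (innerPlacement h) r) =
      (rowSum (perm F (Equiv.Perm μ.cells) (Word μ.cells (Fin m ⊕ Fin b))) (fun c => c.1.1) ∘ₗ
        Finsupp.lmapDomain F F restrictPlacement ∘ₗ
          colSum (perm F (Equiv.Perm (μ.cells ⊕ (Fin (μ.rowLen 0) ⊕ Fin d)))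
            (PlacementOfType (card_paddedCells μ d) a)) (μ.paddedCol d)) (Finsupp.single h r) := by
  rw [leadingOperator, LinearMap.comp_apply, LinearMap.comp_apply, LinearMap.comp_apply,
    LinearMap.comp_apply, colSum_paddedCol, colSum]
  congr 1
  simp only [LinearMap.sum_apply, map_sum, LinearMap.smul_apply, map_smul, perm_single,
    Finsupp.lmapDomain_apply, Finsupp.mapDomain_single]
  rfl

variable [CharZero F]

/-- The operator on placements sees only their inner words, so its image is contained in that of
`leadingOperator`. -/
theorem youngRank_le_leading :
    youngRank F μ d (PlacementOfType (card_paddedCells μ d) a) ≤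
      Module.finrank F (LinearMap.range (leadingOperator F μ (Fin m ⊕ Fin b))) := by
  rw [youngRank_eq (F := F) (θ := restrictPlacement (a := a)) (fun _ _ => rfl) (fun _ _ => rfl)
    exists_smul_eq_of_restrict]
  refine Submodule.finrank_mono ?_
  rintro _ ⟨v, rfl⟩
  induction v using Finsupp.induction_linear with
  | zero => simp
  | add v w hv hw =>
    rw [map_add]
    exact add_mem hv hw
  | single h r => exact ⟨_, leadingOperator_single h r⟩

/-- If every colour is available at least as often as there are inner cells, every inner word
extends to a placement of this type, and the two images coincide. -/
theorem leading_le_youngRank {a : WeakComposition m (μ.card + μ.rowLen 0 + d - 0)}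
    (ha : ∀ i, μ.card + μ.rowLen 0 ≤ a.1 i) :
    Module.finrank F (LinearMap.range (leadingOperator F μ (Fin m ⊕ Fin 0))) ≤
      youngRank F μ d (PlacementOfType (card_paddedCells μ d) a) := by
  rw [youngRank_eq (F := F) (θ := restrictPlacement (a := a)) (fun _ _ => rfl) (fun _ _ => rfl)
    exists_smul_eq_of_restrict]
  refine Submodule.finrank_mono ?_
  have hT : Fintype.card (μ.cells ⊕ Fin (μ.rowLen 0)) = μ.card + μ.rowLen 0 := by
    simp [YoungDiagram.card]
  rintro _ ⟨v, rfl⟩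
  induction v using Finsupp.induction_linear with
  | zero => simp
  | add v w hv hw =>
    rw [map_add]
    exact add_mem hv hw
  | single w r =>
    let D : Fin m ⊕ Fin 0 →₀ ℕ := Finsupp.equivFunOnFinite.symm (Sum.elim a.1 Fin.elim0)
    have hle : valueCount (S := μ.cells ⊕ Fin (μ.rowLen 0)) w ≤ D := by
      rintro (i | j)
      · exact (valueCount_le_card _ _).trans (hT.trans_le (ha i))
      · exact j.elim0
    obtain ⟨v, hv⟩ := exists_sumElim_valueCount_eq hle (d := d) (by
      rw [Finsupp.degree_eq_sum, Fintype.sum_sum_type, hT]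
      exact a.2)
    let h : μ.cells ⊕ (Fin (μ.rowLen 0) ⊕ Fin d) → Fin m ⊕ Fin 0 :=
      Sum.elim w v ∘ (Equiv.sumAssoc _ _ _).symm
    have hval : valueCount h = D := (valueCount_comp_equiv _ _).trans hv
    let h' : PlacementOfType (card_paddedCells μ d) a :=
      ⟨⟨h, fun j => j.elim0⟩, Subtype.ext (funext fun i => DFunLike.congr_fun hval (Sum.inl i))⟩
    refine ⟨Finsupp.single h' r, ?_⟩
    rw [← leadingOperator_single]
    have : innerPlacement h' = w := by
      funext s
      rcases s with c | j <;> rfl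
    rw [this]

/-- Adding `e` to every part embeds the compositions of `k - m * e`. -/
theorem multichoose_le_card (m k e : ℕ) (h : m * e ≤ k)
    [DecidablePred fun a : WeakComposition m k => ∀ i, e ≤ a.1 i] :
    m.multichoose (k - m * e) ≤
      Finset.card {a : WeakComposition m k | ∀ i, e ≤ a.1 i} := by
  rw [← card_weakComposition, ← Finset.card_univ]
  refine Finset.card_le_card_of_injOn (fun a => ⟨fun i => a.1 i + e, ?_⟩) (fun a _ => ?_)
    fun a _ a' _ h => ?_
  · rw [Finset.sum_add_distrib, a.2, Finset.sum_const, Finset.card_univ, Fintype.card_fin,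
      smul_eq_mul, Nat.sub_add_cancel h]
  · simp
  · refine Subtype.ext (funext fun i => ?_)
    have := congrFun (congrArg Subtype.val h) i
    simpa using this

/-- With `n = 0` there are no decorations unless `b = 0`, so only pure colourings remain. -/
theorem mulPadded_zero (F : Type u) [Field F] [CharZero F] (m : ℕ) (μ : YoungDiagram) (d : ℕ) :
    ((SS F m).tensor (AA F 0)).mulPadded μ (μ.card + μ.rowLen 0 + d) =
      ∑ a : WeakComposition m (μ.card + μ.rowLen 0 + d - 0),
        youngRank F μ d (PlacementOfType (card_paddedCells μ d) a) := by
  rw [mulPadded_eq, Finset.sum_range_succ', Finset.sum_eq_zero fun b _ => ?_, zero_add,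
    Nat.multichoose_zero_right, one_mul, youngRank_placement]
  rw [Nat.multichoose_zero_succ, zero_mul]

theorem mulPadded_zero_le (F : Type u) [Field F] [CharZero F] (m : ℕ) (μ : YoungDiagram) (d : ℕ) :
    ((SS F m).tensor (AA F 0)).mulPadded μ (μ.card + μ.rowLen 0 + d) ≤
      Module.finrank F (LinearMap.range (leadingOperator F μ (Fin m ⊕ Fin 0))) *
        m.multichoose (μ.card + μ.rowLen 0 + d) := by
  rw [mulPadded_zero]
  refine (Finset.sum_le_sum fun a _ => youngRank_le_leading).trans_eq ?_
  rw [Finset.sum_const, Finset.card_univ, card_weakComposition, smul_eq_mul, mul_comm]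
  rfl

theorem le_mulPadded_zero (F : Type u) [Field F] [CharZero F] (m : ℕ) (μ : YoungDiagram) (d : ℕ)
    (h : m * (μ.card + μ.rowLen 0) ≤ μ.card + μ.rowLen 0 + d) :
    Module.finrank F (LinearMap.range (leadingOperator F μ (Fin m ⊕ Fin 0))) *
        m.multichoose (μ.card + μ.rowLen 0 + d - m * (μ.card + μ.rowLen 0)) ≤
      ((SS F m).tensor (AA F 0)).mulPadded μ (μ.card + μ.rowLen 0 + d) := by
  classical
  rw [mulPadded_zero]
  refine le_trans ?_ (Finset.sum_le_sum_of_subset (Finset.subset_univ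
    {a : WeakComposition m _ | ∀ i, μ.card + μ.rowLen 0 ≤ a.1 i}))
  refine le_trans ?_ (Finset.card_nsmul_le_sum _ _ _ fun a ha =>
    leading_le_youngRank (F := F) (Finset.mem_filter.1 ha).2)
  rw [smul_eq_mul, mul_comm]
  exact Nat.mul_le_mul_right _ (multichoose_le_card _ _ _ h)

/-- For the empty diagram both sums are the identity and there is just one word; this gives `c_∅ =
1`. -/
theorem finrank_leadingOperator_bot (F : Type u) [Field F] (C : Type)  :
    Module.finrank F (LinearMap.range (leadingOperator F ⊥ C)) = 1 := by
  have h₁ : IsEmpty (⊥ : YoungDiagram).cells := ⟨fun c => YoungDiagram.notMem_bot _ c.2⟩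
  have h₂ : (⊥ : YoungDiagram).rowLen 0 = 0 := by
    by_contra h
    exact YoungDiagram.notMem_bot (0, 0)
      (YoungDiagram.mem_iff_lt_rowLen.2 (Nat.pos_of_ne_zero h))
  have h₃ : IsEmpty ((⊥ : YoungDiagram).cells ⊕ Fin ((⊥ : YoungDiagram).rowLen 0)) := by
    rw [h₂]
    infer_instance
  let _ : Unique (Word (⊥ : YoungDiagram).cells C) := Pi.uniqueOfIsEmpty _
  rw [leadingOperator, rowSum_of_isEmpty, colSum_of_isEmpty, LinearMap.id_comp, LinearMap.comp_id,
    LinearMap.range_eq_top.2, finrank_top, Module.finrank_finsupp_self, Fintype.card_unique]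
  refine Finsupp.mapDomain_surjective fun u => ⟨fun s => isEmptyElim s, Subsingleton.elim _ _⟩

end SymSeq

/-! ### Asymptotics of convolutions -/

open scoped Topology

theorem tendsto_comp_sub_div_pow {f : ℕ → ℝ} {r : ℕ} {α : ℝ}
    (h : Tendsto (fun k => f k / (k : ℝ) ^ r) atTop (𝓝 α)) (c : ℕ) :
    Tendsto (fun k => f (k - c) / (k : ℝ) ^ r) atTop (𝓝 α) := by
  rw [← tendsto_add_atTop_iff_nat c]
  have := h.mul ((tendsto_natCast_div_add_atTop (c : ℝ)).pow r)
  rw [one_pow, mul_one] at this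
  refine this.congr' ?_
  filter_upwards [eventually_gt_atTop 0] with k hk
  have : (k : ℝ) ≠ 0 := Nat.cast_ne_zero.2 hk.ne'
  rw [Nat.add_sub_cancel, div_pow, Nat.cast_add]
  field_simp

theorem tendsto_comp_add_div_pow {f : ℕ → ℝ} {r : ℕ} {α : ℝ}
    (h : Tendsto (fun k => f k / (k : ℝ) ^ r) atTop (𝓝 α)) (c : ℕ) :
    Tendsto (fun k => f (k + c) / (k : ℝ) ^ r) atTop (𝓝 α) := by
  have := ((tendsto_add_atTop_iff_nat c).2 h).div
    ((tendsto_natCast_div_add_atTop (c : ℝ)).pow r) (by simp)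
  rw [one_pow, div_one] at this
  refine this.congr' ?_
  filter_upwards [eventually_gt_atTop 0] with k hk
  have : (k : ℝ) ≠ 0 := Nat.cast_ne_zero.2 hk.ne'
  have : (k : ℝ) + c ≠ 0 := by positivity
  rw [Pi.div_apply, div_pow, Nat.cast_add]
  field_simp

theorem tendsto_descFactorial_div_pow (r : ℕ) :
    Tendsto (fun k : ℕ => (k.descFactorial r : ℝ) / (k : ℝ) ^ r) atTop (𝓝 1) := by
  refine (isEquivalent_iff_tendsto_one ?_).1 (isEquivalent_descFactorial r)
  filter_upwards [eventually_gt_atTop 0] with k hk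
  have : (k : ℝ) ≠ 0 := Nat.cast_ne_zero.2 hk.ne'
  positivity

theorem tendsto_multichoose_div_pow (r : ℕ) :
    Tendsto (fun k : ℕ => ((r + 1).multichoose k : ℝ) / (k : ℝ) ^ r) atTop (𝓝 (1 / r !)) := by
  have h : ∀ k : ℕ, ((r + 1).multichoose k : ℝ) = ((k + r).descFactorial r : ℝ) / r ! := fun k => by
    rw [eq_div_iff (by positivity), ← Nat.cast_mul, Nat.multichoose_eq,
      Nat.descFactorial_eq_factorial_mul_choose, mul_comm, show r + 1 + k - 1 = r + k by omega,
      add_comm k r, Nat.choose_symm_add]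
  simp only [h]
  have := (tendsto_comp_add_div_pow (tendsto_descFactorial_div_pow r) r).div_const (r ! : ℝ)
  refine this.congr fun k => ?_
  ring

theorem one_le_multichoose_succ (r k : ℕ) : 1 ≤ (r + 1).multichoose k := by
  rw [Nat.multichoose_eq]
  exact Nat.choose_pos (by omega)

/-- Since `(m + 1).multichoose` is the sequence of partial sums of `m.multichoose`, convolution with
it is one more summation. This reduces convolutions to iterated partial sums. -/
theorem sum_multichoose_succ (f : ℕ → ℝ) (m k : ℕ) :
    ∑ b ∈ Finset.range (k + 1), f b * ((m + 1).multichoose (k - b) : ℝ) =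
      ∑ j ∈ Finset.range (k + 1), ∑ b ∈ Finset.range (j + 1),
        f b * (m.multichoose (j - b) : ℝ) := by
  induction k with
  | zero => simp [Nat.multichoose_zero_right]
  | succ k ih =>
    rw [Finset.sum_range_succ _ (k + 1), Finset.sum_range_succ _ (k + 1), ← ih,
      Finset.sum_range_succ _ (k + 1), ← add_assoc, ← Finset.sum_add_distrib]
    simp only [Nat.sub_self, Nat.multichoose_zero_right]
    congr 1
    refine Finset.sum_congr rfl fun b hb => ?_
    have : b ≤ k := Nat.lt_succ_iff.1 (Finset.mem_range.1 hb)
    rw [Nat.succ_sub this, Nat.succ_eq_add_one, Nat.multichoose_succ_succ]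
    push_cast
    ring

/-- The comparison is with `multichoose` instead of powers because its partial sums are again
exactly of this form, so each summation just raises the index. -/
theorem isLittleO_sum_multichoose {f : ℕ → ℝ} {r : ℕ} {β : ℝ}
    (h : (fun k => f k - β * ((r + 1).multichoose k : ℝ)) =o[atTop]
      fun k => ((r + 1).multichoose k : ℝ)) (m : ℕ) :
    (fun k => ∑ b ∈ Finset.range (k + 1), f b * (m.multichoose (k - b) : ℝ) -
      β * ((r + m + 1).multichoose k : ℝ)) =o[atTop] fun k => ((r + m + 1).multichoose k : ℝ) := by
  induction m with
  | zero =>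
    refine h.congr_left fun k => ?_
    rw [Finset.sum_range_succ, Finset.sum_eq_zero fun b hb => ?_]
    · simp [Nat.multichoose_zero_right]
    · obtain ⟨t, ht⟩ := Nat.exists_eq_add_of_lt (Finset.mem_range.1 hb)
      rw [show k - b = t + 1 by omega, Nat.multichoose_zero_succ]
      simp
  | succ m ih =>
    have hsum : ∀ k, ∑ j ∈ Finset.range (k + 1), ((r + m + 1).multichoose j : ℝ) =
        ((r + (m + 1) + 1).multichoose k : ℝ) := fun k => by
      induction k with
      | zero => simp [Nat.multichoose_zero_right]
      | succ k ihk =>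
        rw [Finset.sum_range_succ, ihk, show r + (m + 1) + 1 = (r + m + 1) + 1 by ring,
          Nat.multichoose_succ_succ (r + m + 1) k]
        push_cast
        ring
    -- Little-o passes to partial sums because the comparison series has terms at least `1` and so
    -- diverges.
    have h₁ := ih.sum_range (fun k => Nat.cast_nonneg _) (by
      refine tendsto_atTop_mono (fun k => ?_) tendsto_natCast_atTop_atTop
      calc (k : ℝ) = ∑ _j ∈ Finset.range k, (1 : ℝ) := by simp
        _ ≤ _ := Finset.sum_le_sum fun j _ => by exact_mod_cast one_le_multichoose_succ _ _)
    refine (h₁.comp_tendsto (tendsto_add_atTop_nat 1)).congr (fun k => ?_) fun k => ?_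
    · simp only [Function.comp_apply]
      rw [Finset.sum_sub_distrib, ← sum_multichoose_succ, ← Finset.mul_sum, hsum]
    · exact hsum k

theorem tendsto_sum_multichoose {f : ℕ → ℝ} {r : ℕ} {α : ℝ}
    (h : Tendsto (fun k => f k / (k : ℝ) ^ r) atTop (𝓝 α)) (m : ℕ) :
    Tendsto (fun k : ℕ => (∑ b ∈ Finset.range (k + 1), f b * (m.multichoose (k - b) : ℝ)) /
      (k : ℝ) ^ (r + m)) atTop (𝓝 (α * r ! / (r + m)!)) := by
  have hne : ∀ s k, ((s + 1).multichoose k : ℝ) ≠ 0 := fun s k =>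
    Nat.cast_ne_zero.2 (Nat.one_le_iff_ne_zero.1 (one_le_multichoose_succ s k))
  have h₁ : Tendsto (fun k => f k / ((r + 1).multichoose k : ℝ)) atTop (𝓝 (α * r !)) := by
    have := h.div (tendsto_multichoose_div_pow r) (by positivity)
    rw [div_div_eq_mul_div, div_one] at this
    refine this.congr' ?_
    filter_upwards [eventually_gt_atTop 0] with k hk
    have : (k : ℝ) ≠ 0 := Nat.cast_ne_zero.2 hk.ne'
    have := hne r k
    rw [Pi.div_apply]
    field_simp
  have h₂ := isLittleO_sum_multichoose (f := f) (β := α * r !) (r := r) (by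
    rw [isLittleO_iff_tendsto fun k hk => absurd hk (hne r k)]
    have := h₁.sub_const (α * r !)
    rw [sub_self] at this
    refine this.congr fun k => ?_
    have := hne r k
    field_simp) m
  rw [isLittleO_iff_tendsto fun k hk => absurd hk (hne _ k)] at h₂
  have := (h₂.add_const (α * r !)).mul (tendsto_multichoose_div_pow (r + m))
  rw [zero_add, mul_one_div] at this
  refine this.congr fun k => ?_
  have := hne (r + m) k
  field_simp
  ring

theorem isLittleO_sub_pow {f : ℕ → ℝ} {r : ℕ} {α : ℝ}
    (h : Tendsto (fun k => f k / (k : ℝ) ^ r) atTop (𝓝 α)) :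
    (fun k : ℕ => f k - α * (k : ℝ) ^ r) =o[atTop] fun k : ℕ => (k : ℝ) ^ r := by
  have hne : ∀ᶠ k : ℕ in atTop, (k : ℝ) ^ r ≠ 0 := by
    filter_upwards [eventually_gt_atTop 0] with k hk
    have : (k : ℝ) ≠ 0 := Nat.cast_ne_zero.2 hk.ne'
    positivity
  rw [isLittleO_iff_tendsto' (hne.mono fun k hk hk' => absurd hk' hk)]
  have := h.sub_const α
  rw [sub_self] at this
  refine this.congr' (hne.mono fun k hk => ?_)
  field_simp

/-! ### Limits of dimensions and multiplicities -/

namespace SymSeq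

section Dimension

variable (F : Type u) [Field F] (m n : ℕ)

theorem dim_zero (k : ℕ) : ((SS F m).tensor (AA F 0)).dim k = m ^ k := by
  rw [dim_eq, Finset.sum_range_succ, Finset.sum_eq_zero fun j hj => ?_]
  · simp [Nat.multichoose_zero_right]
  · obtain ⟨t, ht⟩ := Nat.exists_eq_add_of_lt (Finset.mem_range.1 hj)
    rw [show k - j = t + 1 by omega, Nat.multichoose_zero_succ]
    simp

theorem dim_div_factorial (k : ℕ) :
    (((SS F m).tensor (AA F n)).dim k : ℝ) / k ! =
      ∑ j ∈ Finset.range (k + 1), (m : ℝ) ^ j / j ! * (n.multichoose (k - j) : ℝ) := by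
  rw [dim_eq, Nat.cast_sum, Finset.sum_div]
  refine Finset.sum_congr rfl fun j hj => ?_
  have h := Nat.choose_mul_factorial_mul_factorial (Nat.lt_succ_iff.1 (Finset.mem_range.1 hj))
  have hk : (k.choose j : ℝ) * j ! * (k - j)! = k ! := by exact_mod_cast h
  have h₁ : (k ! : ℝ) ≠ 0 := by positivity
  have h₂ : (j ! : ℝ) ≠ 0 := by positivity
  push_cast
  rw [div_mul_eq_mul_div, div_eq_div_iff h₁ h₂, ← hk]
  ring

theorem multichoose_mono_right {j k : ℕ} (h : j ≤ k) :
    (n + 1).multichoose j ≤ (n + 1).multichoose k := by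
  refine monotone_nat_of_le_succ (f := fun k => (n + 1).multichoose k) (fun k => ?_) h
  rw [Nat.multichoose_succ_succ]
  exact Nat.le_add_left _ _

theorem tendsto_dim : Tendsto (fun k : ℕ => (((SS F m).tensor (AA F (n + 1))).dim k : ℝ) /
    ((k : ℝ) ^ n * k !)) atTop (𝓝 (Real.exp m / n !)) := by
  have hmc := tendsto_multichoose_div_pow n
  obtain ⟨B, hB⟩ := hmc.bddAbove_range
  have hB' : ∀ k : ℕ, ((n + 1).multichoose k : ℝ) / (k : ℝ) ^ n ≤ B := fun k => hB ⟨k, rfl⟩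
  -- For fixed `j` the ratio tends to `1 / n!`. Monotonicity of `multichoose` bounds it by `B`
  -- uniformly in `j` and `k`, so the exponential series dominates.
  have key := tendsto_tsum_of_dominated_convergence (𝓕 := atTop)
    (f := fun k j : ℕ => if j ∈ Finset.range (k + 1) then
      (m : ℝ) ^ j / j ! * (((n + 1).multichoose (k - j) : ℝ) / (k : ℝ) ^ n) else 0)
    (g := fun j => (m : ℝ) ^ j / j ! * (1 / n !)) (bound := fun j => (m : ℝ) ^ j / j ! * B)
    ((Real.summable_pow_div_factorial m).mul_right B)
    (fun j => by
      refine ((tendsto_comp_sub_div_pow hmc j).const_mul ((m : ℝ) ^ j / j !)).congr' ?_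
      filter_upwards [eventually_ge_atTop j] with k hk
      rw [if_pos (Finset.mem_range.2 (Nat.lt_succ_iff.2 hk))])
    (Eventually.of_forall fun k j => by
      have h₀ : 0 ≤ B := le_trans (by positivity) (hB' 0)
      split_ifs
      · rw [Real.norm_of_nonneg (by positivity)]
        refine mul_le_mul_of_nonneg_left (le_trans ?_ (hB' k)) (by positivity)
        gcongr
        exact multichoose_mono_right n (Nat.sub_le _ _)
      · rw [norm_zero]
        positivity)
  have hexp : ∑' j : ℕ, (m : ℝ) ^ j / j ! = Real.exp m := by
    rw [Real.exp_eq_exp_ℝ, NormedSpace.exp_eq_tsum_div]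
  rw [tsum_mul_right, hexp, mul_one_div] at key
  refine key.congr fun k => ?_
  rw [tsum_eq_sum (s := Finset.range (k + 1)) fun j hj => if_neg hj,
    Finset.sum_congr rfl fun j hj => if_pos hj, mul_comm ((k : ℝ) ^ n), ← div_div,
    dim_div_factorial, Finset.sum_div]
  exact Finset.sum_congr rfl fun j _ => (mul_div_assoc _ _ _).symm

end Dimension

section Multiplicity

variable (F : Type u) [Field F] [CharZero F] (m n : ℕ) (μ : YoungDiagram)

/-- The two bounds have summands with the same leading term in `b`, so convolution with
`m.multichoose` gives them the same limit and the multiplicity is squeezed. -/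
theorem tendsto_mulPadded :
    Tendsto (fun k : ℕ => (((SS F m).tensor (AA F (n + 1))).mulPadded μ k : ℝ) /
      (k : ℝ) ^ (μ.card + m + n)) atTop
        (𝓝 (μ.dimSpecht F / (μ.card + m + n)! * ((μ.card + n).choose n : ℝ))) := by
  set p := μ.card with hp
  set D : ℝ := (μ.dimSpecht F : ℝ) with hD
  have hmc := tendsto_multichoose_div_pow n
  have hdesc := tendsto_descFactorial_div_pow p
  have hpow : Tendsto (fun k : ℕ => (k : ℝ) ^ p / (k : ℝ) ^ p) atTop (𝓝 1) := by
    refine tendsto_const_nhds.congr' ?_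
    filter_upwards [eventually_gt_atTop 0] with k hk
    have : (k : ℝ) ≠ 0 := Nat.cast_ne_zero.2 hk.ne'
    field_simp
  have hlow : Tendsto (fun b : ℕ => ((n + 1).multichoose b : ℝ) *
      (((b - μ.rowLen 0).descFactorial p : ℝ) * D) / (b : ℝ) ^ (n + p)) atTop (𝓝 (D / n !)) := by
    have := hmc.mul ((tendsto_comp_sub_div_pow hdesc (μ.rowLen 0)).mul_const D)
    rw [one_mul, one_div_mul_eq_div] at this
    refine this.congr fun k => ?_
    rw [pow_add]
    ring
  -- The non-injective words drop out because `(m + b)^p` and the falling factorial have the same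
  -- leading term.
  have hup : Tendsto (fun b : ℕ => ((n + 1).multichoose b : ℝ) *
      (((m + b).descFactorial p : ℝ) * D + p ! * (((m + b : ℕ) : ℝ) ^ p -
        ((m + b).descFactorial p : ℝ))) / (b : ℝ) ^ (n + p)) atTop (𝓝 (D / n !)) := by
    have h₁ := tendsto_comp_add_div_pow hdesc m
    have h₂ := tendsto_comp_add_div_pow hpow m
    have := hmc.mul ((h₁.mul_const D).add ((h₂.sub h₁).const_mul (p ! : ℝ)))
    rw [one_mul, sub_self, mul_zero, add_zero, one_div_mul_eq_div] at this
    refine this.congr fun k => ?_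
    rw [pow_add, add_comm k m]
    ring
  -- The convolution contributes `(n + p)! / (n + p + m)!`; together with the `1 / n!` of the
  -- decorations and the `1 / p!` of the free action this produces the binomial coefficient.
  have hlim : D / n ! * (n + p)! / (n + p + m)! / p ! =
      D / (p + m + n)! * ((p + n).choose n : ℝ) := by
    rw [Nat.add_choose p n, Nat.cast_div (Nat.factorial_mul_factorial_dvd_factorial_add p n)
      (by positivity), show n + p + m = p + m + n by ring, add_comm n p]
    push_cast
    field_simp
  have h₁ := (tendsto_sum_multichoose hlow m).div_const (p ! : ℝ)
  have h₂ := (tendsto_sum_multichoose hup m).div_const (p ! : ℝ)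
  rw [hlim] at h₁ h₂
  have hpf : (0 : ℝ) < p ! := by positivity
  refine tendsto_of_tendsto_of_tendsto_of_le_of_le' h₁ h₂ ?_ ?_
  · filter_upwards [eventually_ge_atTop (p + μ.rowLen 0)] with k hk
    obtain ⟨d, rfl⟩ := Nat.exists_eq_add_of_le hk
    have := le_factorial_mul_mulPadded F m (n + 1) μ d
    rw [div_div, mul_comm _ (p ! : ℝ), ← div_div, show n + p + m = p + m + n by ring]
    gcongr
    rw [div_le_iff₀ hpf, mul_comm _ (p ! : ℝ)]
    refine le_trans (le_of_eq ?_) (Nat.cast_le (α := ℝ).2 this |>.trans_eq (by push_cast; rfl))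
    push_cast
    rfl
  · filter_upwards [eventually_ge_atTop (p + μ.rowLen 0)] with k hk
    obtain ⟨d, rfl⟩ := Nat.exists_eq_add_of_le hk
    have := factorial_mul_mulPadded_le F m (n + 1) μ d
    rw [div_div, mul_comm _ (p ! : ℝ), ← div_div, show n + p + m = p + m + n by ring]
    gcongr
    rw [le_div_iff₀ hpf, mul_comm _ (p ! : ℝ)]
    refine le_trans (le_of_eq (by push_cast; rfl)) ((Nat.cast_le (α := ℝ).2 this).trans_eq ?_)
    rw [Nat.cast_sum]
    refine Finset.sum_congr rfl fun b _ => ?_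
    rw [Nat.cast_mul, Nat.cast_mul, Nat.cast_add, Nat.cast_mul, Nat.cast_mul,
      Nat.cast_sub (Nat.descFactorial_le_pow _ _), Nat.cast_pow]

/-- The leading multiplicity. -/
noncomputable def leadingMul (F : Type u) [Field F] (m : ℕ) (μ : YoungDiagram) : ℕ :=
  Module.finrank F (LinearMap.range (leadingOperator F μ (Fin m ⊕ Fin 0)))

/-- The bounds are the same rank times the number of all types and times a lower bound for the
number of types using every colour often enough. Shifting the argument of `multichoose` by a
constant does not affect its leading term. -/
theorem tendsto_mulPadded_zero :
    Tendsto (fun k : ℕ => (((SS F (m + 1)).tensor (AA F 0)).mulPadded μ k : ℝ) / (k : ℝ) ^ m) atTop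
      (𝓝 (leadingMul F (m + 1) μ / m !)) := by
  have hmc := tendsto_multichoose_div_pow m
  have h₁ := (tendsto_comp_sub_div_pow hmc ((m + 1) * (μ.card + μ.rowLen 0))).const_mul
    (leadingMul F (m + 1) μ : ℝ)
  have h₂ := hmc.const_mul (leadingMul F (m + 1) μ : ℝ)
  rw [mul_one_div] at h₁ h₂
  refine tendsto_of_tendsto_of_tendsto_of_le_of_le' h₁ h₂ ?_ ?_
  · filter_upwards [eventually_ge_atTop (μ.card + μ.rowLen 0),
      eventually_ge_atTop ((m + 1) * (μ.card + μ.rowLen 0))] with k hk hk'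
    obtain ⟨d, rfl⟩ := Nat.exists_eq_add_of_le hk
    have := le_mulPadded_zero F (m + 1) μ d hk'
    rw [← mul_div_assoc]
    gcongr
    exact_mod_cast this
  · filter_upwards [eventually_ge_atTop (μ.card + μ.rowLen 0)] with k hk
    obtain ⟨d, rfl⟩ := Nat.exists_eq_add_of_le hk
    have := mulPadded_zero_le F (m + 1) μ d
    rw [← mul_div_assoc]
    gcongr
    exact_mod_cast this

end Multiplicity

end SymSeq

/-! ### The main theorem -/

theorem isLittleO_pow_of_tendsto {f : ℕ → ℝ} {r s : ℕ} {α : ℝ} (hrs : r < s)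
    (h : Tendsto (fun k => f k / (k : ℝ) ^ r) atTop (𝓝 α)) :
    f =o[atTop] fun k : ℕ => (k : ℝ) ^ s := by
  have h' : (fun k : ℕ => (k : ℝ) ^ r) =o[atTop] fun k : ℕ => (k : ℝ) ^ s :=
    (isLittleO_pow_pow_atTop_of_lt hrs).comp_tendsto tendsto_natCast_atTop_atTop
  refine (((isLittleO_sub_pow h).trans h').add (h'.const_mul_left α)).congr_left fun k => ?_
  ring

theorem mainTheorem6 (F : Type u) [Field F] (m n : ℕ) :
    -- the weight `k` parts are finite-dimensional
    (∀ k : ℕ, Module.Finite F (((SymSeq.SS F m).tensor (SymSeq.AA F n)).obj (Fin k))) ∧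
    -- dimensions
    ((fun k : ℕ => (((SymSeq.SS F m).tensor (SymSeq.AA F n)).dim k : ℝ))
      =o[atTop] fun k : ℕ => (k : ℝ) ^ n * (k ! : ℝ)) ∧
    (0 < n →
      (fun k : ℕ => (((SymSeq.SS F m).tensor (SymSeq.AA F n)).dim k : ℝ)
          - Real.exp m / ((n - 1)! : ℝ) * (k : ℝ) ^ (n - 1) * (k ! : ℝ))
        =o[atTop] fun k : ℕ => (k : ℝ) ^ (n - 1) * (k ! : ℝ)) ∧
    (n = 0 → ∀ k : ℕ, ((SymSeq.SS F m).tensor (SymSeq.AA F n)).dim k = m ^ k) ∧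
    -- multiplicities, in characteristic zero
    (CharZero F →
      (∀ μ : YoungDiagram,
        (fun k : ℕ => (((SymSeq.SS F m).tensor (SymSeq.AA F n)).mulPadded μ k : ℝ))
          =o[atTop] fun k : ℕ => (k : ℝ) ^ μ.card * (k : ℝ) ^ (m + n)) ∧
      (0 < n → ∀ μ : YoungDiagram,
        (fun k : ℕ => (((SymSeq.SS F m).tensor (SymSeq.AA F n)).mulPadded μ k : ℝ)
            - (μ.dimSpecht F : ℝ) / ((μ.card + m + n - 1)! : ℝ)
              * ((μ.card + n - 1).choose (n - 1) : ℝ) * (k : ℝ) ^ (μ.card + m + n - 1))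
          =o[atTop] fun k : ℕ => (k : ℝ) ^ (μ.card + m + n - 1)) ∧
      (n = 0 → 0 < m → ∃ c : YoungDiagram → ℝ, (∀ μ, 0 ≤ c μ) ∧ c ⊥ = 1 ∧
        ∀ μ : YoungDiagram,
          (fun k : ℕ => (((SymSeq.SS F m).tensor (SymSeq.AA F n)).mulPadded μ k : ℝ)
              - c μ / ((m - 1)! : ℝ) * (k : ℝ) ^ (m - 1))
            =o[atTop] fun k : ℕ => (k : ℝ) ^ (m - 1))) := by
  refine ⟨fun k => SymSeq.finite_obj m n (Fin k), ?_, ?_, ?_, fun _ => ⟨fun μ => ?_, ?_, ?_⟩⟩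
  · have hdiv : Tendsto (fun k : ℕ => (((SymSeq.SS F m).tensor (SymSeq.AA F n)).dim k : ℝ) / k ! /
        (k : ℝ) ^ n) atTop (𝓝 0) := by
      cases n with
      | zero =>
        refine (FloorSemiring.tendsto_pow_div_factorial_atTop (m : ℝ)).congr fun k => ?_
        rw [SymSeq.dim_zero, pow_zero, div_one, Nat.cast_pow]
      | succ n =>
        have := (SymSeq.tendsto_dim F m n).mul (tendsto_one_div_atTop_nhds_zero_nat (𝕜 := ℝ))
        rw [mul_zero] at this
        refine this.congr fun k => ?_
        rw [pow_succ]
        ring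
    refine (isLittleO_iff_tendsto' ?_).2 (hdiv.congr fun k => by rw [div_div, mul_comm])
    filter_upwards [eventually_gt_atTop 0] with k hk h
    have : (k : ℝ) ≠ 0 := Nat.cast_ne_zero.2 hk.ne'
    exact absurd h (by positivity)
  · intro hn
    obtain ⟨n, rfl⟩ := Nat.exists_eq_add_of_lt hn
    rw [zero_add, Nat.add_sub_cancel]
    have hne : ∀ᶠ k : ℕ in atTop, (k : ℝ) ^ n * (k ! : ℝ) ≠ 0 := by
      filter_upwards [eventually_gt_atTop 0] with k hk
      have : (k : ℝ) ≠ 0 := Nat.cast_ne_zero.2 hk.ne'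
      positivity
    refine (isLittleO_iff_tendsto' (hne.mono fun k hk hk' => absurd hk' hk)).2 ?_
    have := (SymSeq.tendsto_dim F m n).sub_const (Real.exp m / n !)
    rw [sub_self] at this
    refine this.congr' (hne.mono fun k hk => ?_)
    beta_reduce
    rw [sub_div, mul_assoc, mul_div_cancel_right₀ _ hk]
  · rintro rfl k
    exact SymSeq.dim_zero F m k
  · simp only [← pow_add]
    cases n with
    | zero =>
      cases m with
      | zero =>
        -- For `m = n = 0` there are no placements on a nonempty set, so the multiplicity is
        -- eventually zero.
        refine (isLittleO_zero _ _).congr' ?_ EventuallyEq.rfl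
        filter_upwards [eventually_ge_atTop (μ.card + μ.rowLen 0),
          eventually_gt_atTop 0] with k hk hk'
        obtain ⟨d, rfl⟩ := Nat.exists_eq_add_of_le hk
        have := SymSeq.mulPadded_zero_le F 0 μ d
        obtain ⟨t, ht⟩ := Nat.exists_eq_add_of_lt hk'
        rw [ht, zero_add, Nat.multichoose_zero_succ, mul_zero, Nat.le_zero] at this
        rw [ht, zero_add, this, Nat.cast_zero]
      | succ m => exact isLittleO_pow_of_tendsto (by omega) (SymSeq.tendsto_mulPadded_zero F m μ)
    | succ n => exact isLittleO_pow_of_tendsto (by omega) (SymSeq.tendsto_mulPadded F m n μ)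
  · intro hn μ
    obtain ⟨n, rfl⟩ := Nat.exists_eq_add_of_lt hn
    rw [zero_add, Nat.add_sub_cancel, ← add_assoc, Nat.add_sub_cancel, ← add_assoc,
      Nat.add_sub_cancel]
    exact isLittleO_sub_pow (SymSeq.tendsto_mulPadded F m n μ)
  · rintro rfl hm
    obtain ⟨m, rfl⟩ := Nat.exists_eq_add_of_lt hm
    rw [zero_add, Nat.add_sub_cancel]
    exact ⟨fun μ => SymSeq.leadingMul F (m + 1) μ, fun μ => Nat.cast_nonneg _,
      (congrArg Nat.cast (SymSeq.finrank_leadingOperator_bot F _)).trans Nat.cast_one,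
      fun μ => isLittleO_sub_pow (SymSeq.tendsto_mulPadded_zero F m μ)⟩
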